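/- **Theorem 4.1 (Unconditional Stability).** *Setting.* Let $d\ge 2$ and let $\Omega_f,\Omega_p\subset\mathbb R^d$ be disjoint bounded connected Lipschitz domains with interface $\Gamma=\overline\Omega_f\cap\overline\Omega_p$, such that $\partial\Omega_f\setminus\Gamma$ and $\partial\Omega_p\setminus\Gamma$ have positive surface measure; let $n_f$ be the outward unit normal of $\Omega_f$. Let $\nu,g,S_0>0$, $\mu_{BJS}\ge 0$, let $\mathbf K$ be a measurable field of symmetric matrices, bounded and uniformly positive definite on $\overline\Omega_p$, and let $\Pi=\nu\mathbf K/g$. Put $$H_f=\{v\in H^1(\Omega_f)^d: v|_{\partial\Omega_f\setminus\Gamma}=0\},\quad H_p=\{\psi\in H^1(\Omega_p):\psi|_{\partial\Omega_p\setminus\Gamma}=0\},\quad U=H_f\times H_p,\quad Q_f=L^2(\Omega_f).$$ For $\underline u=(u,\phi)$, $\underline v=(v,\psi)\in U$, $q\in Q_f$ and $F=(F_1,F_2)\in L^2(\Omega_f)^d\times L^2(\Omega_p)$ let $\mathbb D(u)=\frac12(\nabla u+\nabla u^{T})$, $P_\tau(u)=u-(u\cdot n_f)n_f$, and $$\langle\underline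 u,\underline v\rangle_0=(u,v)_{\Omega_f}+gS_0(\phi,\psi)_{\Omega_p},\quad \|\underline v\|_0^2=\langle\underline v,\underline v\rangle_0,\quad \|\underline v\|_U^2=\nu(\nabla v,\nabla v)_{\Omega_f}+g(\mathbf K\nabla\psi,\nabla\psi)_{\Omega_p},$$ $$a(\underline u,\underline v)=\nu(\mathbb D(u),\mathbb D(v))_{\Omega_f}+\Big(\tfrac{\mu_{BJS}\,\nu\sqrt d}{\sqrt{\operatorname{trace}\Pi}}P_\tau(u),v\Big)_\Gamma+g(\mathbf K\nabla\phi,\nabla\psi)_{\Omega_p}+g(\phi,v\cdot n_f)_\Gamma-g(\psi,u\cdot n_f)_\Gamma,$$ $$b(\underline v,q)=-(q,\nabla\cdot v)_{\Omega_f},\quad \langle F,\underline v\rangle=(F_1,v)_{\Omega_f}+g(F_2,\psi)_{\Omega_p},\quad \|F\|_{U'}=\sup_{0\ne\underline v\in U}\frac{\langle F,\underline v\rangle}{\|\underline v\|_U}.$$ *Scheme.* Let $\theta\in[0,1]$, let $0=t_0<t_1<\dots<t_N=T$, $k_n=t_{n+1}-t_n$, $\varepsilon_n=\frac{k_n-k_{n-1}}{k_n+k_{n-1}}$,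 and $$\alpha_2=\tfrac{\theta+1}2,\quad \alpha_1=-\theta,\quad \alpha_0=\tfrac{\theta-1}2,\qquad \beta_{1,n}=\tfrac12\Big(1-\tfrac{1-\theta^2}{(1+\varepsilon_n\theta)^2}\Big),$$ $$\beta_{2,n}=\tfrac14\Big(1+\tfrac{1-\theta^2}{(1+\varepsilon_n\theta)^2}+\varepsilon_n^2\tfrac{\theta(1-\theta^2)}{(1+\varepsilon_n\theta)^2}+\theta\Big),\quad \beta_{0,n}=\tfrac14\Big(1+\tfrac{1-\theta^2}{(1+\varepsilon_n\theta)^2}-\varepsilon_n^2\tfrac{\theta(1-\theta^2)}{(1+\varepsilon_n\theta)^2}-\theta\Big),$$ $$\lambda_{1,n}=-\frac{\sqrt{\theta(1-\theta^2)}}{\sqrt2\,(1+\varepsilon_n\theta)},\quad \lambda_{2,n}=-\tfrac{1-\varepsilon_n}2\lambda_{1,n},\quad \lambda_{0,n}=-\tfrac{1+\varepsilon_n}2\lambda_{1,n}.$$ Let $H_{fh}\subset H_f$, $H_{ph}\subset H_p$, $Q_{fh}\subset Q_f$ be linear subspaces (in particular, finite element spaces of any mesh diameter $h$), and let $V_h$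 be the set of $\underline v\in H_{fh}\times H_{ph}$ with $b(\underline v,q)=0$ for all $q\in Q_{fh}$. Let $F$ be a function of time with values in $L^2(\Omega_f)^d\times L^2(\Omega_p)$, and write $\underline u_{h,\beta}^n=\sum_{j=0}^2\beta_{j,n}\underline u_h^{n-1+j}$, $F_\beta^n=\sum_{j=0}^2\beta_{j,n}F(t_{n-1+j})$. A solution of the scheme is a family $\underline u_h^0,\dots,\underline u_h^N\in V_h$ such that, for $1\le n\le N-1$ and all $\underline v_h\in V_h$, $$\Big\langle\frac{\alpha_2\underline u_h^{n+1}+\alpha_1\underline u_h^{n}+\alpha_0\underline u_h^{n-1}}{\alpha_2k_n-\alpha_0k_{n-1}},\underline v_h\Big\rangle_0+a(\underline u_{h,\beta}^n,\underline v_h)=\langle F_\beta^n,\underline v_h\rangle .$$ *Claim.* There are constants $C(\theta),\widetilde C(\theta)\ge 0$ for $\theta\in[0,1]$, with $C(\theta)>0$ if $\theta<1$, which depend only on $\theta$, the domains and the physical data $\nu,g,S_0,\mu_{BJS},\mathbf K$ (in particular not on the subspaces, hence not on $h$, nor on the time steps, $T$, $N$, $F$ or the solution), such that every solution of the scheme satisfies,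 for all $2\le M\le N$, $$\tfrac14(1+\theta)\|\underline u_h^M\|_0^2+\tfrac14(1-\theta)\|\underline u_h^{M-1}\|_0^2+\sum_{n=1}^{M-1}\Big\|\sum_{j=0}^2\lambda_{j,n}\underline u_h^{n-1+j}\Big\|_0^2+C(\theta)\sum_{n=1}^{M-1}(k_n+k_{n-1})\|\underline u_{h,\beta}^n\|_U^2$$ $$\le\tfrac14(1+\theta)\|\underline u_h^1\|_0^2+\tfrac14(1-\theta)\|\underline u_h^0\|_0^2+\widetilde C(\theta)\sum_{n=1}^{N-1}(k_n+k_{n-1})\|F_\beta^n\|_{U'}^2 .$$ -/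

import Mathlib

open MeasureTheory Filter Topology Set
open scoped ENNReal NNReal ContDiff

noncomputable section

namespace StokesDarcy

/-! ### Domains, boundary measure, outward normal -/

/-- The Euclidean space `ℝ^d`. -/
abbrev Space (d : ℕ) := EuclideanSpace ℝ (Fin d)

/-- A bounded Lipschitz domain: a nonempty, connected, bounded open set which, in a ball around
each boundary point `x`, is the part of the ball strictly above the graph of a Lipschitz function
over the hyperplane orthogonal to a unit vector `e` (the "vertical" direction at `x`). -/
structure IsLipschitzDomain {d : ℕ} (Ω : Set (Space d)) : Prop where
  isOpen : IsOpen Ω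
  isConnected : IsConnected Ω
  isBounded : Bornology.IsBounded Ω
  graph : ∀ x ∈ frontier Ω, ∃ (e : Space d) (γ : Space d → ℝ) (L : ℝ≥0) (r : ℝ),
    ‖e‖ = 1 ∧ LipschitzWith L γ ∧ 0 < r ∧
      ∀ y ∈ Metric.ball x r, (y ∈ Ω ↔ γ (y - inner ℝ e y • e) < inner ℝ e y)

/-- The surface measure on `∂Ω`: the (Euclidean normalised) `(d-1)`-dimensional Hausdorff measure
restricted to the boundary. -/
def surface {d : ℕ} (Ω : Set (Space d)) : Measure (Space d) :=
  (Measure.euclideanHausdorffMeasure (d - 1)).restrict (frontier Ω)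

/-- `n` is the outward unit normal of `Ω` at `x`: near `x` and up to an error `o(‖y - x‖)`, the set
`Ω` is the half-space `{y | ⟪n, y - x⟫ < 0}`. -/
def IsOuterNormalAt {d : ℕ} (Ω : Set (Space d)) (x n : Space d) : Prop :=
  ‖n‖ = 1 ∧ ∀ ε : ℝ, 0 < ε → ∀ᶠ y in 𝓝 x,
    (ε * ‖y - x‖ < inner ℝ n (y - x) → y ∉ Ω) ∧
    (inner ℝ n (y - x) < -(ε * ‖y - x‖) → y ∈ Ω)

open Classical in
/-- The outward unit normal field of `Ω`. It is unique where it exists, which for a Lipschitz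
domain is almost everywhere on `∂Ω`; the value `0` is used on the exceptional null set. -/
def outerNormal {d : ℕ} (Ω : Set (Space d)) (x : Space d) : Space d :=
  if h : ∃ n, IsOuterNormalAt Ω x n then h.choose else 0

/-! ### The space `H¹(Ω)` -/

/-- `L²(Ω)`, with Mathlib's inner product `⟪f, g⟫ = ∫_Ω f g`. -/
abbrev L2 {d : ℕ} (Ω : Set (Space d)) := Lp ℝ 2 (volume.restrict Ω)

/-- The classical partial derivative `∂ᵢ φ`. -/
def pderiv {d : ℕ} (i : Fin d) (φ : Space d → ℝ) (x : Space d) : ℝ :=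
  fderiv ℝ φ x (EuclideanSpace.single i 1)

theorem memLp_test {d : ℕ} (Ω : Set (Space d)) {φ : Space d → ℝ} (h : ContDiff ℝ ∞ φ)
    (hc : HasCompactSupport φ) : MemLp φ 2 (volume.restrict Ω) :=
  (h.continuous.memLp_of_hasCompactSupport hc (μ := volume)).restrict Ω

theorem memLp_pderiv_test {d : ℕ} (Ω : Set (Space d)) {φ : Space d → ℝ} (h : ContDiff ℝ ∞ φ)
    (hc : HasCompactSupport φ) (i : Fin d) : MemLp (pderiv i φ) 2 (volume.restrict Ω) := by
  have h1 : Continuous (pderiv i φ) :=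
    (h.continuous_fderiv (by simp)).clm_apply continuous_const
  have h2 : HasCompactSupport (pderiv i φ) := hc.fderiv_apply (𝕜 := ℝ) _
  exact (h1.memLp_of_hasCompactSupport h2 (μ := volume)).restrict Ω

/-- `g` is the weak `i`-th partial derivative of `f` in `Ω`. -/
def HasWeakPDeriv {d : ℕ} (Ω : Set (Space d)) (i : Fin d) (f g : L2 Ω) : Prop :=
  ∀ φ : Space d → ℝ, ContDiff ℝ ∞ φ → HasCompactSupport φ → tsupport φ ⊆ Ω →
    ∫ x in Ω, f x * pderiv i φ x = - ∫ x in Ω, g x * φ x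

/-- The Sobolev space `H¹(Ω)`: the pairs `(f, (∂₁ f, …, ∂_d f))` of a square integrable function and
its square integrable weak partial derivatives. -/
def H1 {d : ℕ} (Ω : Set (Space d)) : Submodule ℝ (L2 Ω × (Fin d → L2 Ω)) where
  carrier := {u | ∀ i, HasWeakPDeriv Ω i u.1 (u.2 i)}
  add_mem' := by
    intro u v hu hv i φ h hc hs
    have e1 : ∀ (a b : L2 Ω) (ψ : Space d → ℝ), MemLp ψ 2 (volume.restrict Ω) →
        ∫ x in Ω, (a + b : L2 Ω) x * ψ x = (∫ x in Ω, a x * ψ x) + ∫ x in Ω, b x * ψ x := by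
      intro a b ψ hψ
      have ia : Integrable (fun x => a x * ψ x) (volume.restrict Ω) :=
        (Lp.memLp a).integrable_mul hψ
      have ib : Integrable (fun x => b x * ψ x) (volume.restrict Ω) :=
        (Lp.memLp b).integrable_mul hψ
      rw [← integral_add ia ib]
      refine integral_congr_ae ?_
      filter_upwards [Lp.coeFn_add a b] with x hx
      simp only [hx, Pi.add_apply, add_mul]
    have h1 := hu i φ h hc hs
    have h2 := hv i φ h hc hs
    have e2 := e1 u.1 v.1 _ (memLp_pderiv_test Ω h hc i)
    have e3 := e1 (u.2 i) (v.2 i) _ (memLp_test Ω h hc)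
    simp only [Prod.fst_add, Prod.snd_add, Pi.add_apply]
    rw [e2, e3, h1, h2]
    ring
  zero_mem' := by
    intro i φ h hc hs
    have e1 : ∀ (ψ : Space d → ℝ), ∫ x in Ω, (0 : L2 Ω) x * ψ x = 0 := by
      intro ψ
      rw [← integral_zero (Space d) ℝ (μ := volume.restrict Ω)]
      refine integral_congr_ae ?_
      filter_upwards [Lp.coeFn_zero ℝ 2 (volume.restrict Ω)] with x hx
      rw [hx, Pi.zero_apply, zero_mul]
    simp only [Prod.fst_zero, Prod.snd_zero, Pi.zero_apply]
    rw [e1, e1, neg_zero]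
  smul_mem' := by
    intro c u hu i φ h hc hs
    have e1 : ∀ (a : L2 Ω) (ψ : Space d → ℝ),
        ∫ x in Ω, (c • a : L2 Ω) x * ψ x = c * ∫ x in Ω, a x * ψ x := by
      intro a ψ
      rw [← integral_const_mul]
      refine integral_congr_ae ?_
      filter_upwards [Lp.coeFn_smul c a] with x hx
      simp only [hx, Pi.smul_apply, smul_eq_mul, mul_assoc]
    have h1 := hu i φ h hc hs
    simp only [Prod.smul_fst, Prod.smul_snd, Pi.smul_apply]
    rw [e1, e1, h1]
    ring

/-- The function underlying an element of `H¹(Ω)`. -/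
def fn {d : ℕ} {Ω : Set (Space d)} (u : H1 Ω) : L2 Ω := u.1.1

/-- The weak partial derivative `∂ᵢ u ∈ L²(Ω)`. -/
def grad {d : ℕ} {Ω : Set (Space d)} (u : H1 Ω) (i : Fin d) : L2 Ω := u.1.2 i

theorem fn_add {d : ℕ} {Ω : Set (Space d)} (u v : H1 Ω) : fn (u + v) = fn u + fn v := rfl

theorem grad_add {d : ℕ} {Ω : Set (Space d)} (u v : H1 Ω) (i : Fin d) :
    grad (u + v) i = grad u i + grad v i := rfl

theorem fn_smul {d : ℕ} {Ω : Set (Space d)} (c : ℝ) (u : H1 Ω) : fn (c • u) = c • fn u := rfl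

theorem grad_smul {d : ℕ} {Ω : Set (Space d)} (c : ℝ) (u : H1 Ω) (i : Fin d) :
    grad (c • u) i = c • grad u i := rfl

theorem fn_zero {d : ℕ} {Ω : Set (Space d)} : fn (0 : H1 Ω) = 0 := rfl

theorem grad_zero {d : ℕ} {Ω : Set (Space d)} (i : Fin d) : grad (0 : H1 Ω) i = 0 := rfl

/-! ### Boundary traces -/

/-- `g ∈ L²(∂Ω)` is the boundary trace of `u ∈ H¹(Ω)`: some sequence of smooth functions on `ℝ^d`
converges to `u` in `H¹(Ω)` and, restricted to `∂Ω`, to `g` in `L²(∂Ω)`. On a bounded Lipschitz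
domain every `u` has exactly one trace. -/
def IsTrace {d : ℕ} (Ω : Set (Space d)) (u : H1 Ω) (g : Lp ℝ 2 (surface Ω)) : Prop :=
  ∃ φ : ℕ → Space d → ℝ, (∀ m, ContDiff ℝ ∞ (φ m) ∧ HasCompactSupport (φ m)) ∧
    Tendsto (fun m => eLpNorm (fun x => φ m x - fn u x) 2 (volume.restrict Ω)) atTop (𝓝 0) ∧
    (∀ i, Tendsto (fun m => eLpNorm (fun x => pderiv i (φ m) x - grad u i x) 2
      (volume.restrict Ω)) atTop (𝓝 0)) ∧
    Tendsto (fun m => eLpNorm (fun x => φ m x - g x) 2 (surface Ω)) atTop (𝓝 0)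

open Classical in
/-- The boundary trace of `u ∈ H¹(Ω)` as a function on `∂Ω`. -/
def trace {d : ℕ} {Ω : Set (Space d)} (u : H1 Ω) : Space d → ℝ :=
  if h : ∃ g, IsTrace Ω u g then h.choose else 0

theorem pderiv_add {d : ℕ} (i : Fin d) {φ ψ : Space d → ℝ} (hφ : ContDiff ℝ ∞ φ)
    (hψ : ContDiff ℝ ∞ ψ) (x : Space d) :
    pderiv i (φ + ψ) x = pderiv i φ x + pderiv i ψ x := by
  unfold pderiv
  rw [fderiv_add (hφ.differentiable (by simp) x) (hψ.differentiable (by simp) x)]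
  rfl

theorem pderiv_smul {d : ℕ} (i : Fin d) (c : ℝ) {φ : Space d → ℝ} (hφ : ContDiff ℝ ∞ φ)
    (x : Space d) : pderiv i (c • φ) x = c * pderiv i φ x := by
  unfold pderiv
  rw [fderiv_const_smul (hφ.differentiable (by simp) x)]
  rfl

theorem continuous_pderiv {d : ℕ} (i : Fin d) {φ : Space d → ℝ} (hφ : ContDiff ℝ ∞ φ) :
    Continuous (pderiv i φ) :=
  (hφ.continuous_fderiv (by simp)).clm_apply continuous_const

theorem tendsto_aux_add {d : ℕ} {μ : Measure (Space d)} {p q : ℕ → Space d → ℝ} {a b : Lp ℝ 2 μ}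
    {r : ℕ → Space d → ℝ} (hp : ∀ m, Continuous (p m)) (hq : ∀ m, Continuous (q m))
    (hr : ∀ m x, r m x = p m x + q m x)
    (h1 : Tendsto (fun m => eLpNorm (fun x => p m x - a x) 2 μ) atTop (𝓝 0))
    (h2 : Tendsto (fun m => eLpNorm (fun x => q m x - b x) 2 μ) atTop (𝓝 0)) :
    Tendsto (fun m => eLpNorm (fun x => r m x - (a + b : Lp ℝ 2 μ) x) 2 μ) atTop (𝓝 0) := by
  have h3 := h1.add h2
  rw [add_zero] at h3
  refine tendsto_of_tendsto_of_tendsto_of_le_of_le tendsto_const_nhds h3 (fun _ => zero_le) ?_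
  intro m
  have e : eLpNorm (fun x => r m x - (a + b : Lp ℝ 2 μ) x) 2 μ
      = eLpNorm ((fun x => p m x - a x) + fun x => q m x - b x) 2 μ := by
    refine eLpNorm_congr_ae ?_
    filter_upwards [Lp.coeFn_add a b] with x hx
    simp only [hx, hr, Pi.add_apply]
    ring
  simp only [e]
  exact eLpNorm_add_le ((hp m).aestronglyMeasurable.sub (Lp.aestronglyMeasurable a))
    ((hq m).aestronglyMeasurable.sub (Lp.aestronglyMeasurable b)) (by norm_num)

theorem tendsto_aux_smul {d : ℕ} {μ : Measure (Space d)} (c : ℝ) {p : ℕ → Space d → ℝ}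
    {a : Lp ℝ 2 μ} {r : ℕ → Space d → ℝ} (hr : ∀ m x, r m x = c * p m x)
    (h1 : Tendsto (fun m => eLpNorm (fun x => p m x - a x) 2 μ) atTop (𝓝 0)) :
    Tendsto (fun m => eLpNorm (fun x => r m x - (c • a : Lp ℝ 2 μ) x) 2 μ) atTop (𝓝 0) := by
  have h3 := ENNReal.Tendsto.const_mul (a := ‖c‖ₑ) h1 (Or.inr (by simp))
  rw [mul_zero] at h3
  refine h3.congr fun m => ?_
  rw [← eLpNorm_const_smul]
  refine eLpNorm_congr_ae ?_
  filter_upwards [Lp.coeFn_smul c a] with x hx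
  simp only [hx, hr, Pi.smul_apply, smul_eq_mul]
  ring

theorem IsTrace.add {d : ℕ} {Ω : Set (Space d)} {u v : H1 Ω} {g k : Lp ℝ 2 (surface Ω)}
    (hu : IsTrace Ω u g) (hv : IsTrace Ω v k) : IsTrace Ω (u + v) (g + k) := by
  obtain ⟨p, hp, p1, p2, p3⟩ := hu
  obtain ⟨q, hq, q1, q2, q3⟩ := hv
  have cp := fun m => (hp m).1.continuous
  have cq := fun m => (hq m).1.continuous
  refine ⟨fun m => p m + q m, fun m => ⟨(hp m).1.add (hq m).1, (hp m).2.add (hq m).2⟩,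
    ?_, fun i => ?_, ?_⟩
  · rw [fn_add]
    exact tendsto_aux_add cp cq (fun _ _ => rfl) p1 q1
  · rw [grad_add]
    exact tendsto_aux_add (fun m => continuous_pderiv i (hp m).1)
      (fun m => continuous_pderiv i (hq m).1)
      (fun m x => pderiv_add i (hp m).1 (hq m).1 x) (p2 i) (q2 i)
  · exact tendsto_aux_add cp cq (fun _ _ => rfl) p3 q3

theorem IsTrace.smul {d : ℕ} {Ω : Set (Space d)} {u : H1 Ω} {g : Lp ℝ 2 (surface Ω)} (c : ℝ)
    (hu : IsTrace Ω u g) : IsTrace Ω (c • u) (c • g) := by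
  obtain ⟨p, hp, p1, p2, p3⟩ := hu
  refine ⟨fun m => c • p m, fun m => ⟨(hp m).1.const_smul c, (hp m).2.smul_left⟩,
    ?_, fun i => ?_, ?_⟩
  · rw [fn_smul]
    exact tendsto_aux_smul c (fun _ _ => rfl) p1
  · rw [grad_smul]
    exact tendsto_aux_smul c (fun m x => pderiv_smul i c (hp m).1 x) (p2 i)
  · exact tendsto_aux_smul c (fun _ _ => rfl) p3

theorem IsTrace.zero {d : ℕ} (Ω : Set (Space d)) : IsTrace Ω 0 0 := by
  have e : ∀ μ : Measure (Space d),
      Tendsto (fun _ : ℕ => eLpNorm (fun x => (0 : ℝ) - (0 : Lp ℝ 2 μ) x) 2 μ) atTop (𝓝 0) := by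
    intro μ
    have h0 : eLpNorm (fun x => (0 : ℝ) - (0 : Lp ℝ 2 μ) x) 2 μ = 0 := by
      rw [← eLpNorm_zero (p := 2) (μ := μ) (ε := ℝ) (α := Space d)]
      refine eLpNorm_congr_ae ?_
      filter_upwards [Lp.coeFn_zero ℝ 2 μ] with x hx
      rw [hx, Pi.zero_apply, sub_zero]
    rw [h0]
    exact tendsto_const_nhds
  have e2 : ∀ i, pderiv (d := d) i 0 = fun _ => 0 := by
    intro i
    funext x
    simp [pderiv]
  refine ⟨fun _ => 0, fun _ => ⟨contDiff_const, HasCompactSupport.zero⟩, ?_, fun i => ?_, e _⟩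
  · rw [fn_zero]
    exact e _
  · simp only [e2]
    rw [grad_zero]
    exact e _

/-- The functions in `H¹(Ω)` whose trace vanishes almost everywhere on `∂Ω \ Γ`. -/
def H1Zero {d : ℕ} (Ω Γ : Set (Space d)) : Submodule ℝ (H1 Ω) where
  carrier := {u | ∃ g, IsTrace Ω u g ∧ ∀ᵐ x ∂(surface Ω), x ∉ Γ → g x = 0}
  add_mem' := by
    rintro u v ⟨g, hg, g0⟩ ⟨k, hk, k0⟩
    refine ⟨g + k, hg.add hk, ?_⟩
    filter_upwards [g0, k0, Lp.coeFn_add g k] with x h1 h2 h3 hx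
    rw [h3, Pi.add_apply, h1 hx, h2 hx, add_zero]
  zero_mem' := by
    refine ⟨0, IsTrace.zero Ω, ?_⟩
    filter_upwards [Lp.coeFn_zero ℝ 2 (surface Ω)] with x h1 _
    rw [h1, Pi.zero_apply]
  smul_mem' := by
    rintro c u ⟨g, hg, g0⟩
    refine ⟨c • g, hg.smul c, ?_⟩
    filter_upwards [g0, Lp.coeFn_smul c g] with x h1 h3 hx
    rw [h3, Pi.smul_apply, h1 hx, smul_zero]

/-! ### The Stokes/Darcy model -/

/-- The data of the Stokes/Darcy model: the fluid region, the porous region, the physical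
parameters and the hydraulic conductivity tensor, a measurable field of symmetric matrices that is
bounded and uniformly positive definite on the closed porous region. -/
structure Model (d : ℕ) where
  /-- the fluid region -/
  Ωf : Set (Space d)
  /-- the porous media region -/
  Ωp : Set (Space d)
  lipschitz_f : IsLipschitzDomain Ωf
  lipschitz_p : IsLipschitzDomain Ωp
  disjoint : Disjoint Ωf Ωp
  /-- the part of `∂Ωf` that carries the no-slip condition is not negligible -/
  dirichlet_f : surface Ωf (frontier Ωf \ (closure Ωf ∩ closure Ωp)) ≠ 0
  /-- the part of `∂Ωp` that carries the homogeneous Dirichlet condition is not negligible -/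
  dirichlet_p : surface Ωp (frontier Ωp \ (closure Ωf ∩ closure Ωp)) ≠ 0
  /-- the kinematic viscosity -/
  ν : ℝ
  ν_pos : 0 < ν
  /-- the gravitational constant -/
  g : ℝ
  g_pos : 0 < g
  /-- the specific mass storativity coefficient -/
  S₀ : ℝ
  S₀_pos : 0 < S₀
  /-- the Beavers-Joseph-Saffman parameter -/
  μBJS : ℝ
  μBJS_nonneg : 0 ≤ μBJS
  /-- the hydraulic conductivity -/
  K : Space d → Matrix (Fin d) (Fin d) ℝ
  K_measurable : ∀ i j, Measurable fun x => K x i j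
  K_symm : ∀ x ∈ closure Ωp, (K x).IsSymm
  K_bounds : ∃ c C : ℝ, 0 < c ∧ ∀ x ∈ closure Ωp, ∀ ξ : Fin d → ℝ,
    c * ∑ i, ξ i ^ 2 ≤ ∑ i, ∑ j, K x i j * ξ j * ξ i ∧
    ∑ i, ∑ j, K x i j * ξ j * ξ i ≤ C * ∑ i, ξ i ^ 2

namespace Model

variable {d : ℕ} (S : Model d)

/-- The interface `Γ` between the two regions. -/
def Γ : Set (Space d) := closure S.Ωf ∩ closure S.Ωp

/-- The space `H_f` of fluid velocities: `H¹(Ωf)^d` with zero trace on `∂Ωf \ Γ`. -/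
abbrev Hf := Fin d → H1Zero S.Ωf S.Γ

/-- The space `H_p` of hydraulic heads: `H¹(Ωp)` with zero trace on `∂Ωp \ Γ`. -/
abbrev Hp := H1Zero S.Ωp S.Γ

/-- The product space `U = H_f × H_p`. -/
abbrev U := S.Hf × S.Hp

/-- The space `L²(Ωf)^d × L²(Ωp)` of the forces `(F₁, F₂)`. -/
abbrev Force := (Fin d → L2 S.Ωf) × L2 S.Ωp

/-- The inner product `⟨u, v⟩₀ = (u_f, v)_{Ωf} + g S₀ (φ, ψ)_{Ωp}`. -/
def inner0 (u v : S.U) : ℝ :=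
  ∑ i, inner ℝ (fn (u.1 i).1) (fn (v.1 i).1) + S.g * S.S₀ * inner ℝ (fn u.2.1) (fn v.2.1)

/-- The norm `‖·‖₀`. -/
def norm0 (v : S.U) : ℝ := √(S.inner0 v v)

/-- `a_{Ωp}(φ, ψ) = g (K ∇φ, ∇ψ)_{Ωp}`. -/
def aΩp (φ ψ : S.Hp) : ℝ :=
  S.g * ∫ x in S.Ωp, ∑ i, ∑ j, S.K x i j * grad φ.1 j x * grad ψ.1 i x

/-- The norm `‖v‖_U = (ν (∇v, ∇v)_{Ωf} + g (K ∇ψ, ∇ψ)_{Ωp})^{1/2}`. -/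
def normU (v : S.U) : ℝ :=
  √(S.ν * ∑ i, ∑ j, inner ℝ (grad (v.1 i).1 j) (grad (v.1 i).1 j) + S.aΩp v.2 v.2)

/-- The entry `(i, j)` of the deformation rate tensor `D(u) = (∇u + ∇ᵗu) / 2`. -/
def deform (u : S.Hf) (i j : Fin d) : L2 S.Ωf :=
  (1 / 2 : ℝ) • (grad (u i).1 j + grad (u j).1 i)

/-- The trace on `∂Ωf` of a fluid velocity. -/
def traceF (u : S.Hf) (x : Space d) : Space d := WithLp.toLp 2 fun i => trace (u i).1 x

/-- The unit normal `n_f` on the interface, pointing out of the fluid region. -/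
def nf (x : Space d) : Space d := outerNormal S.Ωf x

/-- The surface measure on the interface `Γ`. -/
def surfaceΓ : Measure (Space d) := (Measure.euclideanHausdorffMeasure (d - 1)).restrict S.Γ

/-- The projection `P_τ(w) = w - (w · n_f) n_f` onto the tangent plane of `Γ` at `x`. -/
def Pτ (x w : Space d) : Space d := w - inner ℝ w (S.nf x) • S.nf x

/-- The permeability `Π`, given by `K = Π g / ν`. -/
def permeability (x : Space d) : Matrix (Fin d) (Fin d) ℝ := (S.ν / S.g) • S.K x

/-- The coefficient `μ_BJS ν √d / √(trace Π)` of the Beavers-Joseph-Saffman condition. -/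
def coeffBJS (x : Space d) : ℝ := S.μBJS * S.ν * √d / √((S.permeability x).trace)

/-- `a_{Ωf}(u, v) = ν (D(u), D(v))_{Ωf} + (μ_BJS ν √d / √(trace Π) P_τ(u), v)_Γ`. -/
def aΩf (u v : S.Hf) : ℝ :=
  S.ν * ∑ i, ∑ j, inner ℝ (S.deform u i j) (S.deform v i j) +
    ∫ x, S.coeffBJS x * inner ℝ (S.Pτ x (S.traceF u x)) (S.traceF v x) ∂S.surfaceΓ

/-- `a_Γ(u, v) = g (φ, v · n_f)_Γ - g (ψ, u_f · n_f)_Γ`. -/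
def aΓ (u v : S.U) : ℝ :=
  S.g * ∫ x, trace u.2.1 x * inner ℝ (S.traceF v.1 x) (S.nf x) ∂S.surfaceΓ -
    S.g * ∫ x, trace v.2.1 x * inner ℝ (S.traceF u.1 x) (S.nf x) ∂S.surfaceΓ

/-- The bilinear form `a = a_{Ωf} + a_{Ωp} + a_Γ`. -/
def a (u v : S.U) : ℝ := S.aΩf u.1 v.1 + S.aΩp u.2 v.2 + S.aΓ u v

/-- The bilinear form `b(v, q) = -(q, ∇ · v)_{Ωf}`. -/
def b (v : S.U) (q : L2 S.Ωf) : ℝ := -inner ℝ q (∑ i, grad (v.1 i).1 i)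

/-- The pairing `⟨F, v⟩_{U'} = (F₁, v)_{Ωf} + g (F₂, ψ)_{Ωp}`. -/
def pairing (F : S.Force) (v : S.U) : ℝ :=
  ∑ i, inner ℝ (F.1 i) (fn (v.1 i).1) + S.g * inner ℝ F.2 (fn v.2.1)

/-- The dual norm `‖F‖_{U'} = sup_{v ≠ 0} ⟨F, v⟩ / ‖v‖_U`, a supremum in `[0, ∞]` (the space `U` is
symmetric under `v ↦ -v`, so that the negative values may be ignored). -/
def dualNorm (F : S.Force) : ℝ≥0∞ :=
  ⨆ (v : S.U) (_ : v ≠ 0), ENNReal.ofReal (S.pairing F v) / ENNReal.ofReal (S.normU v)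

/-- The divergence-free part `V_h = V_{fh} × H_{ph}` of `U_h = H_{fh} × H_{ph}`: the elements
`(v, ψ)` of `U_h` with `(∇ · v, q) = 0` for all `q ∈ Q_{fh}`. -/
def Vh (Hfh : Submodule ℝ S.Hf) (Qfh : Submodule ℝ (L2 S.Ωf)) (Hph : Submodule ℝ S.Hp) :
    Set S.U :=
  {v | v.1 ∈ Hfh ∧ v.2 ∈ Hph ∧ ∀ q ∈ Qfh, S.b v q = 0}

end Model

/-! ### The DLN coefficients -/

namespace DLN

/-- The time step `k_n = t_{n+1} - t_n`. -/
def step (t : ℕ → ℝ) (n : ℕ) : ℝ := t (n + 1) - t n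

/-- The step size parameter `ε_n = (k_n - k_{n-1}) / (k_n + k_{n-1})`, used for `n ≥ 1`. -/
def eps (t : ℕ → ℝ) (n : ℕ) : ℝ :=
  (step t n - step t (n - 1)) / (step t n + step t (n - 1))

/-- The coefficients `α₀, α₁, α₂`. -/
def α (θ : ℝ) : Fin 3 → ℝ := ![(θ - 1) / 2, -θ, (θ + 1) / 2]

/-- The coefficients `β₀, β₁, β₂` as functions of the step size parameter `e = ε_n`. -/
def β (θ e : ℝ) : Fin 3 → ℝ :=
  ![(1 / 4) * (1 + (1 - θ ^ 2) / (1 + e * θ) ^ 2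
      - e ^ 2 * (θ * (1 - θ ^ 2) / (1 + e * θ) ^ 2) - θ),
    (1 / 2) * (1 - (1 - θ ^ 2) / (1 + e * θ) ^ 2),
    (1 / 4) * (1 + (1 - θ ^ 2) / (1 + e * θ) ^ 2
      + e ^ 2 * (θ * (1 - θ ^ 2) / (1 + e * θ) ^ 2) + θ)]

/-- The coefficient `λ₁` of the numerical dissipation. -/
def lam1 (θ e : ℝ) : ℝ := -(√(θ * (1 - θ ^ 2)) / (√2 * (1 + e * θ)))

/-- The coefficients `λ₀, λ₁, λ₂` of the numerical dissipation, `e = ε_n`. -/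
def lam (θ e : ℝ) : Fin 3 → ℝ :=
  ![-((1 + e) / 2 * lam1 θ e), lam1 θ e, -((1 - e) / 2 * lam1 θ e)]

/-- The three-term combination `c₀ x_{n-1} + c₁ x_n + c₂ x_{n+1}`, used for `n ≥ 1`. -/
def comb {X : Type*} [AddCommGroup X] [Module ℝ X] (c : Fin 3 → ℝ) (x : ℕ → X) (n : ℕ) : X :=
  ∑ j : Fin 3, c j • x (n - 1 + j)

/-- The average time step `α₂ k_n - α₀ k_{n-1}`. -/
def avgStep (θ : ℝ) (t : ℕ → ℝ) (n : ℕ) : ℝ := α θ 2 * step t n - α θ 0 * step t (n - 1)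

/-- `0 = t_0 < t_1 < ⋯ < t_N = T`. -/
def IsPartition (t : ℕ → ℝ) (N : ℕ) (T : ℝ) : Prop :=
  t 0 = 0 ∧ t N = T ∧ ∀ n < N, t n < t (n + 1)

/-- `u_h^0, …, u_h^N` is a solution of the fully discrete variable-step DLN scheme with source term
`F`: all `u_h^n` belong to the discretely divergence-free space `V_h` and for `1 ≤ n ≤ N - 1` and
all `v ∈ V_h`,
`⟨(α₂ u_h^{n+1} + α₁ u_h^n + α₀ u_h^{n-1}) / (α₂ k_n - α₀ k_{n-1}), v⟩₀ + a(u_{h,β}^n, v)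
  = ⟨F_β^n, v⟩`. -/
def IsSolution {d : ℕ} (S : Model d) (Hfh : Submodule ℝ S.Hf) (Qfh : Submodule ℝ (L2 S.Ωf))
    (Hph : Submodule ℝ S.Hp) (θ : ℝ) (t : ℕ → ℝ) (N : ℕ) (F : ℝ → S.Force) (u : ℕ → S.U) : Prop :=
  (∀ n ≤ N, u n ∈ S.Vh Hfh Qfh Hph) ∧
  ∀ n, 1 ≤ n → n ≤ N - 1 → ∀ v ∈ S.Vh Hfh Qfh Hph,
    S.inner0 ((avgStep θ t n)⁻¹ • comb (α θ) u n) v + S.a (comb (β θ (eps t n)) u n) v =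
      S.pairing (comb (β θ (eps t n)) (fun m => F (t m)) n) v

/-- The energy `‖(y, z)‖²_{G(θ)} = (1 + θ) ‖y‖₀² / 4 + (1 - θ) ‖z‖₀² / 4`. -/
def energy {d : ℕ} (S : Model d) (θ : ℝ) (y z : S.U) : ℝ :=
  (1 / 4) * (1 + θ) * S.norm0 y ^ 2 + (1 / 4) * (1 - θ) * S.norm0 z ^ 2

end DLN

end StokesDarcy

end

open MeasureTheory Filter Topology Set
open scoped ENNReal NNReal ContDiff

noncomputable section

namespace StokesDarcy

/-! ### Energy inner product, coercivity and duality -/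

namespace Model

variable {d : ℕ} (S : Model d)

/-! Testing the scheme with `v = u_β` turns the difference quotient into an exact energy balance
(`g_stability`): the DLN coefficients are such that `⟨∑ α_j u_j, ∑ β_j u_j⟩₀` is a difference of two
consecutive energies plus the square of the `λ`-combination. The interface terms of `a` cancel on
the diagonal and friction is nonnegative, so `a(u_β, u_β) ≥ c ‖u_β‖_U²` as soon as Korn's inequality
holds in `H_f` with constant `c`. Young's inequality absorbs the load into half of this (`absorb`),
and summation over the steps telescopes. The constants come only from `c`, which concerns all of
`H_f` and hence no subspace or mesh.

The bulk of the work is Korn's inequality on a Lipschitz domain with a condition on part of the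
boundary (`korn_boundary`, `korn_H1Zero`). The rows of the gradient of a smooth field are projected
in `L²` onto the closure of gradients of test functions. Since `-∂_i u_j + δ_ij div u` is orthogonal
to that space, the projection is controlled by the symmetric gradient. The remainder `H` is row-wise
curl-free and divergence-free, so its entries are weakly harmonic; their first derivatives are
combinations of first derivatives of the symmetric part of `H`, which is small.

The mean value property turns this weak information into the scale-invariant bound `GradBound`, that
is, an estimate of the gradient weighted by the distance to the boundary. Hardy's inequality in
Lipschitz charts, together with chains of balls inside, converts it into closeness to a constant in
`L²` (`GradBound.lintegral_le`). Taking skew parts gives Korn's inequality modulo a constant skew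
matrix `A` (`korn_mod_rigid`).

The matrix `A` is removed by the boundary values. A nonzero skew matrix has rank at least two, so
its kernel is invisible to `(d-1)`-dimensional measure, and compactness bounds `A` by the
oscillation of `x ↦ A x` on the boundary piece. A Poincaré inequality for the values at the feet of
a tube bounds the oscillation of `u - A x` there, and `u` itself is small there when its trace
vanishes. -/

theorem inner0_add_left (u v w : S.U) : S.inner0 (u + v) w = S.inner0 u w + S.inner0 v w := by
  simp only [inner0, Prod.fst_add, Prod.snd_add, Pi.add_apply, Submodule.coe_add, fn_add,
    inner_add_left, Finset.sum_add_distrib]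
  ring

theorem inner0_smul_left (c : ℝ) (u w : S.U) : S.inner0 (c • u) w = c * S.inner0 u w := by
  simp only [inner0, Prod.smul_fst, Prod.smul_snd, Pi.smul_apply, Submodule.coe_smul, fn_smul,
    real_inner_smul_left, ← Finset.mul_sum]
  ring

theorem inner0_comm (u v : S.U) : S.inner0 u v = S.inner0 v u := by
  unfold inner0
  congr 1
  · exact Finset.sum_congr rfl fun i _ => real_inner_comm _ _
  · rw [real_inner_comm]

theorem inner0_add_right (u v w : S.U) : S.inner0 u (v + w) = S.inner0 u v + S.inner0 u w := by
  rw [inner0_comm, inner0_add_left, S.inner0_comm v, S.inner0_comm w]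

theorem inner0_smul_right (c : ℝ) (u w : S.U) : S.inner0 u (c • w) = c * S.inner0 u w := by
  rw [inner0_comm, inner0_smul_left, inner0_comm]

theorem inner0_self_nonneg (u : S.U) : 0 ≤ S.inner0 u u := by
  unfold inner0
  have h1 := S.g_pos
  have h2 := S.S₀_pos
  have h3 : 0 ≤ inner ℝ (fn u.2.1) (fn u.2.1) := real_inner_self_nonneg
  have h4 : 0 ≤ ∑ i, inner ℝ (fn (u.1 i).1) (fn (u.1 i).1) :=
    Finset.sum_nonneg fun i _ => real_inner_self_nonneg
  positivity

theorem norm0_sq (u : S.U) : S.norm0 u ^ 2 = S.inner0 u u :=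
  Real.sq_sqrt (S.inner0_self_nonneg u)

theorem aΩp_self_nonneg (ψ : S.Hp) : 0 ≤ S.aΩp ψ ψ := by
  refine mul_nonneg S.g_pos.le ?_
  obtain ⟨c, C, hc, hK⟩ := S.K_bounds
  refine setIntegral_nonneg S.lipschitz_p.isOpen.measurableSet fun x hx => ?_
  have h := (hK x (subset_closure hx) fun i => grad ψ.1 i x).1
  refine le_trans ?_ h
  positivity

theorem normU_sq (v : S.U) : S.normU v ^ 2 =
    S.ν * ∑ i, ∑ j, inner ℝ (grad (v.1 i).1 j) (grad (v.1 i).1 j) + S.aΩp v.2 v.2 := by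
  refine Real.sq_sqrt ?_
  have h1 := S.ν_pos
  have h2 := S.aΩp_self_nonneg v.2
  have h3 : 0 ≤ ∑ i, ∑ j, inner ℝ (grad (v.1 i).1 j) (grad (v.1 i).1 j) :=
    Finset.sum_nonneg fun i _ => Finset.sum_nonneg fun j _ => real_inner_self_nonneg
  positivity

/-- Only an inequality, because `outerNormal` takes the value `0` where no normal exists. -/
theorem outerNormal_norm_le (Ω : Set (Space d)) (x : Space d) : ‖outerNormal Ω x‖ ≤ 1 := by
  unfold outerNormal
  split_ifs with h
  · exact h.choose_spec.1.le
  · simp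

/-- Pointwise, `P_τ w · w = |w|² - (w · n)²`, which is nonnegative as soon as `|n| ≤ 1`; the
exceptional set of the normal needs no separate treatment. -/
theorem friction_nonneg (u : S.Hf) :
    0 ≤ ∫ x, S.coeffBJS x * inner ℝ (S.Pτ x (S.traceF u x)) (S.traceF u x) ∂S.surfaceΓ := by
  refine integral_nonneg fun x => ?_
  refine mul_nonneg ?_ ?_
  · have := S.μBJS_nonneg
    have := S.ν_pos
    unfold coeffBJS
    positivity
  · set w := S.traceF u x
    have h1 : |inner ℝ w (S.nf x)| ≤ ‖w‖ := by
      refine (abs_real_inner_le_norm _ _).trans ?_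
      have := outerNormal_norm_le S.Ωf x
      exact mul_le_of_le_one_right (norm_nonneg _) this
    unfold Pτ
    rw [inner_sub_left, real_inner_smul_left, real_inner_self_eq_norm_sq, real_inner_comm]
    have := sq_le_sq' (neg_le_of_abs_le h1) (le_of_abs_le h1)
    rw [real_inner_comm] at this
    nlinarith

/-- The coupling `aΓ` is skew-symmetric, so the interface contributes nothing to the energy. -/
theorem a_self (v : S.U) : S.a v v = S.aΩf v.1 v.1 + S.aΩp v.2 v.2 := by
  simp [a, aΓ]

/-- The condition `c ≤ 1` lets the Korn constant serve for the Darcy part too, where coercivity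
holds with constant one; friction is discarded. -/
theorem coercive {c : ℝ} (hc : c ≤ 1) (hK : ∀ u : S.Hf,
    c * ∑ i, ∑ j, inner ℝ (grad (u i).1 j) (grad (u i).1 j) ≤
      ∑ i, ∑ j, inner ℝ (S.deform u i j) (S.deform u i j)) (v : S.U) :
    c * S.normU v ^ 2 ≤ S.a v v := by
  rw [normU_sq, a_self]
  unfold aΩf
  have h1 := mul_le_mul_of_nonneg_left (hK v.1) S.ν_pos.le
  have h2 := S.friction_nonneg v.1
  have h3 := mul_le_of_le_one_left (S.aΩp_self_nonneg v.2) hc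
  linarith

theorem pairing_le (F : S.Force) (v : S.U) (hF : S.dualNorm F ≠ ⊤) :
    S.pairing F v ≤ (S.dualNorm F).toReal * S.normU v := by
  by_cases hv : v = 0
  · subst hv
    have : S.pairing F 0 = 0 := by simp [pairing, fn_zero]
    rw [this]
    have : 0 ≤ S.normU 0 := Real.sqrt_nonneg _
    positivity
  have h1 : ENNReal.ofReal (S.pairing F v) / ENNReal.ofReal (S.normU v) ≤ S.dualNorm F := by
    unfold dualNorm
    exact le_iSup₂_of_le v hv le_rfl
  have hn : 0 ≤ S.normU v := Real.sqrt_nonneg _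
  -- Positivity of `normU v` is not needed: if it vanished, a positive pairing would make the
  -- quotient, hence the dual norm, infinite.
  rw [ENNReal.div_le_iff_le_mul (Or.inr hF) (Or.inl ENNReal.ofReal_ne_top),
    ← ENNReal.ofReal_toReal hF, ← ENNReal.ofReal_mul ENNReal.toReal_nonneg] at h1
  exact (ENNReal.ofReal_le_ofReal_iff (by positivity)).1 h1

/-- The discretely divergence-free space as a subspace of `U`. -/
def VhSubmodule (Hfh : Submodule ℝ S.Hf) (Qfh : Submodule ℝ (L2 S.Ωf))
    (Hph : Submodule ℝ S.Hp) : Submodule ℝ S.U where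
  carrier := S.Vh Hfh Qfh Hph
  add_mem' := by
    rintro u v ⟨h1, h2, h3⟩ ⟨k1, k2, k3⟩
    refine ⟨Hfh.add_mem h1 k1, Hph.add_mem h2 k2, fun q hq => ?_⟩
    have e1 := h3 q hq
    have e2 := k3 q hq
    simp only [b, Prod.fst_add, Pi.add_apply, Submodule.coe_add, grad_add, Finset.sum_add_distrib,
      inner_add_right] at e1 e2 ⊢
    linarith
  zero_mem' := by
    refine ⟨Hfh.zero_mem, Hph.zero_mem, fun q _ => ?_⟩
    simp [b, grad_zero]
  smul_mem' := by
    rintro c u ⟨h1, h2, h3⟩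
    refine ⟨Hfh.smul_mem c h1, Hph.smul_mem c h2, fun q hq => ?_⟩
    have e1 := h3 q hq
    simp only [b, Prod.smul_fst, Pi.smul_apply, Submodule.coe_smul, grad_smul, ← Finset.smul_sum,
      real_inner_smul_right] at e1 ⊢
    linear_combination c * e1

end Model

/-! ### G-stability of the DLN method and the discrete energy estimate -/

namespace DLN

theorem comb_eq {X : Type*} [AddCommGroup X] [Module ℝ X] (c : Fin 3 → ℝ) (x : ℕ → X) {n : ℕ}
    (hn : 1 ≤ n) : comb c x n = c 0 • x (n - 1) + c 1 • x n + c 2 • x (n + 1) := by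
  obtain ⟨m, rfl⟩ := Nat.exists_eq_add_of_le' hn
  simp [comb, Fin.sum_univ_three, add_assoc]

/-- Both sides are linear in the Gram matrix of three vectors, so the identity is checked with its
entries `a_ij` as free variables. The `λ`-form is `λ₁²` times a form with polynomial coefficients;
with `s = (1 - θ²) / (1 + eθ)²` the coefficients `β` and `λ₁²` become polynomial in `s`, `e`, `θ`.
The range of `θ` matters only for squaring the root in `λ₁`. -/
theorem g_stability_scalar {θ e : ℝ} (hθ : θ ∈ Icc (0 : ℝ) 1) (he : 1 + e * θ ≠ 0)
    (a00 a01 a02 a11 a12 a22 : ℝ) :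
    α θ 0 * (β θ e 0 * a00 + β θ e 1 * a01 + β θ e 2 * a02) +
      α θ 1 * (β θ e 0 * a01 + β θ e 1 * a11 + β θ e 2 * a12) +
      α θ 2 * (β θ e 0 * a02 + β θ e 1 * a12 + β θ e 2 * a22) =
    ((1 / 4) * (1 + θ) * a22 + (1 / 4) * (1 - θ) * a11) -
      ((1 / 4) * (1 + θ) * a11 + (1 / 4) * (1 - θ) * a00) +
      (lam θ e 0 * (lam θ e 0 * a00 + lam θ e 1 * a01 + lam θ e 2 * a02) +
      lam θ e 1 * (lam θ e 0 * a01 + lam θ e 1 * a11 + lam θ e 2 * a12) +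
      lam θ e 2 * (lam θ e 0 * a02 + lam θ e 1 * a12 + lam θ e 2 * a22)) := by
  have hs : lam1 θ e ^ 2 = θ * (1 - θ ^ 2) / (2 * (1 + e * θ) ^ 2) := by
    have h0 : 0 ≤ θ * (1 - θ ^ 2) := mul_nonneg hθ.1 (by nlinarith [hθ.1, hθ.2])
    rw [lam1, neg_sq, div_pow, mul_pow, Real.sq_sqrt h0, Real.sq_sqrt (by norm_num)]
  have key : ∀ x, x = lam1 θ e ^ 2 → 
      (lam θ e 0 * (lam θ e 0 * a00 + lam θ e 1 * a01 + lam θ e 2 * a02) +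
      lam θ e 1 * (lam θ e 0 * a01 + lam θ e 1 * a11 + lam θ e 2 * a12) +
      lam θ e 2 * (lam θ e 0 * a02 + lam θ e 1 * a12 + lam θ e 2 * a22)) =
      x * (((1 + e) / 2) ^ 2 * a00 + a11 + ((1 - e) / 2) ^ 2 * a22 - (1 + e) * a01
        + (1 - e ^ 2) / 2 * a02 - (1 - e) * a12) := by
    rintro x rfl
    simp only [lam, Matrix.cons_val_zero, Matrix.cons_val_one, Matrix.cons_val]
    ring
  rw [key _ hs.symm]
  obtain ⟨s, h1⟩ : ∃ s, s = (1 - θ ^ 2) / (1 + e * θ) ^ 2 := ⟨_, rfl⟩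
  have h2 : θ * (1 - θ ^ 2) / (1 + e * θ) ^ 2 = θ * s := by rw [h1, mul_div_assoc]
  have h3 : θ * (1 - θ ^ 2) / (2 * (1 + e * θ) ^ 2) = θ * s / 2 := by
    rw [← h2, div_div, mul_comm (2 : ℝ)]
  have h4 : s * (1 + e * θ) ^ 2 = 1 - θ ^ 2 := by
    rw [h1, div_mul_cancel₀ _ (pow_ne_zero 2 he)]
  simp only [α, β, Matrix.cons_val_zero, Matrix.cons_val_one, Matrix.cons_val, h2, h3, ← h1]
  -- The two sides differ by a multiple of the relation `s (1 + eθ)² = 1 - θ²`.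
  linear_combination (-a00 / 8 + a01 / 4 - a12 / 4 + a22 / 8) * h4

theorem g_stability {d : ℕ} (S : Model d) {θ e : ℝ} (hθ : θ ∈ Icc (0 : ℝ) 1)
    (he : 1 + e * θ ≠ 0) (u : ℕ → S.U) {n : ℕ} (hn : 1 ≤ n) :
    S.inner0 (comb (α θ) u n) (comb (β θ e) u n) =
      energy S θ (u (n + 1)) (u n) - energy S θ (u n) (u (n - 1)) +
        S.norm0 (comb (lam θ e) u n) ^ 2 := by
  have h := g_stability_scalar hθ he (S.inner0 (u (n - 1)) (u (n - 1)))
    (S.inner0 (u (n - 1)) (u n)) (S.inner0 (u (n - 1)) (u (n + 1))) (S.inner0 (u n) (u n))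
    (S.inner0 (u n) (u (n + 1))) (S.inner0 (u (n + 1)) (u (n + 1)))
  have e1 := S.inner0_comm (u n) (u (n - 1))
  have e2 := S.inner0_comm (u (n + 1)) (u (n - 1))
  have e3 := S.inner0_comm (u (n + 1)) (u n)
  simp only [energy, S.norm0_sq, comb_eq _ _ hn, S.inner0_add_left, S.inner0_add_right,
    S.inner0_smul_left, S.inner0_smul_right, e1, e2, e3]
  linarith

/-- Young's inequality spends half of the coercivity on the load. The averaged step satisfies `(1 -
θ)/2 · (k + k') ≤ A ≤ k + k'`: the lower end produces the factor `1 - θ` in front of the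
dissipation, which degenerates at `θ = 1`, and the upper end keeps `θ` out of the constant of the
load. -/
theorem absorb {c θ k k' A X w p nU D : ℝ} (hc0 : 0 < c) (hk : 0 < k) (hk' : 0 < k')
    (θ0 : 0 ≤ θ) (θ1 : θ ≤ 1) (hA : A = (1 + θ) / 2 * k + (1 - θ) / 2 * k')
    (heq : A⁻¹ * X + w = p) (hco : c * nU ^ 2 ≤ w) (hp : p ≤ D * nU) :
    X + c * (1 - θ) / 4 * ((k + k') * nU ^ 2) ≤ 1 / (2 * c) * ((k + k') * D ^ 2) := by
  have hA1 : (1 - θ) / 2 * (k + k') ≤ A := by nlinarith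
  have hA2 : A ≤ k + k' := by nlinarith
  have hA0 : 0 < A := by nlinarith
  have hy : D * nU ≤ c / 2 * nU ^ 2 + 1 / (2 * c) * D ^ 2 := by
    have : c / 2 * nU ^ 2 + 1 / (2 * c) * D ^ 2 - D * nU = (c * nU - D) ^ 2 / (2 * c) := by
      field_simp
      ring
    have h2 : 0 ≤ (c * nU - D) ^ 2 / (2 * c) := by positivity
    linarith
  have h1 : A⁻¹ * X + c / 2 * nU ^ 2 ≤ 1 / (2 * c) * D ^ 2 := by linarith
  have h2 : X + A * (c / 2 * nU ^ 2) ≤ A * (1 / (2 * c) * D ^ 2) := by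
    have := mul_le_mul_of_nonneg_left h1 hA0.le
    rwa [mul_add, mul_inv_cancel_left₀ hA0.ne'] at this
  have h3 : (1 - θ) / 2 * (k + k') * (c / 2 * nU ^ 2) ≤ A * (c / 2 * nU ^ 2) :=
    mul_le_mul_of_nonneg_right hA1 (by positivity)
  have h4 : A * (1 / (2 * c) * D ^ 2) ≤ (k + k') * (1 / (2 * c) * D ^ 2) :=
    mul_le_mul_of_nonneg_right hA2 (by positivity)
  linarith

theorem step_estimate {d : ℕ} (S : Model d) {c : ℝ} (hc0 : 0 < c) (hc1 : c ≤ 1)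
    (hK : ∀ u : S.Hf, c * ∑ i, ∑ j, inner ℝ (grad (u i).1 j) (grad (u i).1 j) ≤
      ∑ i, ∑ j, inner ℝ (S.deform u i j) (S.deform u i j))
    {Hfh : Submodule ℝ S.Hf} {Qfh : Submodule ℝ (L2 S.Ωf)} {Hph : Submodule ℝ S.Hp} {θ : ℝ}
    (hθ : θ ∈ Icc (0 : ℝ) 1) {T : ℝ} {N : ℕ} {t : ℕ → ℝ} (ht : IsPartition t N T)
    {F : ℝ → S.Force} {u : ℕ → S.U} (hu : IsSolution S Hfh Qfh Hph θ t N F u) {n : ℕ}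
    (hn : 1 ≤ n) (hnN : n + 1 ≤ N)
    (hF : S.dualNorm (comb (β θ (eps t n)) (fun m => F (t m)) n) ≠ ⊤) :
    energy S θ (u (n + 1)) (u n) - energy S θ (u n) (u (n - 1)) +
        S.norm0 (comb (lam θ (eps t n)) u n) ^ 2 +
        c * (1 - θ) / 4 * ((step t n + step t (n - 1)) *
          S.normU (comb (β θ (eps t n)) u n) ^ 2) ≤
      1 / (2 * c) * ((step t n + step t (n - 1)) *
        (S.dualNorm (comb (β θ (eps t n)) (fun m => F (t m)) n)).toReal ^ 2) := by
  obtain ⟨θ0, θ1⟩ := hθ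
  have hk : 0 < step t n := sub_pos.2 (ht.2.2 n (by omega))
  have hk' : 0 < step t (n - 1) := by
    have := ht.2.2 (n - 1) (by omega)
    exact sub_pos.2 this
  -- Here `1 + ε_n = 2 k_n / (k_n + k_{n-1}) > 0`, and `1 + ε_n θ = (1 - θ) + θ (1 + ε_n)` is
  -- positive on the whole range of `θ`, endpoint `1` included.
  have he : 1 + eps t n * θ ≠ 0 := by
    have : 0 < 1 + eps t n := by
      unfold eps
      have : 1 + (step t n - step t (n - 1)) / (step t n + step t (n - 1)) =
        2 * step t n / (step t n + step t (n - 1)) := by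
        field_simp
        ring
      rw [this]
      positivity
    have : 0 < 1 + eps t n * θ := by
      have h1 : 0 ≤ (1 + eps t n) * θ := mul_nonneg this.le θ0
      rcases θ1.lt_or_eq with h | h
      · linarith
      · rw [h, mul_one]
        exact this
    exact this.ne'
  -- Since `V_h` is a linear space, `u_β` is itself admissible as a test function.
  have hV : comb (β θ (eps t n)) u n ∈ S.VhSubmodule Hfh Qfh Hph := by
    rw [comb_eq _ _ hn]
    have m0 : u (n - 1) ∈ S.VhSubmodule Hfh Qfh Hph := hu.1 _ (by omega)
    have m1 : u n ∈ S.VhSubmodule Hfh Qfh Hph := hu.1 _ (by omega)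
    have m2 : u (n + 1) ∈ S.VhSubmodule Hfh Qfh Hph := hu.1 _ (by omega)
    exact add_mem (add_mem (Submodule.smul_mem _ _ m0) (Submodule.smul_mem _ _ m1))
      (Submodule.smul_mem _ _ m2)
  have heq := hu.2 n hn (by omega) _ hV
  have hG := g_stability S ⟨θ0, θ1⟩ he u hn
  have hco := S.coercive hc1 hK (comb (β θ (eps t n)) u n)
  have hp := S.pairing_le _ (comb (β θ (eps t n)) u n) hF
  have e1 := S.inner0_smul_left (avgStep θ t n)⁻¹ (comb (α θ) u n) (comb (β θ (eps t n)) u n)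
  have hA : avgStep θ t n = (1 + θ) / 2 * step t n + (1 - θ) / 2 * step t (n - 1) := by
    simp only [avgStep, α, Matrix.cons_val_zero, Matrix.cons_val]
    ring
  refine (congrArg (· + _) hG.symm).trans_le ?_
  exact absorb hc0 hk hk' θ0 θ1 hA ((congrArg (· + _) e1.symm).trans heq) hco hp

theorem telescope {p q y z w : ℕ → ℝ} {a b : ℝ} {M : ℕ} (hpq : ∀ n, q (n + 1) = p n)
    (h : ∀ n, 1 ≤ n → n ≤ M → p n - q n + y n + a * z n ≤ b * w n) :
    p M + ∑ n ∈ Finset.Icc 1 M, y n + a * ∑ n ∈ Finset.Icc 1 M, z n ≤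
      p 0 + b * ∑ n ∈ Finset.Icc 1 M, w n := by
  induction M with
  | zero => simp
  | succ m ih =>
    have h1 := ih fun k hk hkm => h k hk (by omega)
    have h2 := h (m + 1) (by omega) le_rfl
    rw [hpq] at h2
    simp only [Finset.sum_Icc_succ_top (Nat.le_add_left 1 m)]
    linarith

/-- An infinite dual norm at one step makes the right side infinite, because every weight `k n` and
the factor `a` are positive. Otherwise the real inequality transfers, and the sum on the right may
be extended from `M` to `N`. -/
theorem ofReal_le_of_finite {E a L : ℝ} {k : ℕ → ℝ} {D : ℕ → ℝ≥0∞} {M N : ℕ} (hE : 0 ≤ E)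
    (ha : 0 < a) (hMN : M ≤ N) (hk : ∀ n ∈ Finset.Icc 1 N, 0 < k n)
    (h : (∀ n ∈ Finset.Icc 1 N, D n ≠ ⊤) →
      L ≤ E + a * ∑ n ∈ Finset.Icc 1 M, k n * (D n).toReal ^ 2) :
    ENNReal.ofReal L ≤ ENNReal.ofReal E +
      ENNReal.ofReal a * ∑ n ∈ Finset.Icc 1 N, ENNReal.ofReal (k n) * D n ^ 2 := by
  by_cases hF : ∃ n ∈ Finset.Icc 1 N, D n = ⊤
  · obtain ⟨n, hn, hT⟩ := hF
    have : ∑ n ∈ Finset.Icc 1 N, ENNReal.ofReal (k n) * D n ^ 2 = ⊤ := by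
      refine ENNReal.sum_eq_top.2 ⟨n, hn, ?_⟩
      rw [hT, ENNReal.top_pow two_ne_zero, ENNReal.mul_top]
      exact (ENNReal.ofReal_pos.2 (hk n hn)).ne'
    have h2 : ENNReal.ofReal a ≠ 0 := (ENNReal.ofReal_pos.2 ha).ne'
    rw [this, ENNReal.mul_top h2]
    simp
  push Not at hF
  have hsub := Finset.Icc_subset_Icc_right (a := 1) hMN
  have hs : ∀ n ∈ Finset.Icc 1 M, 0 ≤ k n * (D n).toReal ^ 2 := fun n hn => by
    have := hk n (hsub hn)
    positivity
  refine (ENNReal.ofReal_le_ofReal (h hF)).trans ?_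
  rw [ENNReal.ofReal_add hE (mul_nonneg ha.le (Finset.sum_nonneg hs)), ENNReal.ofReal_mul ha.le,
    ENNReal.ofReal_sum_of_nonneg hs]
  gcongr
  refine (Finset.sum_le_sum fun n hn => ?_).trans (Finset.sum_le_sum_of_subset hsub)
  rw [ENNReal.ofReal_mul (hk n (hsub hn)).le, ENNReal.ofReal_pow ENNReal.toReal_nonneg,
    ENNReal.ofReal_toReal (hF n (hsub hn))]

theorem stability_of_korn {d : ℕ} (S : Model d) {c : ℝ} (hc0 : 0 < c) (hc1 : c ≤ 1)
    (hK : ∀ u : S.Hf, c * ∑ i, ∑ j, inner ℝ (grad (u i).1 j) (grad (u i).1 j) ≤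
      ∑ i, ∑ j, inner ℝ (S.deform u i j) (S.deform u i j))
    {Hfh : Submodule ℝ S.Hf} {Qfh : Submodule ℝ (L2 S.Ωf)} {Hph : Submodule ℝ S.Hp} {θ : ℝ}
    (hθ : θ ∈ Icc (0 : ℝ) 1) {T : ℝ} {N : ℕ} {t : ℕ → ℝ} (ht : IsPartition t N T)
    {F : ℝ → S.Force} {u : ℕ → S.U} (hu : IsSolution S Hfh Qfh Hph θ t N F u) {M : ℕ}
    (hM2 : 2 ≤ M) (hMN : M ≤ N) :
    ENNReal.ofReal
      (energy S θ (u M) (u (M - 1)) +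
        ∑ n ∈ Finset.Icc 1 (M - 1), S.norm0 (comb (lam θ (eps t n)) u n) ^ 2 +
        c * (1 - θ) / 4 * ∑ n ∈ Finset.Icc 1 (M - 1),
          (step t n + step t (n - 1)) * S.normU (comb (β θ (eps t n)) u n) ^ 2) ≤
    ENNReal.ofReal (energy S θ (u 1) (u 0)) +
      ENNReal.ofReal (1 / (2 * c)) * ∑ n ∈ Finset.Icc 1 (N - 1),
        ENNReal.ofReal (step t n + step t (n - 1)) *
          S.dualNorm (comb (β θ (eps t n)) (fun m => F (t m)) n) ^ 2 := by
  have hpos : ∀ n ∈ Finset.Icc 1 (N - 1), 0 < step t n + step t (n - 1) := fun n hn => by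
    have hn' := Finset.mem_Icc.1 hn
    exact add_pos (sub_pos.2 (ht.2.2 n (by omega))) (sub_pos.2 (ht.2.2 (n - 1) (by omega)))
  have hE : 0 ≤ energy S θ (u 1) (u 0) := by
    have := hθ.1
    have : 0 ≤ 1 - θ := sub_nonneg.2 hθ.2
    unfold energy
    positivity
  have hc : 0 < 1 / (2 * c) := by positivity
  refine ofReal_le_of_finite (k := fun n => step t n + step t (n - 1))
    (D := fun n => S.dualNorm (comb (β θ (eps t n)) (fun m => F (t m)) n))
    hE hc (Nat.sub_le_sub_right hMN 1) hpos fun hF => ?_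
  have hM : M - 1 + 1 = M := by omega
  -- With `p n` the energy after step `n` and `q n` the one before it, only `q (n + 1)` is compared
  -- with `p`, so the truncated `n - 1` at `n = 0` plays no role.
  have h1 := telescope (p := fun n => energy S θ (u (n + 1)) (u n))
    (q := fun n => energy S θ (u n) (u (n - 1))) (M := M - 1)
    (fun n => by simp only [Nat.add_sub_cancel]) fun n hn hnM =>
    step_estimate S hc0 hc1 hK hθ ht hu hn (by omega) (hF _ (Finset.mem_Icc.2 (by omega)))
  simp only [hM, zero_add] at h1
  exact h1

end DLN

/-! ### Hardy's inequality -/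

theorem ennreal_add_sq_le (a b : ℝ≥0∞) : (a + b) ^ 2 ≤ 2 * (a ^ 2 + b ^ 2) := by
  by_cases ha : a = ⊤
  · simp [ha]
  by_cases hb : b = ⊤
  · simp [hb]
  lift a to ℝ≥0 using ha
  lift b to ℝ≥0 using hb
  exact_mod_cast add_sq_le (a := a) (b := b)

theorem lintegral_mul_sq_le {α : Type*} [MeasurableSpace α] {μ : Measure α} {f g : α → ℝ≥0∞}
    (hf : AEMeasurable f μ) (hg : AEMeasurable g μ) :
    (∫⁻ x, f x * g x ∂μ) ^ 2 ≤ (∫⁻ x, f x ^ 2 ∂μ) * ∫⁻ x, g x ^ 2 ∂μ := by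
  have h := ENNReal.lintegral_mul_norm_pow_le (μ := μ) (hf.pow_const 2) (hg.pow_const 2)
    (p := 1 / 2) (q := 1 / 2) (by norm_num) (by norm_num) (by norm_num)
  have e : ∀ a : ℝ≥0∞, (a ^ 2) ^ (1 / 2 : ℝ) = a := fun a => by
    rw [← ENNReal.rpow_natCast, ← ENNReal.rpow_mul]
    norm_num
  have e' : ∀ a : ℝ≥0∞, (a ^ (1 / 2 : ℝ)) ^ 2 = a := fun a => by
    rw [← ENNReal.rpow_natCast, ← ENNReal.rpow_mul]
    norm_num
  simp only [e] at h
  refine (pow_le_pow_left' h 2).trans ?_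
  rw [mul_pow, e', e']

theorem lintegral_sq_le {α : Type*} [MeasurableSpace α] {μ : Measure α} {f : α → ℝ≥0∞}
    (hf : AEMeasurable f μ) : (∫⁻ x, f x ∂μ) ^ 2 ≤ μ univ * ∫⁻ x, f x ^ 2 ∂μ := by
  simpa using lintegral_mul_sq_le (μ := μ) (f := fun _ => 1) aemeasurable_const hf

/-- The exponent `-3/2` is twice the weight `-3/4` used for Cauchy–Schwarz in `hardy`. -/
theorem lintegral_rpow_tail {h : ℝ} (hh : 0 < h) :
    ∫⁻ t in Ioi (0 : ℝ), ENNReal.ofReal ((h + t) ^ (-3 / 2 : ℝ)) =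
      ENNReal.ofReal (2 * h ^ (-1 / 2 : ℝ)) := by
  have h1 := integral_Ioi_rpow_of_lt (a := -3 / 2) (by norm_num) hh
  have h2 := integrableOn_Ioi_rpow_of_lt (a := -3 / 2) (by norm_num) hh
  have h3 := ofReal_integral_eq_lintegral_ofReal h2
    ((ae_restrict_mem measurableSet_Ioi).mono fun t ht =>
      Real.rpow_nonneg (hh.le.trans (le_of_lt ht)) _)
  rw [h1] at h3
  have h4 : -h ^ (-3 / 2 + 1 : ℝ) / (-3 / 2 + 1) = 2 * h ^ (-1 / 2 : ℝ) := by
    norm_num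
    ring
  rw [← h4, h3, ← lintegral_indicator measurableSet_Ioi, ← lintegral_indicator measurableSet_Ioi]
  conv_rhs => rw [← lintegral_add_left_eq_self _ h]
  refine lintegral_congr fun t => ?_
  by_cases ht : 0 < t
  · rw [indicator_of_mem (mem_Ioi.2 ht), indicator_of_mem (mem_Ioi.2 (by linarith))]
  · rw [indicator_of_notMem (by simpa using ht), indicator_of_notMem (by simpa using ht)]

theorem lintegral_rpow_head {h : ℝ} (hh : 0 < h) :
    ∫⁻ t in Ioo (0 : ℝ) h, ENNReal.ofReal ((h - t) ^ (-1 / 2 : ℝ)) =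
      ENNReal.ofReal (2 * h ^ (1 / 2 : ℝ)) := by
  have h1 : ∫ x in (0 : ℝ)..h, x ^ (-1 / 2 : ℝ) = 2 * h ^ (1 / 2 : ℝ) := by
    rw [integral_rpow (Or.inl (by norm_num)), Real.zero_rpow (by norm_num)]
    norm_num
    ring
  have h2 := (intervalIntegral.intervalIntegrable_rpow' (a := 0) (b := h) (r := -1 / 2)
    (by norm_num)).1
  rw [intervalIntegral.integral_of_le hh.le] at h1
  have h3 := ofReal_integral_eq_lintegral_ofReal h2
    ((ae_restrict_mem measurableSet_Ioc).mono fun t ht => Real.rpow_nonneg ht.1.le _)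
  rw [← h1, h3, setLIntegral_congr (Ioo_ae_eq_Ioc (a := (0 : ℝ)) (b := h)).symm,
    ← lintegral_indicator measurableSet_Ioo, ← lintegral_indicator measurableSet_Ioo]
  conv_rhs => rw [← lintegral_sub_left_eq_self _ h]
  refine lintegral_congr fun t => ?_
  by_cases ht : t ∈ Ioo 0 h
  · rw [indicator_of_mem (a := h - t) (s := Ioo 0 h) ⟨by linarith [ht.2], by linarith [ht.1]⟩,
      indicator_of_mem ht]
  · rw [indicator_of_notMem ht, indicator_of_notMem]
    exact fun h' => ht ⟨by linarith [h'.2], by linarith [h'.1]⟩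

/-- Hardy's inequality along the direction `v`, in the region `0 < h`. -/
theorem hardy {E : Type*} [NormedAddCommGroup E] [NormedSpace ℝ E] [MeasurableSpace E]
    [BorelSpace E] [FiniteDimensional ℝ E] {μ : Measure E} [μ.IsAddHaarMeasure]
    {h : E → ℝ} (hm : Measurable h) {v : E} (hv : ∀ x t, h (x + t • v) = h x + t)
    {F : E → ℝ≥0∞} (hF : Measurable F) :
    ∫⁻ x in {x | 0 < h x}, (∫⁻ t in Ioi (0 : ℝ), F (x + t • v)) ^ 2 ∂μ ≤
      4 * ∫⁻ x in {x | 0 < h x}, ENNReal.ofReal (h x) ^ 2 * F x ^ 2 ∂μ := by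
  have hW : MeasurableSet {x | 0 < h x} := measurableSet_lt measurable_const hm
  -- Cauchy–Schwarz along the ray with the weights `(h + t)^(-3/4)` and `(h + t)^(3/4)`; the first
  -- factor integrates to `2 h^(-1/2)`.
  have step1 : ∀ x ∈ {x | 0 < h x}, (∫⁻ t in Ioi (0 : ℝ), F (x + t • v)) ^ 2 ≤
      ∫⁻ t in Ioi (0 : ℝ), ENNReal.ofReal (2 * h x ^ (-1 / 2 : ℝ)) *
        (ENNReal.ofReal ((h (x + t • v)) ^ (3 / 2 : ℝ)) * F (x + t • v) ^ 2) := by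
    intro x hx
    have hx' : 0 < h x := hx
    have e : ∫⁻ t in Ioi (0 : ℝ), F (x + t • v) = ∫⁻ t in Ioi (0 : ℝ),
        ENNReal.ofReal ((h x + t) ^ (-3 / 4 : ℝ)) *
          (ENNReal.ofReal ((h x + t) ^ (3 / 4 : ℝ)) * F (x + t • v)) := by
      refine setLIntegral_congr_fun measurableSet_Ioi fun t ht => ?_
      have ht' : 0 < h x + t := add_pos hx' ht
      rw [← mul_assoc, ← ENNReal.ofReal_mul (by positivity), ← Real.rpow_add ht']
      norm_num
    rw [e]
    refine (lintegral_mul_sq_le (by fun_prop) (by fun_prop)).trans ?_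
    have e1 : ∫⁻ t in Ioi (0 : ℝ), ENNReal.ofReal ((h x + t) ^ (-3 / 4 : ℝ)) ^ 2 =
        ENNReal.ofReal (2 * h x ^ (-1 / 2 : ℝ)) := by
      rw [← lintegral_rpow_tail hx']
      refine setLIntegral_congr_fun measurableSet_Ioi fun t ht => ?_
      have ht' : 0 < h x + t := add_pos hx' ht
      rw [← ENNReal.ofReal_pow (by positivity), ← Real.rpow_natCast, ← Real.rpow_mul ht'.le]
      norm_num
    rw [e1, ← lintegral_const_mul _ (by fun_prop)]
    refine le_of_eq (setLIntegral_congr_fun measurableSet_Ioi fun t ht => ?_)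
    have ht' : 0 < h x + t := add_pos hx' ht
    rw [mul_pow, ← ENNReal.ofReal_pow (by positivity), ← Real.rpow_natCast,
      ← Real.rpow_mul ht'.le, hv]
    norm_num
  refine (setLIntegral_mono' hW step1).trans ?_
  rw [lintegral_lintegral_swap (by fun_prop)]
  -- Translation by `t • v` moves the function to the fixed point `y`, after which the remaining
  -- weight can be integrated in `t` alone.
  have step2 : ∀ t : ℝ, ∫⁻ x in {x | 0 < h x}, ENNReal.ofReal (2 * h x ^ (-1 / 2 : ℝ)) *
        (ENNReal.ofReal ((h (x + t • v)) ^ (3 / 2 : ℝ)) * F (x + t • v) ^ 2) ∂μ =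
      ∫⁻ y, {y | t < h y}.indicator (fun y => ENNReal.ofReal (2 * (h y - t) ^ (-1 / 2 : ℝ)) *
        (ENNReal.ofReal ((h y) ^ (3 / 2 : ℝ)) * F y ^ 2)) y ∂μ := by
    intro t
    rw [← lintegral_indicator hW]
    conv_rhs => rw [← lintegral_add_right_eq_self _ (t • v)]
    refine lintegral_congr fun x => ?_
    have e1 : h (x + t • v) - t = h x := by rw [hv]; ring
    by_cases hx : 0 < h x
    · rw [indicator_of_mem (by exact hx), indicator_of_mem (by simp [hv, hx]), e1]
    · rw [indicator_of_notMem (by exact hx), indicator_of_notMem (by simpa [hv] using hx)]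
  simp only [step2]
  have hmeas : Measurable (Function.uncurry fun (t : ℝ) (y : E) => {y | t < h y}.indicator
      (fun y => ENNReal.ofReal (2 * (h y - t) ^ (-1 / 2 : ℝ)) *
        (ENNReal.ofReal ((h y) ^ (3 / 2 : ℝ)) * F y ^ 2)) y) := by
    have : (Function.uncurry fun (t : ℝ) (y : E) => {y | t < h y}.indicator
      (fun y => ENNReal.ofReal (2 * (h y - t) ^ (-1 / 2 : ℝ)) *
        (ENNReal.ofReal ((h y) ^ (3 / 2 : ℝ)) * F y ^ 2)) y) =
        {q : ℝ × E | q.1 < h q.2}.indicator fun q =>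
          ENNReal.ofReal (2 * (h q.2 - q.1) ^ (-1 / 2 : ℝ)) *
            (ENNReal.ofReal ((h q.2) ^ (3 / 2 : ℝ)) * F q.2 ^ 2) := by
      ext ⟨t, y⟩
      simp [indicator]
    rw [this]
    refine Measurable.indicator (by fun_prop) (measurableSet_lt (by fun_prop) (by fun_prop))
  rw [lintegral_lintegral_swap hmeas.aemeasurable, ← lintegral_const_mul' _ _ (by norm_num),
    ← lintegral_indicator hW]
  refine lintegral_mono fun y => ?_
  simp only
  by_cases hy : 0 < h y
  · rw [indicator_of_mem (by exact hy)]
    have e : ∀ t, {y | t < h y}.indicator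
        (fun y => ENNReal.ofReal (2 * (h y - t) ^ (-1 / 2 : ℝ)) *
          (ENNReal.ofReal ((h y) ^ (3 / 2 : ℝ)) * F y ^ 2)) y =
        (Iio (h y)).indicator (fun t => ENNReal.ofReal ((h y - t) ^ (-1 / 2 : ℝ)) *
          (2 * (ENNReal.ofReal ((h y) ^ (3 / 2 : ℝ)) * F y ^ 2))) t := by
      intro t
      by_cases ht : t < h y
      · rw [indicator_of_mem (by exact ht), indicator_of_mem (by exact ht),
          ENNReal.ofReal_mul (by norm_num)]
        norm_num
        ring
      · rw [indicator_of_notMem (by exact ht), indicator_of_notMem (by exact ht)]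
    simp only [e]
    rw [setLIntegral_indicator measurableSet_Iio, inter_comm, Ioi_inter_Iio,
      lintegral_mul_const _ (by fun_prop), lintegral_rpow_head hy]
    -- The constant is `2 · 2`, one factor from each weight integral, and the powers combine as `1/2
    -- + 3/2 = 2`.
    have e2 : ENNReal.ofReal (2 * h y ^ (1 / 2 : ℝ)) *
        (2 * (ENNReal.ofReal (h y ^ (3 / 2 : ℝ)) * F y ^ 2)) =
        4 * (ENNReal.ofReal (h y ^ (1 / 2 : ℝ)) * ENNReal.ofReal (h y ^ (3 / 2 : ℝ)) * F y ^ 2) := by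
      rw [ENNReal.ofReal_mul (by norm_num), ENNReal.ofReal_ofNat]
      ring
    rw [e2, ← ENNReal.ofReal_mul (by positivity), ← Real.rpow_add hy,
      ← ENNReal.ofReal_pow hy.le]
    norm_num
  · rw [indicator_of_notMem (by exact hy)]
    refine le_of_eq ?_
    rw [← lintegral_zero (μ := volume.restrict (Ioi (0 : ℝ)))]
    refine setLIntegral_congr_fun measurableSet_Ioi fun t ht => ?_
    have ht' : 0 < t := ht
    exact indicator_of_notMem (by simp; linarith) _

/-! ### Local charts of Lipschitz domains -/

/-- Near a boundary point, a Lipschitz domain is the set where a Lipschitz height function, which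
grows with unit speed along a unit vector, is positive. -/
theorem IsLipschitzDomain.exists_chart {d : ℕ} {Ω : Set (Space d)} (hΩ : IsLipschitzDomain Ω)
    {p : Space d} (hp : p ∈ frontier Ω) :
    ∃ (v : Space d) (h : Space d → ℝ) (K : ℝ≥0) (r : ℝ), ‖v‖ = 1 ∧ LipschitzWith K h ∧ 1 ≤ K ∧
      0 < r ∧ (∀ y t, h (y + t • v) = h y + t) ∧ h p = 0 ∧
      ∀ y ∈ Metric.ball p r, (y ∈ Ω ↔ 0 < h y) := by
  obtain ⟨v, γ, L, r, hv, hγ, hr, hgr⟩ := hΩ.graph p hp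
  have hvv : inner ℝ v v = (1 : ℝ) := by rw [real_inner_self_eq_norm_sq, hv, one_pow]
  have hl : LipschitzWith (1 + L * 2) fun y => inner ℝ v y - γ (y - inner ℝ v y • v) := by
    have h1 : LipschitzWith 1 fun y : Space d => (inner ℝ v y : ℝ) := by
      refine LipschitzWith.of_dist_le_mul fun x y => ?_
      rw [Real.dist_eq, ← inner_sub_right, dist_eq_norm, NNReal.coe_one, one_mul]
      simpa [hv] using abs_real_inner_le_norm v (x - y)
    have h2 : LipschitzWith 2 fun y : Space d => y - (inner ℝ v y : ℝ) • v := by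
      have h3 : LipschitzWith 1 fun y : Space d => (inner ℝ v y : ℝ) • v := by
        refine LipschitzWith.of_dist_le_mul fun x y => ?_
        rw [dist_eq_norm, ← sub_smul, norm_smul, hv, mul_one, ← dist_eq_norm]
        exact h1.dist_le_mul x y
      simpa [one_add_one_eq_two] using LipschitzWith.id.sub h3
    exact h1.sub (hγ.comp h2)
  have hgr' : ∀ y ∈ Metric.ball p r, (y ∈ Ω ↔ 0 < inner ℝ v y - γ (y - inner ℝ v y • v)) :=
    fun y hy => by rw [hgr y hy, sub_pos]
  refine ⟨v, fun y => inner ℝ v y - γ (y - inner ℝ v y • v), _, r, hv, hl, le_self_add, hr,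
    fun y t => ?_, ?_, hgr'⟩
  · simp only [inner_add_right, real_inner_smul_right, hvv, mul_one, add_smul,
      add_sub_add_right_eq_sub]
    ring
  -- The value at `p` is not positive because `p` lies outside the open set, and not negative
  -- because `p` is a limit of points of `Ω`.
  · refine le_antisymm ?_ ?_
    · rw [← not_lt, ← hgr' p (Metric.mem_ball_self hr)]
      rw [hΩ.isOpen.frontier_eq] at hp
      exact hp.2
    · have : (𝓝[Ω] p).NeBot := mem_closure_iff_nhdsWithin_neBot.1 (frontier_subset_closure hp)
      refine ge_of_tendsto ((hl.continuous.tendsto p).mono_left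
        (nhdsWithin_le_nhds (s := Ω))) ?_
      filter_upwards [self_mem_nhdsWithin, nhdsWithin_le_nhds (Metric.ball_mem_nhds p hr)]
        with y h1 h2
      exact ((hgr' y h2).1 h1).le

/-- The derivative of `f` is controlled at every scale by the means of `e`. -/
structure GradBound {d : ℕ} (Ω : Set (Space d)) (f : Space d → ℝ) (e : Space d → ℝ≥0∞) :
    Prop where
  contDiffOn : ContDiffOn ℝ 1 f Ω
  measurable : Measurable e
  bound : ∀ x ε, 0 < ε → Metric.closedBall x ε ⊆ Ω →
    ENNReal.ofReal ε ^ (d + 2) * ‖fderiv ℝ f x‖ₑ ^ 2 ≤ ∫⁻ y in Metric.ball x ε, e y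

theorem enorm_sub_sq_le {a b c : ℝ} :
    ‖a - c‖ₑ ^ 2 ≤ 2 * (‖a - b‖ₑ ^ 2 + ‖b - c‖ₑ ^ 2) := by
  refine le_trans ?_ (ennreal_add_sq_le _ _)
  gcongr
  have : a - c = (a - b) + (b - c) := by ring
  rw [this]
  exact enorm_add_le _ _

/-! ### Oscillation in the interior by chains of balls -/

namespace GradBound

variable {d : ℕ} {Ω : Set (Space d)} {f : Space d → ℝ} {e : Space d → ℝ≥0∞}

/-- Every `z` in the ball of radius `r` is the centre of a ball of radius `r` inside `Ω`, so the
gradient is at most `√(E / r^(d+2))` there, and the mean value inequality gains another `r`. -/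
theorem sub_le_of_closedBall (hf : GradBound Ω f e) (hΩ : IsOpen Ω) {x y : Space d} {r : ℝ}
    (hr : 0 < r) (hx : Metric.closedBall x (2 * r) ⊆ Ω) (hy : y ∈ Metric.ball x r) :
    ‖f y - f x‖ₑ ^ 2 ≤ (ENNReal.ofReal r ^ d)⁻¹ * ∫⁻ z in Ω, e z := by
  set E := ∫⁻ z in Ω, e z with hE
  have hr0 : ENNReal.ofReal r ≠ 0 := (ENNReal.ofReal_pos.2 hr).ne'
  by_cases hE' : E = ⊤
  · rw [hE', ENNReal.mul_top]
    · exact le_top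
    · exact ENNReal.inv_ne_zero.2 (ENNReal.pow_ne_top ENNReal.ofReal_ne_top)
  have hg : ∀ z ∈ Metric.ball x r, ‖fderiv ℝ f z‖ ≤ √(E.toReal / r ^ (d + 2)) := by
    intro z hz
    have hsub : Metric.closedBall z r ⊆ Ω := by
      refine (Metric.closedBall_subset_closedBall' ?_).trans hx
      have := (Metric.mem_ball.1 hz).le
      linarith
    have h1 := (hf.bound z r hr hsub).trans
      (lintegral_mono_set (Metric.ball_subset_closedBall.trans hsub))
    refine Real.le_sqrt_of_sq_le ?_
    rw [le_div_iff₀ (by positivity), mul_comm]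
    have h2 := ENNReal.toReal_mono hE' h1
    simpa [ENNReal.toReal_mul, ENNReal.toReal_ofReal hr.le] using h2
  have hd : ∀ z ∈ Metric.ball x r, DifferentiableAt ℝ f z := fun z hz =>
    (hf.contDiffOn.differentiableOn one_ne_zero).differentiableAt (hΩ.mem_nhds
      (hx (Metric.closedBall_subset_closedBall (by linarith) (Metric.ball_subset_closedBall hz))))
  have h1 := Convex.norm_image_sub_le_of_norm_fderiv_le hd hg (convex_ball x r)
    (Metric.mem_ball_self hr) hy
  have h2 : ‖f y - f x‖ ^ 2 ≤ E.toReal / r ^ d := by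
    have h3 : ‖y - x‖ ≤ r := by
      rw [← dist_eq_norm]
      exact (Metric.mem_ball.1 hy).le
    calc ‖f y - f x‖ ^ 2 ≤ (√(E.toReal / r ^ (d + 2)) * r) ^ 2 := by
          gcongr
          exact h1.trans (by gcongr)
      _ = E.toReal / r ^ d := by
          rw [mul_pow, Real.sq_sqrt (by positivity), pow_add]
          field_simp
  rw [← ofReal_norm, ← ENNReal.ofReal_pow (norm_nonneg _)]
  refine (ENNReal.ofReal_le_ofReal h2).trans ?_
  rw [div_eq_mul_inv, mul_comm, ENNReal.ofReal_mul (by positivity), ENNReal.ofReal_toReal hE',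
    ENNReal.ofReal_inv_of_pos (by positivity), ENNReal.ofReal_pow hr.le]

theorem exists_ball {x : Space d} (hΩ : IsOpen Ω) (hx : x ∈ Ω) :
    ∃ r, 0 < r ∧ Metric.closedBall x (2 * r) ⊆ Ω := by
  obtain ⟨r, hr, h⟩ := Metric.nhds_basis_closedBall.mem_iff.1 (hΩ.mem_nhds hx)
  exact ⟨r / 2, by positivity, by convert h using 2; ring⟩

theorem ball_const_ne_top {r : ℝ} (hr : 0 < r) : (ENNReal.ofReal r ^ d)⁻¹ ≠ ⊤ :=
  ENNReal.inv_ne_top.2 (pow_ne_zero _ (ENNReal.ofReal_pos.2 hr).ne')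

/-- The relation "the oscillation between `x` and `y` is controlled, with a constant chosen before
`f` and `e`" is symmetric, transitive and holds locally, so it holds throughout a connected open
set. -/
theorem sub_le_of_connected (hΩ : IsOpen Ω) (hc : IsPreconnected Ω) {x y : Space d} (hx : x ∈ Ω)
    (hy : y ∈ Ω) : ∃ C : ℝ≥0∞, C ≠ ⊤ ∧ ∀ f e, GradBound Ω f e →
      ‖f x - f y‖ₑ ^ 2 ≤ C * ∫⁻ z in Ω, e z := by
  refine hc.induction₂ (fun x y => ∃ C : ℝ≥0∞, C ≠ ⊤ ∧ ∀ f e, GradBound Ω f e →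
    ‖f x - f y‖ₑ ^ 2 ≤ C * ∫⁻ z in Ω, e z) ?_ ?_ ?_ hx hy
  · intro x hx
    obtain ⟨r, hr, hrΩ⟩ := exists_ball hΩ hx
    filter_upwards [nhdsWithin_le_nhds (Metric.ball_mem_nhds x hr)] with y hy
    refine ⟨_, ball_const_ne_top (d := d) hr, fun f e hf => ?_⟩
    rw [enorm_sub_rev]
    exact hf.sub_le_of_closedBall hΩ hr hrΩ hy
  · rintro x y z _ _ _ ⟨C, hC, h⟩ ⟨C', hC', h'⟩
    refine ⟨2 * (C + C'), by finiteness, fun f e hf => ?_⟩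
    refine (enorm_sub_sq_le (b := f y)).trans ?_
    rw [mul_assoc, add_mul]
    gcongr
    · exact h f e hf
    · exact h' f e hf
  · rintro x y _ _ ⟨C, hC, h⟩
    refine ⟨C, hC, fun f e hf => ?_⟩
    rw [enorm_sub_rev]
    exact h f e hf

theorem sub_le_nhds (hΩ : IsOpen Ω) (hc : IsPreconnected Ω) {x₀ x : Space d} (hx₀ : x₀ ∈ Ω)
    (hx : x ∈ Ω) : ∃ C : ℝ≥0∞, C ≠ ⊤ ∧ ∃ V ∈ 𝓝 x, ∀ f e, GradBound Ω f e → ∀ y ∈ V,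
      ‖f y - f x₀‖ₑ ^ 2 ≤ C * ∫⁻ z in Ω, e z := by
  obtain ⟨C, hC, h⟩ := sub_le_of_connected hΩ hc hx hx₀
  obtain ⟨r, hr, hrΩ⟩ := exists_ball hΩ hx
  have hr' := ball_const_ne_top (d := d) hr
  refine ⟨2 * ((ENNReal.ofReal r ^ d)⁻¹ + C), by finiteness, Metric.ball x r,
    Metric.ball_mem_nhds x hr, fun f e hf y hy => ?_⟩
  refine (enorm_sub_sq_le (b := f x)).trans ?_
  rw [mul_assoc, add_mul]
  gcongr
  · exact hf.sub_le_of_closedBall hΩ hr hrΩ hy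
  · exact h f e hf

theorem sub_le_of_isCompact (hΩ : IsOpen Ω) (hc : IsPreconnected Ω) {x₀ : Space d}
    (hx₀ : x₀ ∈ Ω) {k : Set (Space d)} (hk : IsCompact k) (hkΩ : k ⊆ Ω) :
    ∃ C : ℝ≥0∞, C ≠ ⊤ ∧ ∀ f e, GradBound Ω f e → ∀ y ∈ k,
      ‖f y - f x₀‖ₑ ^ 2 ≤ C * ∫⁻ z in Ω, e z := by
  refine hk.induction_on (p := fun k => ∃ C : ℝ≥0∞, C ≠ ⊤ ∧ ∀ f e, GradBound Ω f e → ∀ y ∈ k,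
      ‖f y - f x₀‖ₑ ^ 2 ≤ C * ∫⁻ z in Ω, e z) ⟨0, by simp⟩ ?_ ?_ ?_
  · rintro s t hst ⟨C, hC, h⟩
    exact ⟨C, hC, fun f e hf y hy => h f e hf y (hst hy)⟩
  · rintro s t ⟨C, hC, h⟩ ⟨C', hC', h'⟩
    refine ⟨C + C', by finiteness, fun f e hf y hy => ?_⟩
    rw [add_mul]
    rcases hy with hy | hy
    · exact (h f e hf y hy).trans le_self_add
    · exact (h' f e hf y hy).trans le_add_self
  · intro x hx
    obtain ⟨C, hC, V, hV, h⟩ := sub_le_nhds hΩ hc hx₀ (hkΩ hx)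
    exact ⟨V, mem_nhdsWithin_of_mem_nhds hV, C, hC, h⟩

end GradBound

/-! ### The weighted Poincaré inequality -/

theorem enorm_sub_le_lintegral_fderiv {E : Type*} [NormedAddCommGroup E] [NormedSpace ℝ E]
    {f : E → ℝ} {Ω : Set E} (hΩ : IsOpen Ω) (hf : ContDiffOn ℝ 1 f Ω) {x v : E} (hv : ‖v‖ ≤ 1)
    {a : ℝ} (ha : 0 ≤ a) (hx : ∀ t ∈ Icc 0 a, x + t • v ∈ Ω) :
    ‖f (x + a • v) - f x‖ₑ ≤ ∫⁻ t in Ioc 0 a, ‖fderiv ℝ f (x + t • v)‖ₑ := by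
  have hd : ∀ t ∈ Icc 0 a, HasDerivAt (fun t : ℝ => f (x + t • v))
      (fderiv ℝ f (x + t • v) v) t := by
    intro t ht
    have h1 : HasFDerivAt f (fderiv ℝ f (x + t • v)) (x + t • v) :=
      ((hf.differentiableOn one_ne_zero).differentiableAt (hΩ.mem_nhds (hx t ht))).hasFDerivAt
    have h2 : HasDerivAt (fun t : ℝ => x + t • v) v t := by
      simpa using ((hasDerivAt_id t).smul_const v).const_add x
    exact h1.comp_hasDerivAt t h2
  have hc : ContinuousOn (fun t : ℝ => fderiv ℝ f (x + t • v) v) (Icc 0 a) := by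
    have h1 : ContinuousOn (fun t : ℝ => fderiv ℝ f (x + t • v)) (Icc 0 a) :=
      (hf.continuousOn_fderiv_of_isOpen hΩ le_rfl).comp (by fun_prop) hx
    exact h1.clm_apply continuousOn_const
  have h := intervalIntegral.integral_eq_sub_of_hasDerivAt
    (fun t ht => hd t (by rwa [uIcc_of_le ha] at ht))
    (ContinuousOn.intervalIntegrable (by rwa [uIcc_of_le ha]))
  simp only [zero_smul, add_zero] at h
  rw [← h, intervalIntegral.integral_of_le ha]
  refine (enorm_integral_le_lintegral_enorm _).trans (lintegral_mono fun t => ?_)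
  refine (ContinuousLinearMap.le_opENorm _ _).trans ?_
  refine mul_le_of_le_one_right' ?_
  rw [← ofReal_norm]
  exact ENNReal.ofReal_le_one.2 hv

section Chart

variable {d : ℕ} {Ω : Set (Space d)} {p : Space d} {h : Space d → ℝ} {K : ℝ≥0} {r : ℝ}

/-- By the Lipschitz bound, `h` stays above `h y / 2` on the ball. As `h p = 0`, the radius is at
most half the distance from `y` to `p`, which keeps the ball within the range of the chart. -/
theorem chart_closedBall_subset (hK : LipschitzWith K h) (hK1 : 1 ≤ K) (hp : h p = 0)
    (hr : ∀ y ∈ Metric.ball p r, (y ∈ Ω ↔ 0 < h y)) {y : Space d}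
    (hy : y ∈ Metric.ball p (r / 2)) (hy0 : 0 < h y) :
    Metric.closedBall y (h y / (2 * K)) ⊆ Ω := by
  have hK' : (1 : ℝ) ≤ K := by exact_mod_cast hK1
  intro z hz
  rw [Metric.mem_closedBall] at hz
  rw [Metric.mem_ball] at hy
  have h1 : h y ≤ K * dist y p := by
    have := hK.dist_le_mul y p
    rw [hp, Real.dist_eq, sub_zero] at this
    exact (le_abs_self _).trans this
  have h2 : |h z - h y| ≤ K * dist z y := hK.dist_le_mul z y
  have h3 : K * dist z y ≤ h y / 2 := by
    calc K * dist z y ≤ K * (h y / (2 * K)) := by gcongr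
      _ = h y / 2 := by field_simp
  have h4 : h y / (2 * K) ≤ dist y p / 2 := by
    rw [div_le_iff₀ (by positivity)]
    linarith
  refine (hr z ?_).2 ?_
  · rw [Metric.mem_ball]
    have := dist_triangle z y p
    have := dist_nonneg (x := y) (y := p)
    linarith
  · have := (abs_le.1 h2).1
    linarith

/-- Tonelli. If `z` lies in the ball of `y`, then `h y / 2 ≤ h z ≤ 3 h y / 2`; hence `y` lies within
`h z / K` of `z` and the weight is at most `(h z / (3K))^(-d)`. The ratio of these two radii gives
`3 ^ d`, and points with `h z ≤ 0` are never reached. -/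
theorem lintegral_mean_le (hK : LipschitzWith K h) (hK1 : 1 ≤ K) {e : Space d → ℝ≥0∞}
    (he : Measurable e) :
    ∫⁻ y in {y | 0 < h y}, (ENNReal.ofReal (h y / (2 * K)) ^ d)⁻¹ *
        ∫⁻ z in Metric.ball y (h y / (2 * K)), e z ≤
      3 ^ d * volume (Metric.ball (0 : Space d) 1) * ∫⁻ z, e z := by
  have hK' : (1 : ℝ) ≤ K := by exact_mod_cast hK1
  have hh : Measurable h := hK.continuous.measurable
  have hW : MeasurableSet {y | 0 < h y} := measurableSet_lt measurable_const hh
  have hT : MeasurableSet {q : Space d × Space d | 0 < h q.1 ∧ dist q.2 q.1 < h q.1 / (2 * K)} :=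
    (measurableSet_lt measurable_const (hh.comp measurable_fst)).inter
      (measurableSet_lt (measurable_snd.dist measurable_fst)
        ((hh.comp measurable_fst).div_const _))
  have e1 : ∫⁻ y in {y | 0 < h y}, (ENNReal.ofReal (h y / (2 * K)) ^ d)⁻¹ *
        ∫⁻ z in Metric.ball y (h y / (2 * K)), e z =
      ∫⁻ y, ∫⁻ z, {q : Space d × Space d | 0 < h q.1 ∧ dist q.2 q.1 < h q.1 / (2 * K)}.indicator
        (fun q => (ENNReal.ofReal (h q.1 / (2 * K)) ^ d)⁻¹ * e q.2) (y, z) := by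
    rw [← lintegral_indicator hW]
    refine lintegral_congr fun y => ?_
    by_cases hy : 0 < h y
    · rw [indicator_of_mem (by exact hy), ← lintegral_const_mul _ he,
        ← lintegral_indicator measurableSet_ball]
      refine lintegral_congr fun z => ?_
      simp [indicator, hy]
    · rw [indicator_of_notMem (by exact hy)]
      simp [indicator, hy]
  have hmeas : Measurable ({q : Space d × Space d | 0 < h q.1 ∧
      dist q.2 q.1 < h q.1 / (2 * K)}.indicator
        (fun q => (ENNReal.ofReal (h q.1 / (2 * K)) ^ d)⁻¹ * e q.2)) :=
    Measurable.indicator (by fun_prop) hT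
  rw [e1, lintegral_lintegral_swap (f := fun y z => {q : Space d × Space d | 0 < h q.1 ∧
    dist q.2 q.1 < h q.1 / (2 * K)}.indicator
        (fun q => (ENNReal.ofReal (h q.1 / (2 * K)) ^ d)⁻¹ * e q.2) (y, z)) hmeas.aemeasurable,
    ← lintegral_const_mul _ he]
  refine lintegral_mono fun z => ?_
  by_cases hz : 0 < h z
  · have h1 : ∀ y, {q : Space d × Space d | 0 < h q.1 ∧
        dist q.2 q.1 < h q.1 / (2 * K)}.indicator
        (fun q => (ENNReal.ofReal (h q.1 / (2 * K)) ^ d)⁻¹ * e q.2) (y, z) ≤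
        (Metric.ball z (h z / K)).indicator
          (fun _ => (ENNReal.ofReal (h z / (3 * K)) ^ d)⁻¹ * e z) y := by
      intro y
      by_cases hy : 0 < h y ∧ dist z y < h y / (2 * K)
      · have h2 : |h z - h y| ≤ K * dist z y := hK.dist_le_mul z y
        have h3 : K * dist z y ≤ h y / 2 := by
          calc K * dist z y ≤ K * (h y / (2 * K)) := by gcongr; exact hy.2.le
            _ = h y / 2 := by field_simp
        have h4 := abs_le.1 h2
        rw [indicator_of_mem (by exact hy), indicator_of_mem]
        · dsimp only
          gcongr ?_⁻¹ * _
          gcongr ENNReal.ofReal ?_ ^ d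
          rw [div_le_div_iff₀ (by positivity) (by positivity)]
          nlinarith
        · rw [Metric.mem_ball, dist_comm]
          refine hy.2.trans_le ?_
          rw [div_le_div_iff₀ (by positivity) (by positivity)]
          nlinarith
      · rw [indicator_of_notMem (by exact hy)]
        exact zero_le
    refine (lintegral_mono h1).trans ?_
    rw [lintegral_indicator measurableSet_ball, setLIntegral_const,
      Measure.addHaar_ball_of_pos _ _ (by positivity), finrank_euclideanSpace_fin]
    have h5 : (ENNReal.ofReal (h z / (3 * K)) ^ d)⁻¹ * ENNReal.ofReal ((h z / K) ^ d) = 3 ^ d := by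
      rw [← ENNReal.ofReal_pow (by positivity), ← ENNReal.ofReal_inv_of_pos (by positivity),
        ← ENNReal.ofReal_mul (by positivity), ← inv_pow, ← mul_pow,
        ← ENNReal.ofReal_ofNat, ← ENNReal.ofReal_pow (by norm_num)]
      congr 2
      field_simp
    rw [← h5]
    refine le_of_eq ?_
    ring
  · refine le_of_eq_of_le ?_ (zero_le (a := _))
    rw [← lintegral_zero (α := Space d) (μ := volume)]
    refine lintegral_congr fun y => indicator_of_notMem ?_ _
    rintro ⟨hy, hzy⟩
    have h2 : |h z - h y| ≤ K * dist z y := hK.dist_le_mul z y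
    have h3 : K * dist z y ≤ h y / 2 := by
      calc K * dist z y ≤ K * (h y / (2 * K)) := by gcongr
        _ = h y / 2 := by field_simp
    have h4 := abs_le.1 h2
    simp only at hy
    linarith

/-- At scale `ε = h y / (2K)` the bound on the gradient becomes exactly a weighted mean of `e`. The
indicator keeps `y` where the corresponding ball is known to lie in `Ω`. -/
theorem GradBound.lintegral_chart_le {f : Space d → ℝ} {e : Space d → ℝ≥0∞}
    (hf : GradBound Ω f e) (hΩ : MeasurableSet Ω) (hK : LipschitzWith K h) (hK1 : 1 ≤ K)
    (hp : h p = 0) (hr : ∀ y ∈ Metric.ball p r, (y ∈ Ω ↔ 0 < h y)) :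
    ∫⁻ y in {y | 0 < h y}, ENNReal.ofReal (h y) ^ 2 *
        (Metric.ball p (r / 2)).indicator (fun y => ‖fderiv ℝ f y‖ₑ) y ^ 2 ≤
      ENNReal.ofReal (2 * K) ^ 2 * (3 ^ d * volume (Metric.ball (0 : Space d) 1) *
        ∫⁻ z in Ω, e z) := by
  have hK' : (1 : ℝ) ≤ K := by exact_mod_cast hK1
  have hh : Measurable h := hK.continuous.measurable
  have hW : MeasurableSet {y | 0 < h y} := measurableSet_lt measurable_const hh
  have h1 := lintegral_mean_le hK hK1 (hf.measurable.indicator hΩ)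
  rw [lintegral_indicator hΩ] at h1
  refine le_trans ?_ (mul_le_mul_right h1 _)
  rw [← lintegral_const_mul' _ _ (by finiteness)]
  refine setLIntegral_mono' hW fun y hy => ?_
  have hy0 : 0 < h y := hy
  by_cases hyb : y ∈ Metric.ball p (r / 2)
  · have hsub := chart_closedBall_subset hK hK1 hp hr hyb hy0
    have hb := hf.bound y _ (by positivity) hsub
    rw [indicator_of_mem hyb]
    have e1 : ∫⁻ z in Metric.ball y (h y / (2 * K)), Ω.indicator e z =
        ∫⁻ z in Metric.ball y (h y / (2 * K)), e z :=
      setLIntegral_congr_fun measurableSet_ball fun z hz =>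
        indicator_of_mem (hsub (Metric.ball_subset_closedBall hz)) _
    rw [e1]
    have e2 : ENNReal.ofReal (h y) = ENNReal.ofReal (2 * K) * ENNReal.ofReal (h y / (2 * K)) := by
      rw [← ENNReal.ofReal_mul (by positivity)]
      congr 1
      field_simp
    rw [e2, mul_pow, mul_assoc]
    refine mul_le_mul_right ?_ _
    have hε : ENNReal.ofReal (h y / (2 * K)) ≠ 0 := (ENNReal.ofReal_pos.2 (by positivity)).ne'
    rw [mul_comm (_⁻¹), ← div_eq_mul_inv, ENNReal.le_div_iff_mul_le
      (Or.inl (pow_ne_zero _ hε)) (Or.inl (by finiteness))]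
    refine le_trans (le_of_eq ?_) hb
    ring
  · rw [indicator_of_notMem hyb]
    simp

end Chart

namespace GradBound

variable {d : ℕ} {Ω : Set (Space d)}

/-- From a point near `p`, a vertical climb of length `r / 8` ends in a compact subset of `Ω`, where
the chain bound applies. The change along the climb is estimated in mean square by Hardy's
inequality with the distance-weighted gradient. -/
theorem lintegral_le_nhds_frontier (hΩ : IsLipschitzDomain Ω) {x₀ p : Space d} (hx₀ : x₀ ∈ Ω)
    (hp : p ∈ frontier Ω) : ∃ C : ℝ≥0∞, C ≠ ⊤ ∧ ∃ V ∈ 𝓝 p, ∀ f e, GradBound Ω f e →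
      ∫⁻ y in V ∩ Ω, ‖f y - f x₀‖ₑ ^ 2 ≤ C * ∫⁻ z in Ω, e z := by
  obtain ⟨v, h, K, r, hv, hK, hK1, hr0, hhv, hhp, hr⟩ := hΩ.exists_chart hp
  have hh : Continuous h := hK.continuous
  have hW : MeasurableSet {y | 0 < h y} := measurableSet_lt measurable_const hh.measurable
  -- The end points of the climbs: they have height at least `r / 8` and distance less than `r / 4 +
  -- r / 8 = 3r / 8` from `p`.
  have hk : IsCompact (Metric.closedBall p (3 * r / 8) ∩ {y | r / 8 ≤ h y}) :=
    (isCompact_closedBall _ _).inter_right (isClosed_le continuous_const hh)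
  have hkΩ : Metric.closedBall p (3 * r / 8) ∩ {y | r / 8 ≤ h y} ⊆ Ω := by
    rintro y ⟨h1, h2⟩
    have h2' : r / 8 ≤ h y := h2
    exact (hr y (Metric.closedBall_subset_ball (by linarith) h1)).2 (by linarith)
  obtain ⟨C, hC, hCf⟩ := sub_le_of_isCompact hΩ.isOpen hΩ.isConnected.isPreconnected hx₀ hk hkΩ
  have hvol : volume (Metric.ball p (r / 4)) ≠ ⊤ := measure_ball_lt_top.ne
  have hvol1 : volume (Metric.ball (0 : Space d) 1) ≠ ⊤ := measure_ball_lt_top.ne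
  refine ⟨2 * (4 * (ENNReal.ofReal (2 * K) ^ 2 *
    (3 ^ d * volume (Metric.ball (0 : Space d) 1))) + C * volume (Metric.ball p (r / 4))),
    by finiteness, Metric.ball p (r / 4), Metric.ball_mem_nhds p (by positivity),
    fun f e hf => ?_⟩
  set F : Space d → ℝ≥0∞ := (Metric.ball p (r / 2)).indicator fun y => ‖fderiv ℝ f y‖ₑ with hFdef
  have hF : Measurable F := (measurable_fderiv ℝ f).enorm.indicator measurableSet_ball
  set E := ∫⁻ z in Ω, e z
  have hHardy := (hardy (μ := volume) hh.measurable hhv hF).trans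
    (mul_le_mul_right (hf.lintegral_chart_le hΩ.isOpen.measurableSet hK hK1 hhp hr) 4)
  have hsub : Metric.ball p (r / 4) ∩ Ω ⊆ {y | 0 < h y} := fun y hy =>
    (hr y (Metric.ball_subset_ball (by linarith) hy.1)).1 hy.2
  have hpt : ∀ y ∈ Metric.ball p (r / 4) ∩ Ω, ‖f y - f x₀‖ₑ ^ 2 ≤
      2 * ((∫⁻ t in Ioi (0 : ℝ), F (y + t • v)) ^ 2 + C * E) := by
    intro y hy
    have hy0 : 0 < h y := hsub hy
    have hdist : ∀ t ∈ Icc 0 (r / 8), dist (y + t • v) p < 3 * r / 8 := by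
      intro t ht
      have h1 := Metric.mem_ball.1 hy.1
      have h2 : dist (y + t • v) y = t := by
        rw [dist_eq_norm, add_sub_cancel_left, norm_smul, hv, mul_one, Real.norm_eq_abs,
          abs_of_nonneg ht.1]
      have := dist_triangle (y + t • v) y p
      linarith [ht.2]
    refine (enorm_sub_sq_le (b := f (y + (r / 8) • v))).trans ?_
    gcongr
    · rw [enorm_sub_rev]
      refine (enorm_sub_le_lintegral_fderiv hΩ.isOpen hf.contDiffOn hv.le (by positivity)
        fun t ht => ?_).trans ?_
      · refine (hr _ (Metric.mem_ball.2 ((hdist t ht).trans (by linarith)))).2 ?_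
        rw [hhv]
        linarith [ht.1]
      · refine le_trans (le_of_eq ?_)
          (lintegral_mono_set (Ioc_subset_Ioi_self (a := r / 8) (b := 0)))
        refine setLIntegral_congr_fun measurableSet_Ioc fun t ht => ?_
        rw [hFdef, indicator_of_mem]
        exact Metric.mem_ball.2 ((hdist t ⟨ht.1.le, ht.2⟩).trans (by linarith))
    · refine hCf f e hf _ ⟨(hdist _ ⟨by positivity, le_rfl⟩).le, ?_⟩
      change r / 8 ≤ h (y + (r / 8) • v)
      rw [hhv]
      linarith
  have hVm : MeasurableSet (Metric.ball p (r / 4) ∩ Ω) :=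
    measurableSet_ball.inter hΩ.isOpen.measurableSet
  calc ∫⁻ y in Metric.ball p (r / 4) ∩ Ω, ‖f y - f x₀‖ₑ ^ 2
      ≤ ∫⁻ y in Metric.ball p (r / 4) ∩ Ω,
          2 * ((∫⁻ t in Ioi (0 : ℝ), F (y + t • v)) ^ 2 + C * E) := setLIntegral_mono' hVm hpt
    _ = 2 * ((∫⁻ y in Metric.ball p (r / 4) ∩ Ω, (∫⁻ t in Ioi (0 : ℝ), F (y + t • v)) ^ 2) +
          C * E * volume (Metric.ball p (r / 4) ∩ Ω)) := by
        rw [lintegral_const_mul' _ _ (by norm_num), lintegral_add_right _ measurable_const,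
          setLIntegral_const]
    _ ≤ 2 * (4 * (ENNReal.ofReal (2 * K) ^ 2 * (3 ^ d * volume (Metric.ball (0 : Space d) 1) * E))
          + C * E * volume (Metric.ball p (r / 4))) := by
        gcongr
        · exact (lintegral_mono_set hsub).trans hHardy
        · exact inter_subset_left
    _ = _ := by ring

/-- A function on a bounded Lipschitz domain whose gradient is controlled by `e` at every scale is
close to a constant in `L²`. -/
theorem lintegral_le (hΩ : IsLipschitzDomain Ω) {x₀ : Space d} (hx₀ : x₀ ∈ Ω) :
    ∃ C : ℝ≥0∞, C ≠ ⊤ ∧ ∀ f e, GradBound Ω f e →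
      ∫⁻ y in Ω, ‖f y - f x₀‖ₑ ^ 2 ≤ C * ∫⁻ z in Ω, e z := by
  have hcpt : IsCompact (closure Ω) := hΩ.isBounded.isCompact_closure
  have key : ∃ C : ℝ≥0∞, C ≠ ⊤ ∧ ∀ f e, GradBound Ω f e →
      ∫⁻ y in closure Ω ∩ Ω, ‖f y - f x₀‖ₑ ^ 2 ≤ C * ∫⁻ z in Ω, e z := by
    -- Compactness of the closure glues the interior estimate and the boundary estimate; uniformity
    -- in `f` and `e` survives because only finitely many constants are added.
    refine hcpt.induction_on (p := fun k => ∃ C : ℝ≥0∞, C ≠ ⊤ ∧ ∀ f e, GradBound Ω f e →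
      ∫⁻ y in k ∩ Ω, ‖f y - f x₀‖ₑ ^ 2 ≤ C * ∫⁻ z in Ω, e z) ⟨0, by simp⟩ ?_ ?_ ?_
    · rintro s t hst ⟨C, hC, h⟩
      exact ⟨C, hC, fun f e hf =>
        (lintegral_mono_set (inter_subset_inter_left _ hst)).trans (h f e hf)⟩
    · rintro s t ⟨C, hC, h⟩ ⟨C', hC', h'⟩
      refine ⟨C + C', by finiteness, fun f e hf => ?_⟩
      rw [add_mul, union_inter_distrib_right]
      exact (lintegral_union_le _ _ _).trans (add_le_add (h f e hf) (h' f e hf))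
    · intro x hx
      by_cases hxΩ : x ∈ Ω
      · obtain ⟨C, hC, V, hV, h⟩ := sub_le_nhds hΩ.isOpen hΩ.isConnected.isPreconnected hx₀ hxΩ
        obtain ⟨ρ, hρ, hρV⟩ := Metric.mem_nhds_iff.1 hV
        have hvol : volume (Metric.ball x ρ) ≠ ⊤ := measure_ball_lt_top.ne
        refine ⟨Metric.ball x ρ, mem_nhdsWithin_of_mem_nhds (Metric.ball_mem_nhds x hρ),
          C * volume (Metric.ball x ρ), by finiteness, fun f e hf => ?_⟩
        refine (lintegral_mono_set inter_subset_left).trans ?_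
        refine (setLIntegral_mono' measurableSet_ball fun y hy => h f e hf y (hρV hy)).trans ?_
        rw [setLIntegral_const]
        refine le_of_eq ?_
        ring
      · have hxf : x ∈ frontier Ω := by
          rw [hΩ.isOpen.frontier_eq]
          exact ⟨hx, hxΩ⟩
        obtain ⟨C, hC, V, hV, h⟩ := lintegral_le_nhds_frontier hΩ hx₀ hxf
        exact ⟨V, mem_nhdsWithin_of_mem_nhds hV, C, hC, h⟩
  rwa [inter_eq_right.2 subset_closure] at key

end GradBound

/-! ### Radial kernels and the mean value property -/

/-- The smooth functions with compact support in `Ω`. -/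
structure IsTest {d : ℕ} (Ω : Set (Space d)) (φ : Space d → ℝ) : Prop where
  contDiff : ContDiff ℝ ∞ φ
  hasCompactSupport : HasCompactSupport φ
  tsupport_subset : tsupport φ ⊆ Ω

/-- The radial profile `t ↦ exp (-1 / (1 - t))` on `t < 1`, extended by zero. -/
def profile (t : ℝ) : ℝ := expNegInvGlue (1 - t)

/-- The primitive of `profile / 2` that vanishes for `1 ≤ t`. -/
def profilePrim (t : ℝ) : ℝ := ∫ s in (1 : ℝ)..t, profile s / 2

theorem profile_contDiff : ContDiff ℝ ∞ profile :=
  expNegInvGlue.contDiff.comp (contDiff_const.sub contDiff_id)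

theorem profile_nonneg (t : ℝ) : 0 ≤ profile t := expNegInvGlue.nonneg _

theorem profile_eq_zero {t : ℝ} (ht : 1 ≤ t) : profile t = 0 :=
  expNegInvGlue.zero_of_nonpos (by linarith)

theorem profile_pos {t : ℝ} (ht : t < 1) : 0 < profile t :=
  expNegInvGlue.pos_of_pos (by linarith)

theorem profile_differentiable : Differentiable ℝ profile :=
  profile_contDiff.differentiable (by simp)

theorem profilePrim_hasDerivAt (t : ℝ) : HasDerivAt profilePrim (profile t / 2) t := by
  have hc : Continuous fun s => profile s / 2 := profile_contDiff.continuous.div_const 2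
  exact intervalIntegral.integral_hasDerivAt_right (hc.intervalIntegrable _ _)
    (hc.stronglyMeasurableAtFilter _ _) hc.continuousAt

theorem profilePrim_contDiff : ContDiff ℝ ∞ profilePrim := by
  rw [contDiff_infty_iff_deriv]
  refine ⟨fun t => (profilePrim_hasDerivAt t).differentiableAt, ?_⟩
  have : deriv profilePrim = fun t => profile t / 2 := by
    funext t
    exact (profilePrim_hasDerivAt t).deriv
  rw [this]
  exact profile_contDiff.div_const 2

theorem profilePrim_eq_zero {t : ℝ} (ht : 1 ≤ t) : profilePrim t = 0 := by
  unfold profilePrim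
  rw [← intervalIntegral.integral_zero (a := 1) (b := t)]
  refine intervalIntegral.integral_congr fun s hs => ?_
  rw [uIcc_of_le ht] at hs
  simp [profile_eq_zero hs.1]

section Radial

variable {d : ℕ}

/-- The rescaled radial function `y ↦ F (‖y - x‖² / ε²)`. -/
def radial (F : ℝ → ℝ) (x : Space d) (ε : ℝ) (y : Space d) : ℝ := F (‖y - x‖ ^ 2 / ε ^ 2)

theorem radial_contDiff {F : ℝ → ℝ} (hF : ContDiff ℝ ∞ F) (x : Space d) (ε : ℝ) :
    ContDiff ℝ ∞ (radial F x ε) :=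
  hF.comp (((contDiff_id.sub contDiff_const).norm_sq ℝ).div_const _)

theorem radial_eq_zero {F : ℝ → ℝ} (hF : ∀ t, 1 ≤ t → F t = 0) {x y : Space d} {ε : ℝ}
    (hε : 0 < ε) (hy : ε ≤ dist y x) : radial F x ε y = 0 := by
  refine hF _ ?_
  rw [one_le_div (by positivity), ← dist_eq_norm]
  gcongr

theorem radial_tsupport {F : ℝ → ℝ} (hF : ∀ t, 1 ≤ t → F t = 0) {x : Space d} {ε : ℝ}
    (hε : 0 < ε) : tsupport (radial F x ε) ⊆ Metric.closedBall x ε := by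
  refine closure_minimal (fun y hy => ?_) Metric.isClosed_closedBall
  rw [Metric.mem_closedBall]
  by_contra hlt
  exact hy (radial_eq_zero hF hε (le_of_not_ge hlt))

theorem radial_isTest {Ω : Set (Space d)} {F : ℝ → ℝ} (hF : ContDiff ℝ ∞ F)
    (hF0 : ∀ t, 1 ≤ t → F t = 0) {x : Space d} {ε : ℝ} (hε : 0 < ε)
    (hx : Metric.closedBall x ε ⊆ Ω) : IsTest Ω (radial F x ε) where
  contDiff := radial_contDiff hF x ε
  hasCompactSupport := (isCompact_closedBall x ε).of_isClosed_subset (isClosed_tsupport _)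
    (radial_tsupport hF0 hε)
  tsupport_subset := (radial_tsupport hF0 hε).trans hx

theorem pderiv_radial {F : ℝ → ℝ} (hF : Differentiable ℝ F) (x : Space d) (ε : ℝ) (k : Fin d)
    (y : Space d) : pderiv k (radial F x ε) y =
      deriv F (‖y - x‖ ^ 2 / ε ^ 2) * (2 * (y k - x k) / ε ^ 2) := by
  have h1 : HasFDerivAt (fun y : Space d => ‖y - x‖ ^ 2 / ε ^ 2)
      ((ε ^ 2)⁻¹ • (2 • (innerSL ℝ (y - x)))) y := by
    have h2 : HasFDerivAt (fun y : Space d => ‖y - x‖ ^ 2) (2 • (innerSL ℝ (y - x))) y := by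
      simpa using ((hasFDerivAt_id y).sub_const x).norm_sq
    simpa [div_eq_inv_mul] using h2.const_mul (ε ^ 2)⁻¹
  have h3 := (hF _).hasDerivAt.comp_hasFDerivAt y h1
  have h4 : fderiv ℝ (radial F x ε) y =
      deriv F (‖y - x‖ ^ 2 / ε ^ 2) • ((ε ^ 2)⁻¹ • (2 • (innerSL ℝ (y - x)))) := h3.fderiv
  rw [pderiv, h4]
  simp [EuclideanSpace.inner_single_right]
  left
  ring

theorem pderiv_mul {f g : Space d → ℝ} {y : Space d} (k : Fin d) (hf : DifferentiableAt ℝ f y)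
    (hg : DifferentiableAt ℝ g y) :
    pderiv k (fun y => f y * g y) y = f y * pderiv k g y + g y * pderiv k f y := by
  unfold pderiv
  rw [fderiv_fun_mul hf hg]
  simp

/-- The profile of the Laplacian of the rescaled `profilePrim`. -/
def profileLap (d : ℕ) (s : ℝ) : ℝ := 2 * s * deriv profile s + d * profile s

/-- The factor `1/2` in `profilePrim` makes the gradient `profile · (y - x) / ε²`, and its
divergence produces `2 s profile' + d profile`. -/
theorem laplacian_radial (x : Space d) {ε : ℝ} (hε : 0 < ε) (y : Space d) :
    ∑ k, pderiv k (pderiv k (radial profilePrim x ε)) y =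
      (ε ^ 2)⁻¹ * profileLap d (‖y - x‖ ^ 2 / ε ^ 2) := by
  have h1 : ∀ k : Fin d, pderiv k (radial profilePrim x ε) =
      fun y => radial profile x ε y * ((y k - x k) / ε ^ 2) := by
    intro k
    funext y
    rw [pderiv_radial (profilePrim_contDiff.differentiable (by simp)),
      (profilePrim_hasDerivAt _).deriv]
    unfold radial
    ring
  have h2 : ∀ k : Fin d, HasFDerivAt (fun y : Space d => (y k - x k) / ε ^ 2)
      ((ε ^ 2)⁻¹ • (EuclideanSpace.proj k : Space d →L[ℝ] ℝ)) y := by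
    intro k
    have h3 : HasFDerivAt (fun y : Space d => y k)
      (EuclideanSpace.proj k : Space d →L[ℝ] ℝ) y :=
      (EuclideanSpace.proj k : Space d →L[ℝ] ℝ).hasFDerivAt
    simpa [div_eq_inv_mul] using (h3.sub_const (x k)).const_mul (ε ^ 2)⁻¹
  have h3 : ∀ k : Fin d, pderiv k (fun y : Space d => (y k - x k) / ε ^ 2) y = (ε ^ 2)⁻¹ := by
    intro k
    rw [pderiv, (h2 k).fderiv]
    simp
  have h4 : ∀ k : Fin d, pderiv k (pderiv k (radial profilePrim x ε)) y =
      radial profile x ε y * (ε ^ 2)⁻¹ + 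
        (2 * deriv profile (‖y - x‖ ^ 2 / ε ^ 2) / ε ^ 4) * (y k - x k) ^ 2 := by
    intro k
    rw [h1, pderiv_mul k ((radial_contDiff profile_contDiff x ε).differentiable (by simp) y)
      (h2 k).differentiableAt, h3, pderiv_radial profile_differentiable]
    field_simp
  simp only [h4, Finset.sum_add_distrib, ← Finset.mul_sum, Finset.sum_const, Finset.card_univ,
    Fintype.card_fin, nsmul_eq_mul]
  have h5 : ∑ k, (y k - x k) ^ 2 = ‖y - x‖ ^ 2 := by
    simp [EuclideanSpace.norm_sq_eq]
  rw [h5]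
  unfold radial profileLap
  field_simp
  ring

theorem profileLap_bound (d : ℕ) : ∃ C, ∀ s, 0 ≤ s → |profileLap d s| ≤ C := by
  have hc : Continuous (profileLap d) := by
    have h1 : Continuous (deriv profile) := profile_contDiff.continuous_deriv (by simp)
    have h2 : Continuous profile := profile_contDiff.continuous
    unfold profileLap
    fun_prop
  obtain ⟨C, hC⟩ := isCompact_Icc.exists_bound_of_continuousOn (s := Icc (0 : ℝ) 1)
    hc.continuousOn
  refine ⟨C, fun s hs => ?_⟩
  rcases le_or_gt s 1 with h | h
  · exact hC s ⟨hs, h⟩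
  · have h1 : deriv profile s = 0 := by
      have : profile =ᶠ[𝓝 s] fun _ => 0 := by
        filter_upwards [lt_mem_nhds h] with t ht using profile_eq_zero ht.le
      rw [this.deriv_eq, deriv_const]
    have h2 : profileLap d s = 0 := by simp [profileLap, h1, profile_eq_zero h.le]
    rw [h2, abs_zero]
    exact (norm_nonneg _).trans (hC 0 (by simp))

/-- The rescaled kernel of the local means. -/
def kern (x : Space d) (ε : ℝ) (y : Space d) : ℝ := (ε ^ d)⁻¹ * radial profile x ε y

/-- The same `profileLap` as in `laplacian_radial`: the derivative of the kernel in the radius is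
`-ε^(1-d)` times the Laplacian of a test function. This is the source of the mean value property. -/
theorem kern_hasDerivAt (x y : Space d) {ε : ℝ} (hε : 0 < ε) :
    HasDerivAt (fun ε => kern x ε y)
      (-((ε ^ (d + 1))⁻¹ * profileLap d (‖y - x‖ ^ 2 / ε ^ 2))) ε := by
  have h1 : HasDerivAt (fun ε : ℝ => (ε ^ d)⁻¹) (-(d * (ε ^ (d + 1))⁻¹)) ε := by
    have := (hasDerivAt_zpow (-d : ℤ) ε (Or.inl hε.ne'))
    simp only [zpow_neg, zpow_natCast] at this
    refine this.congr_deriv ?_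
    rw [zpow_sub₀ hε.ne', zpow_neg, zpow_natCast, zpow_one, pow_succ]
    push_cast
    field_simp
  have h2 : HasDerivAt (fun ε : ℝ => ‖y - x‖ ^ 2 / ε ^ 2) (-(2 * ‖y - x‖ ^ 2 / ε ^ 3)) ε := by
    have := ((hasDerivAt_pow 2 ε).inv (by positivity)).const_mul (‖y - x‖ ^ 2)
    simp only [div_eq_mul_inv]
    refine this.congr_deriv ?_
    field_simp
    norm_num
    ring
  have h3 := h1.mul ((profile_differentiable _).hasDerivAt.comp ε h2)
  refine h3.congr_deriv ?_
  unfold profileLap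
  simp only [Function.comp_apply, pow_succ]
  field_simp
  ring

theorem kern_continuous (x : Space d) (ε : ℝ) : Continuous (kern x ε) :=
  (radial_contDiff profile_contDiff x ε).continuous.const_mul _

theorem kern_bound (x : Space d) {ε : ℝ} (hε : 0 < ε) (y : Space d) :
    ‖kern x ε y‖ ≤ (ε ^ d)⁻¹ := by
  unfold kern radial
  have h0 := profile_nonneg (‖y - x‖ ^ 2 / ε ^ 2)
  rw [Real.norm_of_nonneg (by positivity)]
  refine mul_le_of_le_one_right (by positivity) ?_
  unfold profile expNegInvGlue
  split_ifs with h
  · exact zero_le_one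
  · rw [Real.exp_le_one_iff, neg_nonpos, inv_nonneg]
    exact (not_le.1 h).le

/-- `H` is weakly harmonic in `Ω`. -/
def WeaklyHarmonic (Ω : Set (Space d)) (H : Space d → ℝ) : Prop :=
  ∀ φ, IsTest Ω φ → ∫ y in Ω, H y * ∑ k, pderiv k (pderiv k φ) y = 0

variable {Ω : Set (Space d)} {H : Space d → ℝ}

theorem kern_mul_integrable (hH : IntegrableOn H Ω) (x : Space d) {ε : ℝ} (hε : 0 < ε) :
    IntegrableOn (fun y => kern x ε y * H y) Ω :=
  hH.bdd_mul (kern_continuous x ε).aestronglyMeasurable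
    (Eventually.of_forall fun y => kern_bound x hε y)

/-- The local means of a weakly harmonic function do not depend on the radius. -/
theorem WeaklyHarmonic.mean_eq (hh : WeaklyHarmonic Ω H) (hH : IntegrableOn H Ω) {x : Space d}
    {r : ℝ} (hx : Metric.ball x r ⊆ Ω) {ε ε' : ℝ} (hε : ε ∈ Ioo 0 r) (hε' : ε' ∈ Ioo 0 r) :
    ∫ y in Ω, kern x ε y * H y = ∫ y in Ω, kern x ε' y * H y := by
  obtain ⟨C, hC⟩ := profileLap_bound d
  have key : ∀ τ ∈ Ioo 0 r, HasDerivAt (fun τ => ∫ y in Ω, kern x τ y * H y) 0 τ := by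
    intro τ hτ
    have hτ0 : 0 < τ := hτ.1
    have hcl : Continuous (profileLap d) := by
      have h1 : Continuous (deriv profile) := profile_contDiff.continuous_deriv (by simp)
      have h2 : Continuous profile := profile_contDiff.continuous
      unfold profileLap
      fun_prop
    have h := hasDerivAt_integral_of_dominated_loc_of_deriv_le (μ := volume.restrict Ω) (𝕜 := ℝ)
      (F := fun τ y => kern x τ y * H y) (x₀ := τ) (s := Ioi (τ / 2))
      (F' := fun τ y => -((τ ^ (d + 1))⁻¹ * profileLap d (‖y - x‖ ^ 2 / τ ^ 2)) * H y)
      (bound := fun y => (((τ / 2) ^ (d + 1))⁻¹ * C) * ‖H y‖)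
      (Ioi_mem_nhds (by linarith))
      (Eventually.of_forall fun t =>
        (kern_continuous x t).aestronglyMeasurable.mul hH.aestronglyMeasurable)
      (kern_mul_integrable hH x hτ0)
      (Continuous.aestronglyMeasurable (by fun_prop) |>.mul hH.aestronglyMeasurable)
      (Eventually.of_forall fun y t ht => ?_) (hH.norm.const_mul _)
      (Eventually.of_forall fun y t ht => ?_)
    · refine h.2.congr_deriv ?_
      -- The radial test function whose Laplacian represents the derivative in the radius; weak
      -- harmonicity makes that derivative vanish.
      have htest : IsTest Ω (radial profilePrim x τ) :=
        radial_isTest profilePrim_contDiff (fun t ht => profilePrim_eq_zero ht) hτ0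
          ((Metric.closedBall_subset_ball hτ.2).trans hx)
      have h0 := hh _ htest
      simp only [laplacian_radial x hτ0] at h0
      have : ∀ y, -((τ ^ (d + 1))⁻¹ * profileLap d (‖y - x‖ ^ 2 / τ ^ 2)) * H y =
          -(τ ^ 2 * (τ ^ (d + 1))⁻¹) * (H y * ((τ ^ 2)⁻¹ * profileLap d (‖y - x‖ ^ 2 / τ ^ 2))) := by
        intro y
        field_simp
      simp only [this]
      rw [integral_const_mul, h0, mul_zero]
    · have ht' : τ / 2 < t := ht
      have ht0 : 0 < t := by linarith
      rw [norm_mul, norm_neg, norm_mul, Real.norm_of_nonneg (by positivity)]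
      gcongr
      · exact hC _ (by positivity)
    · have ht' : τ / 2 < t := ht
      exact (kern_hasDerivAt x y (by linarith)).mul_const (H y)
  exact isOpen_Ioo.is_const_of_deriv_eq_zero isPreconnected_Ioo
    (fun τ hτ => (key τ hτ).differentiableAt.differentiableWithinAt)
    (fun τ hτ => (key τ hτ).deriv) hε hε'

end Radial

/-! ### Local means of weakly harmonic functions -/

section LocalMean

variable {d : ℕ} {Ω : Set (Space d)} {H : Space d → ℝ}

open Classical in
/-- The local mean of `H` over a ball inside `Ω`, of radius chosen arbitrarily. -/
def localMean (Ω : Set (Space d)) (H : Space d → ℝ) (x : Space d) : ℝ :=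
  if h : ∃ ε, 0 < ε ∧ Metric.closedBall x ε ⊆ Ω then ∫ y in Ω, kern x h.choose y * H y else 0

theorem exists_ball_subset_of_closedBall_subset (hΩ : IsOpen Ω) {x : Space d} {ε : ℝ}
    (hε : 0 < ε) (hx : Metric.closedBall x ε ⊆ Ω) : ∃ r, ε < r ∧ Metric.ball x r ⊆ Ω := by
  obtain ⟨δ, hδ, h⟩ := (isCompact_closedBall x ε).exists_cthickening_subset_open hΩ hx
  rw [cthickening_closedBall hδ.le hε.le] at h
  exact ⟨δ + ε, by linarith, Metric.ball_subset_closedBall.trans h⟩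

/-- Makes the arbitrary choice of radius harmless. Both closed balls sit in slightly larger open
balls, and the larger of these contains both radii strictly, as `mean_eq` demands. -/
theorem WeaklyHarmonic.localMean_eq (hh : WeaklyHarmonic Ω H) (hΩ : IsOpen Ω)
    (hH : IntegrableOn H Ω) {x : Space d} {ε : ℝ} (hε : 0 < ε)
    (hx : Metric.closedBall x ε ⊆ Ω) : localMean Ω H x = ∫ y in Ω, kern x ε y * H y := by
  have h : ∃ ε, 0 < ε ∧ Metric.closedBall x ε ⊆ Ω := ⟨ε, hε, hx⟩
  rw [localMean, dif_pos h]
  obtain ⟨h1, h2⟩ := h.choose_spec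
  obtain ⟨r, hr, hrΩ⟩ := exists_ball_subset_of_closedBall_subset hΩ h1 h2
  obtain ⟨r', hr', hrΩ'⟩ := exists_ball_subset_of_closedBall_subset hΩ hε hx
  rcases le_total r r' with hrr | hrr
  · exact hh.mean_eq hH hrΩ' ⟨h1, hr.trans_le hrr⟩ ⟨hε, hr'⟩
  · exact hh.mean_eq hH hrΩ ⟨h1, hr⟩ ⟨hε, hr'.trans_le hrr⟩

theorem kern_contDiff (x : Space d) (ε : ℝ) : ContDiff ℝ ∞ (kern x ε) :=
  contDiff_const.mul (radial_contDiff profile_contDiff x ε)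

theorem kern_eq_zero {x y : Space d} {ε : ℝ} (hε : 0 < ε) (hy : ε ≤ dist y x) :
    kern x ε y = 0 := by
  rw [kern, radial_eq_zero (fun t ht => profile_eq_zero ht) hε hy, mul_zero]

theorem kern_tsupport {x : Space d} {ε : ℝ} (hε : 0 < ε) :
    tsupport (kern x ε) ⊆ Metric.closedBall x ε := by
  refine closure_minimal (fun y hy => ?_) Metric.isClosed_closedBall
  rw [Metric.mem_closedBall]
  by_contra hlt
  exact hy (kern_eq_zero hε (le_of_not_ge hlt))

theorem kern_hasCompactSupport (x : Space d) {ε : ℝ} (hε : 0 < ε) :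
    HasCompactSupport (kern x ε) :=
  (isCompact_closedBall x ε).of_isClosed_subset (isClosed_tsupport _) (kern_tsupport hε)

theorem kern_isTest {x : Space d} {ε : ℝ} (hε : 0 < ε) (hx : Metric.closedBall x ε ⊆ Ω) :
    IsTest Ω (kern x ε) :=
  ⟨kern_contDiff x ε, kern_hasCompactSupport x hε, (kern_tsupport hε).trans hx⟩

theorem pderiv_kern (x : Space d) (ε : ℝ) (k : Fin d) (y : Space d) : pderiv k (kern x ε) y =
    (ε ^ d)⁻¹ * (deriv profile (‖y - x‖ ^ 2 / ε ^ 2) * (2 * (y k - x k) / ε ^ 2)) := by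
  rw [← pderiv_radial profile_differentiable]
  exact pderiv_smul k ((ε ^ d)⁻¹) (radial_contDiff profile_contDiff x ε) y

theorem exists_pderiv_kern_le : ∃ C : ℝ, 0 ≤ C ∧ ∀ (x : Space d) (ε : ℝ), 0 < ε →
    ∀ (k : Fin d) (y : Space d), ‖pderiv k (kern x ε) y‖ₑ ≤
      (Metric.ball x ε).indicator (fun _ => ENNReal.ofReal (C * (ε ^ (d + 1))⁻¹)) y := by
  obtain ⟨C, hC⟩ := isCompact_Icc.exists_bound_of_continuousOn (s := Icc (0 : ℝ) 1)
    (profile_contDiff.continuous_deriv (by simp)).continuousOn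
  have hC0 : 0 ≤ C := (norm_nonneg _).trans (hC 0 (by simp))
  refine ⟨2 * C, by positivity, fun x ε hε k y => ?_⟩
  rw [pderiv_kern]
  by_cases hy : y ∈ Metric.ball x ε
  · rw [indicator_of_mem hy, ← ofReal_norm]
    refine ENNReal.ofReal_le_ofReal ?_
    have h1 : ‖y - x‖ ≤ ε := by
      rw [← dist_eq_norm]
      exact (Metric.mem_ball.1 hy).le
    have h2 : ‖deriv profile (‖y - x‖ ^ 2 / ε ^ 2)‖ ≤ C := by
      refine hC _ ⟨by positivity, div_le_one_of_le₀ ?_ (by positivity)⟩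
      gcongr
    have h3 : |y k - x k| ≤ ε := by
      have := PiLp.norm_apply_le (y - x) k
      simpa using this.trans h1
    rw [norm_mul, norm_mul, norm_div, norm_mul, Real.norm_of_nonneg (by positivity : 0 ≤ (ε ^ d)⁻¹),
      Real.norm_of_nonneg (by positivity : 0 ≤ ε ^ 2), Real.norm_ofNat, Real.norm_eq_abs (y k - x k)]
    calc (ε ^ d)⁻¹ * (‖deriv profile (‖y - x‖ ^ 2 / ε ^ 2)‖ * (2 * |y k - x k| / ε ^ 2))
        ≤ (ε ^ d)⁻¹ * (C * (2 * ε / ε ^ 2)) := by gcongr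
      _ = 2 * C * (ε ^ (d + 1))⁻¹ := by
          rw [pow_succ]
          field_simp
          ring
  · rw [indicator_of_notMem hy]
    have h1 : 1 ≤ ‖y - x‖ ^ 2 / ε ^ 2 := by
      rw [Metric.mem_ball, not_lt, dist_eq_norm] at hy
      rw [one_le_div (by positivity)]
      gcongr
    have h2 : deriv profile (‖y - x‖ ^ 2 / ε ^ 2) = 0 := by
      -- A zero of the nonnegative profile is a minimum, which also covers the transition at `s =
      -- 1`.
      have hz : ∀ s, profile s = 0 → deriv profile s = 0 := by
        intro s hs
        refine IsLocalMin.deriv_eq_zero (Eventually.of_forall fun t => ?_)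
        rw [hs]
        exact profile_nonneg t
      exact hz _ (profile_eq_zero h1)
    simp [h2]

theorem mean_eq_convolution (hΩ : MeasurableSet Ω) (ε : ℝ) (x : Space d) :
    ∫ y in Ω, kern x ε y * H y =
      convolution (Ω.indicator H) (kern 0 ε) (ContinuousLinearMap.mul ℝ ℝ) volume x := by
  rw [convolution, ← integral_indicator hΩ]
  refine integral_congr_ae (Eventually.of_forall fun y => ?_)
  have : kern x ε y = kern 0 ε (x - y) := by
    unfold kern radial
    rw [sub_zero, norm_sub_rev]
  by_cases hy : y ∈ Ω
  · simp [hy, this, mul_comm]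
  · simp [hy]

theorem mean_contDiff (hΩ : MeasurableSet Ω) (hH : IntegrableOn H Ω) {ε : ℝ} (hε : 0 < ε) :
    ContDiff ℝ 1 fun x => ∫ y in Ω, kern x ε y * H y := by
  simp only [mean_eq_convolution hΩ]
  exact (kern_hasCompactSupport 0 hε).contDiff_convolution_right (n := 1) _
    (hH.integrable_indicator hΩ).locallyIntegrable ((kern_contDiff 0 ε).of_le (by simp))

/-- The kernel depends only on `x - y`, so a derivative in the centre is minus a derivative in `y`,
to which a weak hypothesis on `H` applies. -/
theorem pderiv_mean (hΩ : MeasurableSet Ω) (hH : IntegrableOn H Ω) {ε : ℝ} (hε : 0 < ε)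
    (k : Fin d) (x : Space d) : pderiv k (fun x => ∫ y in Ω, kern x ε y * H y) x =
      -∫ y in Ω, H y * pderiv k (kern x ε) y := by
  simp only [mean_eq_convolution hΩ]
  have hloc := (hH.integrable_indicator hΩ).locallyIntegrable
  have hcs := kern_hasCompactSupport (0 : Space d) hε
  have hc1 : ContDiff ℝ 1 (kern (0 : Space d) ε) := (kern_contDiff 0 ε).of_le (by simp)
  rw [pderiv, (hcs.hasFDerivAt_convolution_right (ContinuousLinearMap.mul ℝ ℝ) hloc hc1 x).fderiv,
    convolution_precompR_apply _ hloc (hcs.fderiv ℝ) (hc1.continuous_fderiv one_ne_zero),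
    convolution, ← integral_neg, ← integral_indicator hΩ]
  refine integral_congr_ae (Eventually.of_forall fun y => ?_)
  have : fderiv ℝ (kern 0 ε) (x - y) (EuclideanSpace.single k 1) = -pderiv k (kern x ε) y := by
    change pderiv k (kern 0 ε) (x - y) = _
    rw [pderiv_kern, pderiv_kern, sub_zero, norm_sub_rev]
    simp
    ring
  by_cases hy : y ∈ Ω
  · simp [hy, this]
  · simp [hy]

theorem enorm_fderiv_le_sum_pderiv (f : Space d → ℝ) (x : Space d) :
    ‖fderiv ℝ f x‖ₑ ≤ ∑ k, ‖pderiv k f x‖ₑ := by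
  have h : ‖fderiv ℝ f x‖ ≤ ∑ k, ‖pderiv k f x‖ := by
    refine ContinuousLinearMap.opNorm_le_bound _ (by positivity) fun v => ?_
    have h1 : fderiv ℝ f x v = ∑ k, v k * pderiv k f x := by
      conv_lhs => rw [← (EuclideanSpace.basisFun (Fin d) ℝ).sum_repr v]
      simp [pderiv]
    rw [h1, Finset.sum_mul]
    refine (norm_sum_le _ _).trans (Finset.sum_le_sum fun k _ => ?_)
    rw [norm_mul, mul_comm]
    gcongr
    exact PiLp.norm_apply_le v k
  simp only [← ofReal_norm]
  rw [← ENNReal.ofReal_sum_of_nonneg fun _ _ => norm_nonneg _]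
  exact ENNReal.ofReal_le_ofReal h

/-- One radius serves all nearby centres, so the local mean, despite its choice of radii, is locally
a convolution and may be differentiated as such. -/
theorem WeaklyHarmonic.localMean_eventuallyEq (hh : WeaklyHarmonic Ω H) (hΩ : IsOpen Ω)
    (hH : IntegrableOn H Ω) {x : Space d} {ε : ℝ} (hε : 0 < ε)
    (hx : Metric.closedBall x ε ⊆ Ω) :
    localMean Ω H =ᶠ[𝓝 x] fun x => ∫ y in Ω, kern x ε y * H y := by
  obtain ⟨r, hr, hrΩ⟩ := exists_ball_subset_of_closedBall_subset hΩ hε hx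
  filter_upwards [Metric.ball_mem_nhds x (sub_pos.2 hr)] with z hz
  refine hh.localMean_eq hΩ hH hε fun y hy => hrΩ ?_
  rw [Metric.mem_ball] at hz ⊢
  rw [Metric.mem_closedBall] at hy
  have := dist_triangle y z x
  linarith

/-- If the weak derivatives of a weakly harmonic function are controlled by weak derivatives of
functions bounded by `N`, then those of its local means are controlled by `N ^ 2`. -/
theorem exists_gradBound_localMean (d : ℕ) : ∃ C : ℝ≥0∞, C ≠ ⊤ ∧ ∀ (Ω : Set (Space d))
    (H : Space d → ℝ) (N : Space d → ℝ≥0∞), IsOpen Ω → IntegrableOn H Ω → WeaklyHarmonic Ω H →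
    Measurable N →
    (∀ k φ, IsTest Ω φ → ‖∫ y in Ω, H y * pderiv k φ y‖ₑ ≤
      3 * ∫⁻ y in Ω, N y * ∑ l, ‖pderiv l φ y‖ₑ) →
    GradBound Ω (localMean Ω H) fun y => C * N y ^ 2 := by
  obtain ⟨C, hC0, hC⟩ := exists_pderiv_kern_le (d := d)
  have hvol1 : volume (Metric.ball (0 : Space d) 1) ≠ ⊤ := measure_ball_lt_top.ne
  refine ⟨(d * (3 * (d * ENNReal.ofReal C))) ^ 2 * volume (Metric.ball (0 : Space d) 1),
    by finiteness, fun Ω H N hΩ hH hh hN hw => ⟨?_, by fun_prop, ?_⟩⟩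
  · intro x hx
    obtain ⟨r, hr, hrΩ⟩ := GradBound.exists_ball hΩ hx
    exact ((mean_contDiff hΩ.measurableSet hH (by positivity)).contDiffAt.congr_of_eventuallyEq
      (hh.localMean_eventuallyEq hΩ hH (by positivity) hrΩ)).contDiffWithinAt
  · intro x ε hε hx
    -- The derivative of the mean is `H` tested against a derivative of the kernel. The hypothesis
    -- trades it for `N` against kernel derivatives of size `ε^(-(d+1))`, supported in the ball.
    have h1 : ∀ k, ‖pderiv k (localMean Ω H) x‖ₑ ≤ 3 * (d * ENNReal.ofReal C *
        ENNReal.ofReal ((ε ^ (d + 1))⁻¹) * ∫⁻ y in Metric.ball x ε, N y) := by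
      intro k
      have e1 : pderiv k (localMean Ω H) x = -∫ y in Ω, H y * pderiv k (kern x ε) y := by
        rw [← pderiv_mean hΩ.measurableSet hH hε, pderiv, pderiv,
          (hh.localMean_eventuallyEq hΩ hH hε hx).fderiv_eq]
      rw [e1, enorm_neg]
      refine (hw k _ (kern_isTest hε hx)).trans ?_
      gcongr
      have e2 : ∀ y, N y * ∑ l, ‖pderiv l (kern x ε) y‖ₑ ≤ (Metric.ball x ε).indicator
          (fun y => (d * ENNReal.ofReal C * ENNReal.ofReal ((ε ^ (d + 1))⁻¹)) * N y) y := by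
        intro y
        have := Finset.sum_le_sum fun l (_ : l ∈ Finset.univ) => hC x ε hε l y
        rw [Finset.sum_const, Finset.card_univ, Fintype.card_fin, nsmul_eq_mul] at this
        refine (mul_le_mul_right this _).trans ?_
        by_cases hy : y ∈ Metric.ball x ε
        · rw [indicator_of_mem hy, indicator_of_mem hy, ENNReal.ofReal_mul hC0]
          refine le_of_eq ?_
          ring
        · rw [indicator_of_notMem hy, indicator_of_notMem hy]
          simp
      refine (lintegral_mono e2).trans ?_
      rw [lintegral_indicator measurableSet_ball, lintegral_const_mul _ hN]
      gcongr
      exact Measure.restrict_le_self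
    have h2 : ‖fderiv ℝ (localMean Ω H) x‖ₑ ≤ d * (3 * (d * ENNReal.ofReal C *
        ENNReal.ofReal ((ε ^ (d + 1))⁻¹) * ∫⁻ y in Metric.ball x ε, N y)) := by
      refine (enorm_fderiv_le_sum_pderiv _ _).trans ?_
      refine (Finset.sum_le_sum fun k _ => h1 k).trans ?_
      simp
    have h3 : (∫⁻ y in Metric.ball x ε, N y) ^ 2 ≤
        ENNReal.ofReal (ε ^ d) * volume (Metric.ball (0 : Space d) 1) *
          ∫⁻ y in Metric.ball x ε, N y ^ 2 := by
      refine (lintegral_sq_le hN.aemeasurable).trans ?_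
      rw [Measure.restrict_apply_univ, Measure.addHaar_ball_of_pos _ _ hε,
        finrank_euclideanSpace_fin]
    -- Scale invariance: the powers `d + 2`, `-2(d + 1)` from the kernel and `d` from Cauchy–Schwarz
    -- on the ball cancel.
    have h4 : ENNReal.ofReal ε ^ (d + 2) * ENNReal.ofReal ((ε ^ (d + 1))⁻¹) ^ 2 *
        ENNReal.ofReal (ε ^ d) = 1 := by
      rw [← ENNReal.ofReal_pow hε.le, ← ENNReal.ofReal_pow (by positivity),
        ← ENNReal.ofReal_mul (by positivity), ← ENNReal.ofReal_mul (by positivity),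
        ← ENNReal.ofReal_one]
      congr 1
      field_simp
      ring
    rw [lintegral_const_mul _ (by fun_prop)]
    calc ENNReal.ofReal ε ^ (d + 2) * ‖fderiv ℝ (localMean Ω H) x‖ₑ ^ 2
        ≤ ENNReal.ofReal ε ^ (d + 2) * (d * (3 * (d * ENNReal.ofReal C *
        ENNReal.ofReal ((ε ^ (d + 1))⁻¹) * ∫⁻ y in Metric.ball x ε, N y))) ^ 2 := by gcongr
      _ = ENNReal.ofReal ε ^ (d + 2) * ENNReal.ofReal ((ε ^ (d + 1))⁻¹) ^ 2 *
          (d * (3 * (d * ENNReal.ofReal C))) ^ 2 * (∫⁻ y in Metric.ball x ε, N y) ^ 2 := by ring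
      _ ≤ ENNReal.ofReal ε ^ (d + 2) * ENNReal.ofReal ((ε ^ (d + 1))⁻¹) ^ 2 *
          (d * (3 * (d * ENNReal.ofReal C))) ^ 2 * (ENNReal.ofReal (ε ^ d) *
            volume (Metric.ball (0 : Space d) 1) * ∫⁻ y in Metric.ball x ε, N y ^ 2) := by gcongr
      _ = (ENNReal.ofReal ε ^ (d + 2) * ENNReal.ofReal ((ε ^ (d + 1))⁻¹) ^ 2 *
          ENNReal.ofReal (ε ^ d)) * ((d * (3 * (d * ENNReal.ofReal C))) ^ 2 *
            volume (Metric.ball (0 : Space d) 1) * ∫⁻ y in Metric.ball x ε, N y ^ 2) := by ring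
      _ = _ := by rw [h4, one_mul]

/-- The total mass of the kernels. -/
def kernMass (d : ℕ) : ℝ := ∫ y : Space d, kern 0 1 y

theorem kernMass_pos (d : ℕ) : 0 < kernMass d := by
  unfold kernMass
  refine (kern_continuous 0 1).integral_pos_of_hasCompactSupport_nonneg_nonzero
    (kern_hasCompactSupport 0 one_pos) (fun y => ?_) (x := 0) ?_
  · exact mul_nonneg (by positivity) (profile_nonneg _)
  · simp only [kern, radial]
    have := profile_pos (t := 0) one_pos
    simp [this.ne']

theorem integral_kern (x : Space d) {ε : ℝ} (hε : 0 < ε) : ∫ y, kern x ε y = kernMass d := by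
  have h1 : ∀ y, kern x ε y = (fun w => (ε ^ d)⁻¹ * kern 0 1 (ε⁻¹ • w)) (y - x) := by
    intro y
    simp only [kern, radial, sub_zero, norm_smul, norm_inv, Real.norm_of_nonneg hε.le]
    simp only [one_pow, inv_one, one_mul, div_one, mul_pow, inv_pow]
    rw [div_eq_inv_mul]
  simp only [h1]
  rw [integral_sub_right_eq_self (fun w => (ε ^ d)⁻¹ * kern 0 1 (ε⁻¹ • w)) x,
    integral_const_mul, Measure.integral_comp_smul, finrank_euclideanSpace_fin, kernMass]
  simp only [inv_pow, inv_inv, smul_eq_mul]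
  rw [abs_of_pos (by positivity), inv_mul_cancel_left₀ (by positivity)]

/-- A weakly harmonic function agrees almost everywhere with its local means. -/
theorem WeaklyHarmonic.localMean_ae_eq (hh : WeaklyHarmonic Ω H) (hΩ : IsOpen Ω)
    (hH : IntegrableOn H Ω) :
    ∀ᵐ x ∂volume.restrict Ω, localMean Ω H x = kernMass d * H x := by
  have hloc := (hH.integrable_indicator hΩ.measurableSet).locallyIntegrable
  have hae := IsUnifLocDoublingMeasure.ae_tendsto_average_norm_sub volume hloc 1
  rw [ae_restrict_iff' hΩ.measurableSet]
  filter_upwards [hae] with x hx hxΩ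
  obtain ⟨r, hr, hrΩ⟩ := Metric.nhds_basis_closedBall.mem_iff.1 (hΩ.mem_nhds hxΩ)
  have ht : Tendsto (fun ε : ℝ => ε) (𝓝[>] 0) (𝓝[>] 0) := tendsto_id
  have h1 := hx (fun _ => x) (fun ε => ε) ht (by
    filter_upwards [self_mem_nhdsWithin] with ε hε
    refine Metric.mem_closedBall_self ?_
    rw [one_mul]
    exact le_of_lt hε)
  -- At a Lebesgue point: the kernel is at most `ε^(-d)`, so its error is dominated by the average
  -- oscillation over the ball. The left side is independent of `ε`; the kernel is not normalised,
  -- hence the factor `kernMass d`.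
  have h2 : ∀ ε ∈ Ioc 0 r, ‖localMean Ω H x - kernMass d * H x‖ ≤
      (volume.real (Metric.closedBall (0 : Space d) 1)) *
        ⨍ y in Metric.closedBall x ε, ‖Ω.indicator H y - Ω.indicator H x‖ := by
    intro ε hε
    have hε0 : 0 < ε := hε.1
    have hsub : Metric.closedBall x ε ⊆ Ω :=
      (Metric.closedBall_subset_closedBall hε.2).trans hrΩ
    have hk : Integrable (kern x ε) :=
      (kern_continuous x ε).integrable_of_hasCompactSupport (kern_hasCompactSupport x hε0)
    have e1 : localMean Ω H x = ∫ y, kern x ε y * Ω.indicator H y := by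
      rw [hh.localMean_eq hΩ hH hε0 hsub, ← integral_indicator hΩ.measurableSet]
      refine integral_congr_ae (Eventually.of_forall fun y => ?_)
      by_cases hy : y ∈ Ω <;> simp [hy]
    have e2 : kernMass d * H x = ∫ y, kern x ε y * Ω.indicator H x := by
      rw [integral_mul_const, integral_kern x hε0, indicator_of_mem hxΩ]
    have hi : Integrable fun y => kern x ε y * Ω.indicator H y :=
      (hH.integrable_indicator hΩ.measurableSet).bdd_mul
        (kern_continuous x ε).aestronglyMeasurable
        (Eventually.of_forall fun y => kern_bound x hε0 y)
    have e3 : localMean Ω H x - kernMass d * H x =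
        ∫ y in Metric.closedBall x ε, kern x ε y * (Ω.indicator H y - Ω.indicator H x) := by
      rw [e1, e2, ← integral_sub hi (hk.mul_const _), setIntegral_eq_integral_of_forall_compl_eq_zero]
      · simp only [mul_sub]
      · intro y hy
        rw [kern_eq_zero hε0, zero_mul]
        rw [Metric.mem_closedBall, not_le] at hy
        exact hy.le
    have hvol : volume.real (Metric.closedBall x ε) =
        ε ^ d * volume.real (Metric.closedBall (0 : Space d) 1) := by
      rw [measureReal_def, Measure.addHaar_closedBall' _ _ hε0.le, finrank_euclideanSpace_fin,
        ENNReal.toReal_mul, ENNReal.toReal_ofReal (by positivity), measureReal_def]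
    have hvpos : 0 < volume.real (Metric.closedBall (0 : Space d) 1) :=
      ENNReal.toReal_pos (Metric.measure_closedBall_pos _ _ one_pos).ne'
        measure_closedBall_lt_top.ne
    have hint : IntegrableOn (fun y => ‖Ω.indicator H y - Ω.indicator H x‖)
        (Metric.closedBall x ε) :=
      ((hH.integrable_indicator hΩ.measurableSet).integrableOn.sub
        (integrableOn_const measure_closedBall_lt_top.ne)).norm
    rw [e3, setAverage_eq, hvol, smul_eq_mul, mul_inv, mul_comm ((ε ^ d)⁻¹), mul_assoc,
      mul_inv_cancel_left₀ hvpos.ne', ← integral_const_mul]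
    refine norm_integral_le_of_norm_le (hint.const_mul _) (Eventually.of_forall fun y => ?_)
    rw [norm_mul]
    gcongr
    exact kern_bound x hε0 y
  have h3 : ‖localMean Ω H x - kernMass d * H x‖ ≤
      (volume.real (Metric.closedBall (0 : Space d) 1)) * 0 := by
    refine ge_of_tendsto (h1.const_mul _) ?_
    filter_upwards [Ioc_mem_nhdsGT hr] with ε hε using h2 ε hε
  rw [mul_zero] at h3
  exact sub_eq_zero.1 (norm_le_zero_iff.1 h3)

end LocalMean

/-! ### Korn's inequality modulo rigid motions -/

section Calculus

variable {d : ℕ} {Ω : Set (Space d)}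

theorem pderiv_contDiff {φ : Space d → ℝ} (h : ContDiff ℝ ∞ φ) (i : Fin d) :
    ContDiff ℝ ∞ (pderiv i φ) :=
  (h.fderiv_right (m := ∞) (by simp)).clm_apply contDiff_const

theorem pderiv_hasCompactSupport {φ : Space d → ℝ} (hc : HasCompactSupport φ) (i : Fin d) :
    HasCompactSupport (pderiv i φ) := hc.fderiv_apply (𝕜 := ℝ) _

theorem IsTest.pderiv {φ : Space d → ℝ} (h : IsTest Ω φ) (i : Fin d) : IsTest Ω (pderiv i φ) where
  contDiff := pderiv_contDiff h.contDiff i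
  hasCompactSupport := pderiv_hasCompactSupport h.hasCompactSupport i
  tsupport_subset := (tsupport_fderiv_apply_subset ℝ _).trans h.tsupport_subset

theorem pderiv_comm {φ : Space d → ℝ} (h : ContDiff ℝ ∞ φ) (i j : Fin d) :
    pderiv i (pderiv j φ) = pderiv j (pderiv i φ) := by
  funext x
  have h1 : ∀ k l : Fin d, pderiv k (pderiv l φ) x =
      fderiv ℝ (fderiv ℝ φ) x (EuclideanSpace.single k 1) (EuclideanSpace.single l 1) := by
    intro k l
    have hd : DifferentiableAt ℝ (fderiv ℝ φ) x :=
      (h.fderiv_right (m := ∞) (by simp)).differentiable (by simp) x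
    have : fderiv ℝ (pderiv l φ) x = (fderiv ℝ (fderiv ℝ φ) x).flip (EuclideanSpace.single l 1) := by
      have := (hd.hasFDerivAt.clm_apply (hasFDerivAt_const (EuclideanSpace.single l (1 : ℝ)) x))
      change fderiv ℝ (fun y => fderiv ℝ φ y (EuclideanSpace.single l 1)) x = _
      simpa using this.fderiv
    rw [StokesDarcy.pderiv, this]
    rfl
  rw [h1, h1]
  refine (h.contDiffAt.isSymmSndFDerivAt ?_) _ _
  rw [minSmoothness_of_isRCLikeNormedField]
  exact WithTop.coe_le_coe.2 (le_top : (2 : ℕ∞) ≤ ⊤)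

theorem integral_mul_pderiv {u φ : Space d → ℝ} (hu : ContDiff ℝ ∞ u) (hφ : ContDiff ℝ ∞ φ)
    (hc : HasCompactSupport φ) (i : Fin d) :
    ∫ x, u x * pderiv i φ x = -∫ x, pderiv i u x * φ x := by
  refine integral_mul_fderiv_eq_neg_fderiv_mul_of_integrable (v := EuclideanSpace.single i 1)
    ?_ ?_ ?_ (fun x _ => hu.differentiable (by simp) x) (fun x _ => hφ.differentiable (by simp) x)
  · exact ((continuous_pderiv i hu).mul hφ.continuous).integrable_of_hasCompactSupport hc.mul_left
  · exact (hu.continuous.mul (continuous_pderiv i hφ)).integrable_of_hasCompactSupport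
      (pderiv_hasCompactSupport hc i).mul_left
  · exact (hu.continuous.mul hφ.continuous).integrable_of_hasCompactSupport hc.mul_left

theorem IsTest.setIntegral_mul {φ : Space d → ℝ} (h : IsTest Ω φ) (u : Space d → ℝ) :
    ∫ x in Ω, u x * φ x = ∫ x, u x * φ x := by
  refine setIntegral_eq_integral_of_forall_compl_eq_zero fun x hx => ?_
  have : φ x = 0 := by
    by_contra hne
    exact hx (h.tsupport_subset (subset_tsupport φ hne))
  rw [this, mul_zero]

/-- The gradient of a smooth function is weakly curl-free. -/
theorem setIntegral_pderiv_mul_pderiv_comm {u φ : Space d → ℝ} (hu : ContDiff ℝ ∞ u)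
    (hφ : IsTest Ω φ) (i j : Fin d) :
    ∫ x in Ω, pderiv i u x * pderiv j φ x = ∫ x in Ω, pderiv j u x * pderiv i φ x := by
  rw [(hφ.pderiv j).setIntegral_mul, (hφ.pderiv i).setIntegral_mul]
  have h1 := integral_mul_pderiv hu (hφ.pderiv j).contDiff (hφ.pderiv j).hasCompactSupport i
  have h2 := integral_mul_pderiv hu (hφ.pderiv i).contDiff (hφ.pderiv i).hasCompactSupport j
  rw [pderiv_comm hφ.contDiff] at h1
  linarith

theorem inner_toLp (f : L2 Ω) {ψ : Space d → ℝ} (hψ : MemLp ψ 2 (volume.restrict Ω)) :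
    inner ℝ f (hψ.toLp ψ) = ∫ x in Ω, f x * ψ x := by
  rw [L2.inner_def]
  refine integral_congr_ae ?_
  filter_upwards [hψ.coeFn_toLp] with x hx
  rw [hx]
  simp [mul_comm]

end Calculus

/-! ### Projection onto the gradients of test functions -/

section Projection

variable {d : ℕ} {Ω : Set (Space d)}

/-- The partial derivative of a smooth compactly supported function, in `L²(Ω)`. -/
def gradL2 (Ω : Set (Space d)) {φ : Space d → ℝ} (h : ContDiff ℝ ∞ φ) (hc : HasCompactSupport φ)
    (i : Fin d) : L2 Ω := (memLp_pderiv_test Ω h hc i).toLp (pderiv i φ)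

/-- The closure in `L²(Ω)^d` of the gradients of test functions. -/
def gradClosure (Ω : Set (Space d)) : Submodule ℝ (PiLp 2 fun _ : Fin d => L2 Ω) :=
  (Submodule.span ℝ {w | ∃ φ, ∃ h : IsTest Ω φ,
    w = WithLp.toLp 2 (gradL2 Ω h.contDiff h.hasCompactSupport)}).topologicalClosure

instance (Ω : Set (Space d)) : (gradClosure Ω).HasOrthogonalProjection := by
  have : CompleteSpace (gradClosure Ω) :=
    (Submodule.isClosed_topologicalClosure _).completeSpace_coe
  infer_instance

/-- The condition is linear and closed in `L²`, so it passes from gradients of test functions, where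
mixed derivatives commute, to the closure of their span. -/
theorem gradClosure_curl_free {w : PiLp 2 fun _ : Fin d => L2 Ω} (hw : w ∈ gradClosure Ω)
    {φ : Space d → ℝ} (hφ : IsTest Ω φ) (j k : Fin d) :
    inner ℝ (w j) (gradL2 Ω hφ.contDiff hφ.hasCompactSupport k) =
      inner ℝ (w k) (gradL2 Ω hφ.contDiff hφ.hasCompactSupport j) := by
  have hclosed : IsClosed {w : PiLp 2 fun _ : Fin d => L2 Ω |
      inner ℝ (w j) (gradL2 Ω hφ.contDiff hφ.hasCompactSupport k) =
      inner ℝ (w k) (gradL2 Ω hφ.contDiff hφ.hasCompactSupport j)} :=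
    isClosed_eq (by fun_prop) (by fun_prop)
  refine closure_minimal ?_ hclosed hw
  intro w hw
  refine Submodule.span_induction (p := fun w _ =>
    inner ℝ (w j) (gradL2 Ω hφ.contDiff hφ.hasCompactSupport k) =
      inner ℝ (w k) (gradL2 Ω hφ.contDiff hφ.hasCompactSupport j)) ?_ ?_ ?_ ?_ hw
  · rintro _ ⟨ψ, hψ, rfl⟩
    simp only [gradL2]
    rw [inner_toLp, inner_toLp]
    have := setIntegral_pderiv_mul_pderiv_comm hψ.contDiff hφ j k
    calc _ = ∫ x in Ω, pderiv j ψ x * pderiv k φ x := by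
          refine integral_congr_ae ?_
          filter_upwards [(memLp_pderiv_test Ω hψ.contDiff hψ.hasCompactSupport j).coeFn_toLp]
            with x hx
          rw [hx]
      _ = _ := by
          rw [this]
          refine integral_congr_ae ?_
          filter_upwards [(memLp_pderiv_test Ω hψ.contDiff hψ.hasCompactSupport k).coeFn_toLp]
            with x hx
          rw [hx]
  · simp
  · intro x y _ _ hx hy
    simp only [PiLp.add_apply, inner_add_left, hx, hy]
  · intro c x _ hx
    simp only [PiLp.smul_apply, real_inner_smul_left, hx]

theorem inner_gradL2_comm {u φ : Space d → ℝ} (hu : ContDiff ℝ ∞ u) (hc : HasCompactSupport u)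
    (hφ : IsTest Ω φ) (j k : Fin d) :
    inner ℝ (gradL2 Ω hu hc j) (gradL2 Ω hφ.contDiff hφ.hasCompactSupport k) =
      inner ℝ (gradL2 Ω hu hc k) (gradL2 Ω hφ.contDiff hφ.hasCompactSupport j) := by
  have e : ∀ a b : Fin d, inner ℝ (gradL2 Ω hu hc a)
      (gradL2 Ω hφ.contDiff hφ.hasCompactSupport b) = ∫ x in Ω, pderiv a u x * pderiv b φ x := by
    intro a b
    rw [gradL2, gradL2, inner_toLp]
    refine integral_congr_ae ?_
    filter_upwards [(memLp_pderiv_test Ω hu hc a).coeFn_toLp] with x hx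
    rw [hx]
  rw [e, e, setIntegral_pderiv_mul_pderiv_comm hu hφ]

/-- A decomposition of the gradient of a smooth vector field into a part controlled by the
symmetric gradient and a part whose entries are weakly harmonic. -/
theorem exists_harmonic_decomposition (Ω : Set (Space d)) {u : Fin d → Space d → ℝ}
    (hu : ∀ i, ContDiff ℝ ∞ (u i)) (hc : ∀ i, HasCompactSupport (u i)) {δ : ℝ}
    (hδ : ∀ i j, ‖gradL2 Ω (hu i) (hc i) j + gradL2 Ω (hu j) (hc j) i‖ ≤ δ) :
    ∃ N H : Fin d → Fin d → L2 Ω, (∀ i j, gradL2 Ω (hu i) (hc i) j = N i j + H i j) ∧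
      (∀ i j, ‖N i j‖ ≤ d * ((1 + d) * δ)) ∧
      (∀ i φ, IsTest Ω φ → ∑ j, ∫ x in Ω, H i j x * pderiv j φ x = 0) ∧
      ∀ i j k φ, IsTest Ω φ → ∫ x in Ω, H i j x * pderiv k φ x =
        ∫ x in Ω, H i k x * pderiv j φ x := by
  set g : Fin d → Fin d → L2 Ω := fun i j => gradL2 Ω (hu i) (hc i) j with hg
  -- The decisive choice: `T` is controlled by the symmetric gradient alone, since its trace term is
  -- the sum of the diagonal entries.
  set T : Fin d → Fin d → L2 Ω := fun i j =>
    (g i j + g j i) - if i = j then ∑ k, g k k else 0 with hT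
  set P : Fin d → PiLp 2 fun _ : Fin d => L2 Ω := fun i =>
    (gradClosure Ω).starProjection (WithLp.toLp 2 (g i)) with hP
  have hgrad : ∀ {φ} (hφ : IsTest Ω φ),
      WithLp.toLp 2 (gradL2 Ω hφ.contDiff hφ.hasCompactSupport) ∈ gradClosure Ω := fun hφ =>
    Submodule.le_topologicalClosure _ (Submodule.subset_span ⟨_, hφ, rfl⟩)
  have hTg : ∀ i, P i = (gradClosure Ω).starProjection (WithLp.toLp 2 (T i)) := by
    intro i
    -- The entries of the difference are `-∂_i u_j + δ_ij div u`. Against `∂_j φ` they cancel after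
    -- summation, because `∫ ∂_i u_j ∂_j φ = ∫ ∂_j u_j ∂_i φ`. Thus the rows of the gradient and of
    -- `T` have equal projections.
    have horth : WithLp.toLp 2 (g i) - WithLp.toLp 2 (T i) ∈ (gradClosure Ω)ᗮ := by
      rw [gradClosure, Submodule.orthogonal_closure, Submodule.mem_orthogonal]
      intro w hw
      refine Submodule.span_induction (p := fun w _ =>
        inner ℝ w (WithLp.toLp 2 (g i) - WithLp.toLp 2 (T i)) = 0) ?_ ?_ ?_ ?_ hw
      · rintro _ ⟨φ, hφ, rfl⟩
        rw [PiLp.inner_apply]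
        simp only [PiLp.sub_apply, hT]
        set G := gradL2 Ω hφ.contDiff hφ.hasCompactSupport
        have e1 : ∀ j, inner ℝ (G j) (g i j - ((g i j + g j i) - if i = j then ∑ k, g k k else 0))
            = -inner ℝ (G j) (g j i) + if i = j then inner ℝ (G j) (∑ k, g k k) else 0 := by
          intro j
          split_ifs <;> simp only [inner_sub_right, inner_add_right, inner_zero_right] <;> ring
        simp only [e1, Finset.sum_add_distrib, Finset.sum_ite_eq, Finset.mem_univ, if_true,
          inner_sum, Finset.sum_neg_distrib]
        have e2 : ∀ j, inner ℝ (G j) (g j i) = inner ℝ (G i) (g j j) := by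
          intro j
          have := inner_gradL2_comm (hu j) (hc j) hφ j i
          rw [real_inner_comm, ← this, real_inner_comm]
        simp only [e2]
        ring
      · simp
      · intro x y _ _ hx hy
        rw [inner_add_left, hx, hy, add_zero]
      · intro c x _ hx
        rw [real_inner_smul_left, hx, mul_zero]
    have h0 := (Submodule.starProjection_apply_eq_zero_iff _).2 horth
    rw [map_sub, sub_eq_zero] at h0
    exact h0
  have hδ0 : ∀ i : Fin d, 0 ≤ δ := fun i => (norm_nonneg _).trans (hδ i i)
  have hTn : ∀ i j, ‖T i j‖ ≤ (1 + d) * δ := by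
    intro i j
    have h1 : ‖∑ k, g k k‖ ≤ d * δ := by
      refine (norm_sum_le _ _).trans ?_
      have : ∀ k ∈ Finset.univ, ‖g k k‖ ≤ δ := by
        intro k _
        have h2 := hδ k k
        rw [← two_smul ℝ, norm_smul, Real.norm_ofNat] at h2
        have := norm_nonneg (g k k)
        linarith
      simpa using Finset.sum_le_sum this
    refine (norm_sub_le _ _).trans ?_
    have h3 : ‖if i = j then ∑ k, g k k else 0‖ ≤ d * δ := by
      split_ifs
      · exact h1
      · rw [norm_zero]
        have := hδ0 i
        positivity
    have := hδ i j
    linarith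
  refine ⟨fun i j => P i j, fun i j => g i j - P i j, fun i j => by simp [hg], ?_, ?_, ?_⟩
  · intro i j
    refine (PiLp.norm_apply_le (P i) j).trans ?_
    rw [hTg]
    refine (Submodule.norm_starProjection_apply_le _ _).trans ?_
    have e1 : WithLp.toLp 2 (T i) = ∑ j, PiLp.single 2 j (T i j) := by
      ext1 k
      simp
    rw [e1]
    refine (norm_sum_le _ _).trans ?_
    have : ∀ k ∈ Finset.univ, ‖PiLp.single (β := fun _ : Fin d => L2 Ω) 2 k (T i k)‖ ≤ (1 + d) * δ := fun k _ => by
      rw [PiLp.norm_single]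
      exact hTn i k
    simpa using Finset.sum_le_sum this
  · intro i φ hφ
    have h1 : WithLp.toLp 2 (g i) - P i ∈ (gradClosure Ω)ᗮ :=
      Submodule.sub_starProjection_mem_orthogonal _
    have h2 := Submodule.inner_left_of_mem_orthogonal (hgrad hφ) h1
    rw [PiLp.inner_apply] at h2
    refine Eq.trans (Finset.sum_congr rfl fun j _ => ?_) h2
    exact (inner_toLp _ (memLp_pderiv_test Ω hφ.contDiff hφ.hasCompactSupport j)).symm
  -- Both the gradient and its projection are weakly curl-free, hence so is the difference.
  · intro i j k φ hφ
    have h1 := gradClosure_curl_free (Submodule.starProjection_apply_mem (gradClosure Ω)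
      (WithLp.toLp 2 (g i))) hφ j k
    have h2 := inner_gradL2_comm (hu i) (hc i) hφ j k
    have e : ∀ a b, ∫ x in Ω, (g i a - P i a : L2 Ω) x * pderiv b φ x =
        inner ℝ (g i a - P i a) (gradL2 Ω hφ.contDiff hφ.hasCompactSupport b) := fun a b =>
      (inner_toLp _ _).symm
    rw [e, e, inner_sub_left, inner_sub_left]
    exact congrArg₂ (· - ·) h2 h1

end Projection

/-! ### From harmonic remainders to a constant skew matrix -/

section KornModRigid

variable {d : ℕ} {Ω : Set (Space d)}

theorem lintegral_enorm_sq_Lp {α : Type*} [MeasurableSpace α] {μ : Measure α} (f : Lp ℝ 2 μ) :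
    ∫⁻ x, ‖f x‖ₑ ^ 2 ∂μ = ‖f‖ₑ ^ 2 := by
  rw [Lp.enorm_def, eLpNorm_eq_lintegral_rpow_enorm_toReal (by norm_num) (by norm_num)]
  rw [← ENNReal.rpow_natCast, ← ENNReal.rpow_mul]
  norm_num

theorem setIntegral_half_add_mul (f g : L2 Ω) {ψ : Space d → ℝ}
    (hψ : MemLp ψ 2 (volume.restrict Ω)) :
    ∫ x in Ω, ((1 / 2 : ℝ) • (f + g) : L2 Ω) x * ψ x =
      (1 / 2) * ((∫ x in Ω, f x * ψ x) + ∫ x in Ω, g x * ψ x) := by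
  rw [← inner_toLp _ hψ, ← inner_toLp _ hψ, ← inner_toLp _ hψ, real_inner_smul_left,
    inner_add_left]

/-- For a row-wise curl-free field with symmetric part `E`, weakly `∂_k H_ij = ∂_k E_ij + ∂_j E_ik -
∂_i E_jk`. The three terms account for the factor `3`. -/
theorem weak_curl_le {H : Fin d → Fin d → L2 Ω}
    (hcurl : ∀ i j k φ, IsTest Ω φ → ∫ x in Ω, H i j x * pderiv k φ x =
        ∫ x in Ω, H i k x * pderiv j φ x) {N : Space d → ℝ≥0∞}
    (hN : ∀ i j, ∀ y, ‖((1 / 2 : ℝ) • (H i j + H j i) : L2 Ω) y‖ₑ ≤ N y) (i j k : Fin d)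
    {φ : Space d → ℝ} (hφ : IsTest Ω φ) : ‖∫ y in Ω, H i j y * pderiv k φ y‖ₑ ≤
      3 * ∫⁻ y in Ω, N y * ∑ l, ‖pderiv l φ y‖ₑ := by
  have hm := fun k => memLp_pderiv_test Ω hφ.contDiff hφ.hasCompactSupport k
  have e : ∫ y in Ω, H i j y * pderiv k φ y =
      (∫ y in Ω, ((1 / 2 : ℝ) • (H i j + H j i) : L2 Ω) y * pderiv k φ y) +
      (∫ y in Ω, ((1 / 2 : ℝ) • (H i k + H k i) : L2 Ω) y * pderiv j φ y) +
      -∫ y in Ω, ((1 / 2 : ℝ) • (H j k + H k j) : L2 Ω) y * pderiv i φ y := by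
    rw [setIntegral_half_add_mul _ _ (hm k), setIntegral_half_add_mul _ _ (hm j),
      setIntegral_half_add_mul _ _ (hm i), hcurl i k j φ hφ, hcurl j k i φ hφ, hcurl k j i φ hφ]
    ring
  have h : ∀ a b c : Fin d, ‖∫ y in Ω, ((1 / 2 : ℝ) • (H a b + H b a) : L2 Ω) y * pderiv c φ y‖ₑ ≤
      ∫⁻ y in Ω, N y * ∑ l, ‖pderiv l φ y‖ₑ := by
    intro a b c
    refine (enorm_integral_le_lintegral_enorm _).trans (lintegral_mono fun y => ?_)
    rw [enorm_mul]
    exact mul_le_mul' (hN a b y)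
      (Finset.single_le_sum (f := fun l => ‖pderiv l φ y‖ₑ) (fun _ _ => zero_le)
        (Finset.mem_univ c))
  rw [e]
  refine (enorm_add_le _ _).trans ?_
  refine (add_le_add (enorm_add_le _ _) le_rfl).trans ?_
  rw [enorm_neg]
  refine (add_le_add (add_le_add (h i j k) (h i k j)) (h j k i)).trans (le_of_eq ?_)
  ring

/-- Curl-freeness exchanges `H_ij` tested with `∂_k ∂_k φ` for `H_ik` tested with `∂_k ∂_j φ`;
summed over `k` this is the divergence condition for the test function `∂_j φ`. -/
theorem weaklyHarmonic_of_curl_div {H : Fin d → Fin d → L2 Ω}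
    (hdiv : ∀ i φ, IsTest Ω φ → ∑ j, ∫ x in Ω, H i j x * pderiv j φ x = 0)
    (hcurl : ∀ i j k φ, IsTest Ω φ → ∫ x in Ω, H i j x * pderiv k φ x =
        ∫ x in Ω, H i k x * pderiv j φ x) (i j : Fin d) : WeaklyHarmonic Ω (H i j) := by
  intro φ hφ
  have hm : ∀ k, Integrable (fun y => H i j y * pderiv k (pderiv k φ) y) (volume.restrict Ω) :=
    fun k => (Lp.memLp (H i j)).integrable_mul (memLp_pderiv_test Ω (hφ.pderiv k).contDiff
      (hφ.pderiv k).hasCompactSupport k)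
  simp only [Finset.mul_sum]
  rw [integral_finsetSum _ fun k _ => hm k, ← hdiv i _ (hφ.pderiv j)]
  refine Finset.sum_congr rfl fun k _ => ?_
  rw [hcurl i j k _ (hφ.pderiv k), pderiv_comm hφ.contDiff]

theorem enorm_sub_const_sq [IsFiniteMeasure (volume.restrict Ω)] (f : L2 Ω) (c : ℝ)
    {g : Space d → ℝ} (k : ℝ) (hg : ∀ᵐ y ∂volume.restrict Ω, f y = k * g y) (b : ℝ)
    (hc : c = k * b) : ‖f - Lp.const 2 (volume.restrict Ω) c‖ₑ ^ 2 =
      ‖k‖ₑ ^ 2 * ∫⁻ y in Ω, ‖g y - b‖ₑ ^ 2 := by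
  rw [← lintegral_enorm_sq_Lp, ← lintegral_const_mul' _ _ (by finiteness)]
  refine lintegral_congr_ae ?_
  filter_upwards [Lp.coeFn_sub f (Lp.const 2 (volume.restrict Ω) c),
    Lp.coeFn_const (p := 2) (volume.restrict Ω) c, hg] with y h3 h4 h5
  rw [h3, Pi.sub_apply, h4, h5, ← mul_pow, ← enorm_mul, hc, Function.const_apply, mul_sub]

theorem lintegral_sum_sum_enorm_sq_le (E : Fin d → Fin d → L2 Ω) {b : ℝ}
    (hE : ∀ i j, ‖E i j‖ ≤ b) :
    ∫⁻ y in Ω, ∑ i, ∑ j, ‖E i j y‖ₑ ^ 2 ≤ d ^ 2 * ENNReal.ofReal b ^ 2 := by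
  have hEm : ∀ i j, Measurable fun y => ‖E i j y‖ₑ := fun i j =>
    (Lp.stronglyMeasurable (E i j)).measurable.enorm
  rw [lintegral_finsetSum _ fun i _ => by fun_prop]
  have h1 : ∀ i, ∫⁻ y in Ω, ∑ j, ‖E i j y‖ₑ ^ 2 ≤ d * ENNReal.ofReal b ^ 2 := by
    intro i
    rw [lintegral_finsetSum _ fun j _ => by fun_prop]
    have h2 : ∀ j ∈ Finset.univ, ∫⁻ y in Ω, ‖E i j y‖ₑ ^ 2 ≤ ENNReal.ofReal b ^ 2 := by
      intro j _
      rw [lintegral_enorm_sq_Lp, ← ofReal_norm]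
      gcongr
      exact hE i j
    simpa using Finset.sum_le_sum h2
  refine (Finset.sum_le_sum fun i _ => h1 i).trans (le_of_eq ?_)
  simp
  ring

/-- A curl- and divergence-free matrix field is close to a constant as soon as its symmetric part
is small. -/
theorem exists_const_of_curl_div (hΩ : IsLipschitzDomain Ω) [IsFiniteMeasure (volume.restrict Ω)] :
    ∃ C : ℝ, 0 ≤ C ∧ ∀ (H : Fin d → Fin d → L2 Ω),
      (∀ i φ, IsTest Ω φ → ∑ j, ∫ x in Ω, H i j x * pderiv j φ x = 0) →
      (∀ i j k φ, IsTest Ω φ → ∫ x in Ω, H i j x * pderiv k φ x =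
        ∫ x in Ω, H i k x * pderiv j φ x) →
      ∀ b : ℝ, 0 ≤ b → (∀ i j, ‖(1 / 2 : ℝ) • (H i j + H j i)‖ ≤ b) →
      ∃ a : Fin d → Fin d → ℝ, ∀ i j, ‖H i j - Lp.const 2 (volume.restrict Ω) (a i j)‖ ≤ C * b := by
  obtain ⟨x₀, hx₀⟩ := hΩ.isConnected.nonempty
  obtain ⟨C1, hC1, hP⟩ := GradBound.lintegral_le hΩ hx₀
  obtain ⟨C2, hC2, hG⟩ := exists_gradBound_localMean d
  refine ⟨√(C1 * C2 * (‖(kernMass d)⁻¹‖ₑ ^ 2 * d ^ 2)).toReal, by positivity,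
    fun H hdiv hcurl b hb0 hb => ⟨fun i j => (kernMass d)⁻¹ * localMean Ω (H i j) x₀,
    fun i j => ?_⟩⟩
  -- The pointwise Euclidean norm of the symmetric part serves as the common majorant `N` in the
  -- gradient bound; the approximating constant is the normalised local mean at the base point `x₀`.
  let M : Space d → ℝ≥0∞ := fun y =>
    (∑ i, ∑ j, ‖((1 / 2 : ℝ) • (H i j + H j i) : L2 Ω) y‖ₑ ^ 2) ^ (1 / 2 : ℝ)
  have hEm : ∀ i j, Measurable fun y => ‖((1 / 2 : ℝ) • (H i j + H j i) : L2 Ω) y‖ₑ := fun i j =>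
    (Lp.stronglyMeasurable _).measurable.enorm
  have hMm : Measurable M := by fun_prop
  have hM2 : ∀ y, M y ^ 2 = ∑ i, ∑ j, ‖((1 / 2 : ℝ) • (H i j + H j i) : L2 Ω) y‖ₑ ^ 2 := by
    intro y
    rw [← ENNReal.rpow_natCast, ← ENNReal.rpow_mul]
    norm_num
  have hEM : ∀ i j y, ‖((1 / 2 : ℝ) • (H i j + H j i) : L2 Ω) y‖ₑ ≤ M y := by
    intro i j y
    rw [← ENNReal.pow_le_pow_left_iff two_ne_zero, hM2]
    exact (Finset.single_le_sum
      (f := fun j => ‖((1 / 2 : ℝ) • (H i j + H j i) : L2 Ω) y‖ₑ ^ 2) (fun _ _ => zero_le)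
      (Finset.mem_univ j)).trans (Finset.single_le_sum
        (f := fun i => ∑ j, ‖((1 / 2 : ℝ) • (H i j + H j i) : L2 Ω) y‖ₑ ^ 2)
        (fun _ _ => zero_le) (Finset.mem_univ i))
  have hMint : ∫⁻ y in Ω, M y ^ 2 ≤ d ^ 2 * ENNReal.ofReal b ^ 2 := by
    simp only [hM2]
    exact lintegral_sum_sum_enorm_sq_le (fun i j => (1 / 2 : ℝ) • (H i j + H j i)) hb
  have hfin : IntegrableOn (H i j) Ω := (Lp.memLp (H i j)).integrable (by norm_num)
  have hharm := weaklyHarmonic_of_curl_div hdiv hcurl i j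
  have hgb := hG Ω (H i j) M hΩ.isOpen hfin hharm hMm fun k φ hφ =>
    weak_curl_le hcurl hEM i j k hφ
  have h1 := hP _ _ hgb
  have h2 := enorm_sub_const_sq (H i j) _ (kernMass d)⁻¹
    (g := localMean Ω (H i j)) (by
      filter_upwards [hharm.localMean_ae_eq hΩ.isOpen hfin] with y h5
      rw [h5, inv_mul_cancel_left₀ (kernMass_pos d).ne']) (localMean Ω (H i j) x₀) rfl
  generalize H i j - Lp.const 2 (volume.restrict Ω)
    ((kernMass d)⁻¹ * localMean Ω (H i j) x₀) = f at h2 ⊢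
  have h3 : ‖f‖ₑ ^ 2 ≤ C1 * C2 * (‖(kernMass d)⁻¹‖ₑ ^ 2 * d ^ 2) * ENNReal.ofReal b ^ 2 := by
    rw [h2]
    rw [lintegral_const_mul _ (by fun_prop)] at h1
    calc _ ≤ ‖(kernMass d)⁻¹‖ₑ ^ 2 * (C1 * (C2 * ∫⁻ y in Ω, M y ^ 2)) := by gcongr
      _ ≤ ‖(kernMass d)⁻¹‖ₑ ^ 2 * (C1 * (C2 * (d ^ 2 * ENNReal.ofReal b ^ 2))) := by gcongr
      _ = _ := by ring
  have h4 := ENNReal.toReal_mono (by finiteness) h3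
  rw [ENNReal.toReal_mul, ENNReal.toReal_pow, ENNReal.toReal_pow, toReal_enorm,
    ENNReal.toReal_ofReal hb0] at h4
  refine abs_le_of_sq_le_sq' ?_ (by positivity) |>.2
  rw [mul_pow, Real.sq_sqrt ENNReal.toReal_nonneg]
  exact h4

/-- Replaces the approximating constant by its skew part. The identity splits `g` into half of `g -
g'` and half of `g + g'`; only the skew half needs the approximation, the symmetric half is already
small. -/
theorem norm_sub_half_sub_le {V : Type*} [NormedAddCommGroup V] [NormedSpace ℝ V]
    {g g' n n' h h' a a' : V} {δ c C : ℝ} (hg : g = n + h) (hg' : g' = n' + h')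
    (hδ : ‖g + g'‖ ≤ δ) (hn : ‖n‖ ≤ c) (hn' : ‖n'‖ ≤ c) (ha : ‖h - a‖ ≤ C) (ha' : ‖h' - a'‖ ≤ C) :
    ‖g - (1 / 2 : ℝ) • (a - a')‖ ≤ 2 * c + C + δ := by
  have e : g - (1 / 2 : ℝ) • (a - a') = (1 / 2 : ℝ) • (n - n') + (1 / 2 : ℝ) • (h - a) -
      (1 / 2 : ℝ) • (h' - a') + (1 / 2 : ℝ) • (g + g') := by
    rw [hg, hg']
    module
  rw [e]
  have h1 := norm_add_le ((1 / 2 : ℝ) • (n - n') + (1 / 2 : ℝ) • (h - a) -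
      (1 / 2 : ℝ) • (h' - a')) ((1 / 2 : ℝ) • (g + g'))
  have h2 := norm_sub_le ((1 / 2 : ℝ) • (n - n') + (1 / 2 : ℝ) • (h - a))
      ((1 / 2 : ℝ) • (h' - a'))
  have h3 := norm_add_le ((1 / 2 : ℝ) • (n - n')) ((1 / 2 : ℝ) • (h - a))
  have h4 := norm_sub_le n n'
  simp only [norm_smul, one_div, norm_inv, RCLike.norm_ofNat] at h1 h2 h3 ⊢
  have h5 := norm_nonneg n
  have h6 := norm_nonneg (g + g')
  linarith

/-- The symmetric part of the harmonic remainder is that of the gradient minus that of the projected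
part, both small. -/
theorem norm_half_smul_add_le {V : Type*} [NormedAddCommGroup V] [NormedSpace ℝ V]
    {g g' n n' h h' : V} {δ c : ℝ} (hg : g = n + h) (hg' : g' = n' + h')
    (hδ : ‖g + g'‖ ≤ δ) (hn : ‖n‖ ≤ c) (hn' : ‖n'‖ ≤ c) :
    ‖(1 / 2 : ℝ) • (h + h')‖ ≤ δ + c := by
  have e : (1 / 2 : ℝ) • (h + h') = (1 / 2 : ℝ) • (g + g') - (1 / 2 : ℝ) • (n + n') := by
    rw [hg, hg']
    module
  rw [e]
  have h1 := norm_sub_le ((1 / 2 : ℝ) • (g + g')) ((1 / 2 : ℝ) • (n + n'))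
  have h2 := norm_add_le n n'
  simp only [norm_smul, one_div, norm_inv, RCLike.norm_ofNat] at h1 ⊢
  have h6 := norm_nonneg (g + g')
  linarith

/-- Korn's inequality modulo rigid motions for the restrictions of smooth vector fields to a
bounded Lipschitz domain. -/
theorem korn_mod_rigid (hΩ : IsLipschitzDomain Ω) [IsFiniteMeasure (volume.restrict Ω)] :
    ∃ C : ℝ, 0 ≤ C ∧ ∀ (u : Fin d → Space d → ℝ)
    (hu : ∀ i, ContDiff ℝ ∞ (u i)) (hc : ∀ i, HasCompactSupport (u i)) (δ : ℝ), 0 ≤ δ →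
    (∀ i j, ‖gradL2 Ω (hu i) (hc i) j + gradL2 Ω (hu j) (hc j) i‖ ≤ δ) →
    ∃ A : Fin d → Fin d → ℝ, (∀ i j, A i j = -A j i) ∧
      ∀ i j, ‖gradL2 Ω (hu i) (hc i) j - Lp.const 2 (volume.restrict Ω) (A i j)‖ ≤ C * δ := by
  obtain ⟨C, hC, hconst⟩ := exists_const_of_curl_div hΩ
  refine ⟨2 * (d * (1 + d)) + C * (1 + d * (1 + d)) + 1, by positivity,
    fun u hu hc δ hδ0 hδ => ?_⟩
  obtain ⟨N, H, hgNH, hN, hdiv, hcurl⟩ := exists_harmonic_decomposition Ω hu hc hδ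
  obtain ⟨a, ha⟩ := hconst H hdiv hcurl (δ + d * ((1 + d) * δ)) (by positivity) fun i j =>
    norm_half_smul_add_le (hgNH i j) (hgNH j i) (hδ i j) (hN i j) (hN j i)
  refine ⟨fun i j => (1 / 2) * (a i j - a j i), fun i j => by ring, fun i j => ?_⟩
  have e : Lp.const 2 (volume.restrict Ω) ((1 / 2) * (a i j - a j i)) =
      (1 / 2 : ℝ) • (Lp.const 2 (volume.restrict Ω) (a i j) -
        Lp.const 2 (volume.restrict Ω) (a j i)) := by
    rw [← map_sub]
    exact (Lp.constL 2 (volume.restrict Ω) ℝ).map_smul (1 / 2 : ℝ) (a i j - a j i)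
  rw [e]
  refine (norm_sub_half_sub_le (hgNH i j) (hgNH j i) (hδ i j) (hN i j) (hN j i) (ha i j)
    (ha j i)).trans (le_of_eq ?_)
  ring

end KornModRigid

/-! ### Surface measure and tubes over Lipschitz graphs -/

section Tube

theorem euclideanHausdorffMeasure_image_le {X Y : Type*} [EMetricSpace X] [EMetricSpace Y]
    [MeasurableSpace X] [BorelSpace X] [MeasurableSpace Y] [BorelSpace Y] {K : ℝ≥0} {f : X → Y}
    (hf : LipschitzWith K f) (n : ℕ) (s : Set X) :
    Measure.euclideanHausdorffMeasure n (f '' s) ≤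
      (K : ℝ≥0∞) ^ n * Measure.euclideanHausdorffMeasure n s := by
  simp only [Measure.euclideanHausdorffMeasure_def, Measure.smul_apply]
  rw [ENNReal.smul_def, ENNReal.smul_def, smul_eq_mul, smul_eq_mul, mul_left_comm]
  gcongr
  simpa using hf.hausdorffMeasure_image_le (d := n) (by positivity) s

variable {d : ℕ} {v : Space d} {h : Space d → ℝ} {K : ℝ≥0}

/-- The vertical projection onto the graph `{h = 0}`. -/
def foot (h : Space d → ℝ) (v y : Space d) : Space d := y - h y • v

theorem measurable_foot (hh : Measurable h) : Measurable (foot h v) := by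
  unfold foot
  fun_prop

theorem foot_add_smul (hhv : ∀ y t, h (y + t • v) = h y + t) (y : Space d) (t : ℝ) :
    foot h v (y + t • v) = foot h v y := by
  rw [foot, foot, hhv]
  module

theorem dist_foot_le (hv : ‖v‖ = 1) (y : Space d) : dist (foot h v y) y = |h y| := by
  rw [foot, dist_eq_norm, sub_sub_cancel_left, norm_neg, norm_smul, hv, mul_one, Real.norm_eq_abs]

/-- The part below height `a` of the vertical tube over `A ⊆ {h = 0}`. -/
def tube (h : Space d → ℝ) (v : Space d) (A : Set (Space d)) (a : ℝ) : Set (Space d) :=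
  {y | foot h v y ∈ A ∧ h y ∈ Ioo 0 a}

theorem measurableSet_tube (hh : Measurable h) {A : Set (Space d)} (hA : MeasurableSet A) (a : ℝ) :
    MeasurableSet (tube h v A a) :=
  ((measurable_foot hh) hA).inter (hh measurableSet_Ioo)

theorem measurePreserving_smul_add (hv : ‖v‖ = 1) :
    MeasurePreserving (fun q : ℝ × (ℝ ∙ v)ᗮ => q.1 • v + (q.2 : Space d))
      ((volume : Measure ℝ).prod volume) volume := by
  have h1 := (LinearIsometryEquiv.toSpanUnitSingleton (𝕜 := ℝ) v hv).measurePreserving.prod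
    (MeasurePreserving.id (volume : Measure (ℝ ∙ v)ᗮ))
  have h2 := ((ℝ ∙ v).measurePreserving_measurableEquivProd (0 : Space d)).symm
  rw [InnerProductSpace.euclideanHausdorffMeasure_eq_volume] at h2
  have e : (fun q : ℝ × (ℝ ∙ v)ᗮ => q.1 • v + (q.2 : Space d)) =
      ((ℝ ∙ v).measurableEquivProd (0 : Space d)).symm ∘
        Prod.map (LinearIsometryEquiv.toSpanUnitSingleton (𝕜 := ℝ) v hv) id := by
    funext q
    simp
  rw [e]
  exact h2.comp h1

/-- The foot is constant along `v` while `h` grows with unit speed, so every nonempty vertical slice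
is an interval of length `a`; Fubini over the hyperplane orthogonal to `v`. -/
theorem volume_tube (hv : ‖v‖ = 1) (hh : Measurable h) (hhv : ∀ y t, h (y + t • v) = h y + t)
    {A : Set (Space d)} (hA : MeasurableSet A) (a : ℝ) :
    volume (tube h v A a) =
      ENNReal.ofReal a * volume {w : (ℝ ∙ v)ᗮ | foot h v (w : Space d) ∈ A} := by
  have hT := measurableSet_tube (v := v) hh hA a
  have hB : MeasurableSet {w : (ℝ ∙ v)ᗮ | foot h v (w : Space d) ∈ A} :=
    (measurable_foot hh).comp measurable_subtype_coe hA
  rw [← (measurePreserving_smul_add hv).measure_preimage hT.nullMeasurableSet,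
    Measure.prod_apply_symm ((measurePreserving_smul_add hv).measurable hT)]
  have h1 : ∀ w : (ℝ ∙ v)ᗮ, volume ((fun x => (x, w)) ⁻¹'
      ((fun q : ℝ × (ℝ ∙ v)ᗮ => q.1 • v + (q.2 : Space d)) ⁻¹' tube h v A a)) =
      {w : (ℝ ∙ v)ᗮ | foot h v (w : Space d) ∈ A}.indicator (fun _ => ENNReal.ofReal a) w := by
    intro w
    have e : ((fun x => (x, w)) ⁻¹'
      ((fun q : ℝ × (ℝ ∙ v)ᗮ => q.1 • v + (q.2 : Space d)) ⁻¹' tube h v A a)) =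
      {t : ℝ | foot h v (w : Space d) ∈ A ∧ t ∈ Ioo (-h w) (a - h w)} := by
      ext t
      simp only [tube, mem_preimage, mem_ofPred_eq, mem_Ioo]
      rw [add_comm (t • v), foot_add_smul hhv, hhv]
      refine and_congr_right fun _ => ⟨fun h => ⟨?_, ?_⟩, fun h => ⟨?_, ?_⟩⟩ <;> linarith [h.1, h.2]
    rw [e]
    by_cases hw : foot h v (w : Space d) ∈ A
    · simp only [hw, true_and, ofPred_mem_eq, Real.volume_Ioo, indicator, mem_ofPred_eq, if_true]
      congr 1
      ring
    · simp [hw]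
  simp only [h1]
  rw [lintegral_indicator hB, setLIntegral_const]

theorem finrank_orthogonal_unit (hv : ‖v‖ = 1) : Module.finrank ℝ (ℝ ∙ v)ᗮ = d - 1 := by
  have h1 := (ℝ ∙ v).finrank_add_finrank_orthogonal
  rw [finrank_span_singleton (norm_ne_zero_iff.1 (by rw [hv]; exact one_ne_zero)),
    finrank_euclideanSpace_fin] at h1
  omega

/-- The base of the tube in the hyperplane is contained in the orthogonal projection of `A`, and
projections do not increase Hausdorff measure. -/
theorem volume_tube_le (hv : ‖v‖ = 1) (hh : Measurable h)
    (hhv : ∀ y t, h (y + t • v) = h y + t) {A : Set (Space d)} (hA : MeasurableSet A) (a : ℝ) :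
    volume (tube h v A a) ≤ ENNReal.ofReal a * Measure.euclideanHausdorffMeasure (d - 1) A := by
  rw [volume_tube hv hh hhv hA]
  gcongr
  have hP : LipschitzWith 1 ((ℝ ∙ v)ᗮ.orthogonalProjectionOnto : Space d → (ℝ ∙ v)ᗮ) :=
    ContinuousLinearMap.lipschitzWith_of_opNorm_le (Submodule.orthogonalProjectionOnto_norm_le _)
  have h1 := euclideanHausdorffMeasure_image_le hP (d - 1) A
  rw [ENNReal.coe_one, one_pow, one_mul] at h1
  refine le_trans ?_ h1
  have h2 := InnerProductSpace.euclideanHausdorffMeasure_eq_volume (V := (ℝ ∙ v)ᗮ)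
  rw [finrank_orthogonal_unit hv] at h2
  rw [← h2]
  refine measure_mono fun w hw => ⟨_, hw, ?_⟩
  have hv0 : (ℝ ∙ v)ᗮ.orthogonalProjectionOnto v = 0 := by
    rw [Submodule.orthogonalProjectionOnto_eq_zero_iff, Submodule.orthogonal_orthogonal]
    exact Submodule.mem_span_singleton_self v
  rw [foot, map_sub, map_smul, hv0, smul_zero, sub_zero,
    Submodule.orthogonalProjectionOnto_mem_subspace_eq_self]

/-- Conversely, `A` lies in the image of that base under the Lipschitz graph map `w ↦ foot h v w`,
so a null base forces a null piece of the graph. -/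
theorem euclideanHausdorffMeasure_eq_zero_of_tube (hv : ‖v‖ = 1) (hK : LipschitzWith K h)
    (hhv : ∀ y t, h (y + t • v) = h y + t) {A : Set (Space d)} (hA : MeasurableSet A)
    (hA0 : ∀ x ∈ A, h x = 0) {a : ℝ} (ha : 0 < a) (h0 : volume (tube h v A a) = 0) :
    Measure.euclideanHausdorffMeasure (d - 1) A = 0 := by
  rw [volume_tube hv hK.continuous.measurable hhv hA, mul_eq_zero] at h0
  have h1 := h0.resolve_left (ENNReal.ofReal_pos.2 ha).ne'
  have h2 := InnerProductSpace.euclideanHausdorffMeasure_eq_volume (V := (ℝ ∙ v)ᗮ)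
  rw [finrank_orthogonal_unit hv] at h2
  rw [← h2] at h1
  have hG : LipschitzWith (1 + K) fun w : (ℝ ∙ v)ᗮ => foot h v (w : Space d) := by
    have e1 : LipschitzWith 1 fun w : (ℝ ∙ v)ᗮ => (w : Space d) := LipschitzWith.subtype_val _
    have e2 : LipschitzWith K fun w : (ℝ ∙ v)ᗮ => h w • v := by
      refine LipschitzWith.of_dist_le_mul fun w w' => ?_
      rw [dist_eq_norm, ← sub_smul, norm_smul, hv, mul_one, ← dist_eq_norm]
      exact hK.dist_le_mul _ _
    exact e1.sub e2
  have h3 := euclideanHausdorffMeasure_image_le hG (d - 1) {w | foot h v (w : Space d) ∈ A}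
  rw [h1, mul_zero] at h3
  refine measure_mono_null (fun x hx => ?_) (nonpos_iff_eq_zero.1 h3)
  have hx' : x - inner ℝ v x • v ∈ (ℝ ∙ v)ᗮ := by
    rw [Submodule.mem_orthogonal_singleton_iff_inner_right, inner_sub_right, inner_smul_right,
      real_inner_self_eq_norm_sq, hv]
    ring
  have e : foot h v (x - inner ℝ v x • v) = x := by
    rw [sub_eq_add_neg, ← neg_smul, foot_add_smul hhv, foot, hA0 x hx, zero_smul, sub_zero]
  exact ⟨⟨_, hx'⟩, by simpa only [mem_ofPred_eq, e] using hx, e⟩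

/-- A proper subspace of codimension at least two has no surface measure. -/
theorem euclideanHausdorffMeasure_submodule (V : Submodule ℝ (Space d))
    (hV : Module.finrank ℝ V < d - 1) (x : Space d) :
    Measure.euclideanHausdorffMeasure (d - 1) ((fun y => x + y) '' (V : Set (Space d))) = 0 := by
  rw [(isometry_add_left x).euclideanHausdorffMeasure_image, Measure.euclideanHausdorffMeasure_def,
    Measure.smul_apply]
  have h1 : dimH (V : Set (Space d)) < ((d - 1 : ℕ) : ℝ≥0) := by
    have e := isometry_subtype_coe (s := (V : Set (Space d))).dimH_image univ
    rw [image_univ, Subtype.range_coe] at e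
    rw [e, Real.dimH_univ_eq_finrank V]
    exact_mod_cast hV
  have h2 := hausdorffMeasure_of_dimH_lt h1
  rw [NNReal.coe_natCast] at h2
  rw [h2, smul_zero]

end Tube

/-! ### Poincaré inequalities on convex sets and on boundary tubes -/

section Poincare

variable {d : ℕ}

theorem lintegral_comp_smul_add {c : ℝ} (hc : 0 < c) (z : Space d) {G : Space d → ℝ≥0∞}
    (hG : Measurable G) :
    ∫⁻ y, G (c • y + z) = ENNReal.ofReal (c⁻¹ ^ d) * ∫⁻ y, G y := by
  have h1 := Measure.map_addHaar_smul (volume : Measure (Space d)) hc.ne'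
  have h2 : ∫⁻ y, G (c • y + z) = ∫⁻ y, G (y + z) ∂(volume.map fun y : Space d => c • y) := by
    rw [lintegral_map (by fun_prop) (by fun_prop)]
  rw [h2, h1, lintegral_smul_measure, lintegral_add_right_eq_self, smul_eq_mul,
    finrank_euclideanSpace_fin, abs_of_pos (by positivity), inv_pow]

theorem setLIntegral_comp_add_le {T B : Set (Space d)} (hT : MeasurableSet T)
    (hB : MeasurableSet B) {z : Space d} (hTB : ∀ y ∈ T, y + z ∈ B) (G : Space d → ℝ≥0∞) :
    ∫⁻ y in T, G (y + z) ≤ ∫⁻ y in B, G y := by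
  rw [← lintegral_indicator hT, ← lintegral_indicator hB,
    ← lintegral_add_right_eq_self (B.indicator G) z]
  refine lintegral_mono fun y => ?_
  by_cases hy : y ∈ T
  · rw [indicator_of_mem hy, indicator_of_mem (hTB y hy)]
  · rw [indicator_of_notMem hy]
    exact zero_le

variable {f : Space d → ℝ}

theorem measurable_enorm_fderiv (hf : ContDiff ℝ 1 f) : Measurable fun y => ‖fderiv ℝ f y‖ₑ :=
  (hf.continuous_fderiv one_ne_zero).enorm.measurable

/-- The path stops at the midpoint so that the coefficient of `y'` stays at least `1/2`. This makes
the change of variables in `y'` harmless, with Jacobian at most `2 ^ d`. -/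
theorem enorm_midpoint_sub_sq_le (hf : ContDiff ℝ 1 f) {B : Set (Space d)} (hB : Convex ℝ B)
    {D : ℝ} (hD : 0 < D) {y y' : Space d} (hy : y ∈ B) (hy' : y' ∈ B) (hyy : ‖y - y'‖ ≤ D) :
    ‖f ((1 / 2 : ℝ) • (y + y')) - f y'‖ₑ ^ 2 ≤ ENNReal.ofReal (D / 2) *
      ∫⁻ t in Ioc 0 (D / 2), B.indicator (fun y => ‖fderiv ℝ f y‖ₑ) ((1 - t / D) • y' +
        (t / D) • y) ^ 2 := by
  have hF := measurable_enorm_fderiv hf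
  have h1 := enorm_sub_le_lintegral_fderiv (f := f) isOpen_univ hf.contDiffOn (x := y')
    (v := D⁻¹ • (y - y')) (a := D / 2) (by
      rw [norm_smul, norm_inv, Real.norm_of_nonneg hD.le, inv_mul_le_iff₀ hD, mul_one]
      exact hyy) (by positivity) fun _ _ => mem_univ _
  have e1 : y' + (D / 2) • D⁻¹ • (y - y') = (1 / 2 : ℝ) • (y + y') := by
    rw [smul_smul, show D / 2 * D⁻¹ = 1 / 2 by field_simp]
    module
  have e2 : ∀ t : ℝ, y' + t • D⁻¹ • (y - y') = (1 - t / D) • y' + (t / D) • y := by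
    intro t
    rw [smul_smul, ← div_eq_mul_inv]
    module
  simp only [e1, e2] at h1
  have hseg : ∀ t ∈ Ioc 0 (D / 2), (1 - t / D) • y' + (t / D) • y ∈ B := by
    intro t ht
    have : t / D ≤ 1 := by
      rw [div_le_one hD]
      linarith [ht.2]
    exact hB hy' hy (by linarith) (div_nonneg ht.1.le hD.le) (by ring)
  have h2 := lintegral_sq_le (μ := volume.restrict (Ioc 0 (D / 2)))
    (f := fun t => ‖fderiv ℝ f ((1 - t / D) • y' + (t / D) • y)‖ₑ)
    (hF.comp (by fun_prop)).aemeasurable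
  rw [Measure.restrict_apply_univ, Real.volume_Ioc, sub_zero] at h2
  refine (pow_le_pow_left' h1 2).trans (h2.trans (le_of_eq ?_))
  congr 1
  refine setLIntegral_congr_fun measurableSet_Ioc fun t ht => ?_
  simp only [indicator_of_mem (hseg t ht)]

theorem lintegral_midpoint_sub_le (hf : ContDiff ℝ 1 f) {B : Set (Space d)} (hB : Convex ℝ B)
    (hBm : MeasurableSet B) {D : ℝ} (hD : 0 < D) (hBD : ∀ y ∈ B, ∀ y' ∈ B, ‖y - y'‖ ≤ D) :
    ∫⁻ y in B, ∫⁻ y' in B, ‖f ((1 / 2 : ℝ) • (y + y')) - f y'‖ₑ ^ 2 ≤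
      ENNReal.ofReal (D / 2) ^ 2 * 2 ^ d * volume B * ∫⁻ y in B, ‖fderiv ℝ f y‖ₑ ^ 2 := by
  have hF := measurable_enorm_fderiv hf
  set F := B.indicator fun y => ‖fderiv ℝ f y‖ₑ with hFdef
  have hFm : Measurable F := hF.indicator hBm
  have hF2 : ∫⁻ y, F y ^ 2 = ∫⁻ y in B, ‖fderiv ℝ f y‖ₑ ^ 2 := by
    rw [← lintegral_indicator hBm]
    refine lintegral_congr fun y => ?_
    by_cases hy : y ∈ B <;> simp [hFdef, hy]
  have hin : ∀ y ∈ B, ∫⁻ y' in B, ‖f ((1 / 2 : ℝ) • (y + y')) - f y'‖ₑ ^ 2 ≤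
      ENNReal.ofReal (D / 2) ^ 2 * 2 ^ d * ∫⁻ y in B, ‖fderiv ℝ f y‖ₑ ^ 2 := by
    intro y hy
    calc _ ≤ ∫⁻ y' in B, ENNReal.ofReal (D / 2) *
          ∫⁻ t in Ioc 0 (D / 2), F ((1 - t / D) • y' + (t / D) • y) ^ 2 :=
          setLIntegral_mono' hBm fun y' hy' =>
            enorm_midpoint_sub_sq_le hf hB hD hy hy' (hBD y hy y' hy')
      _ ≤ ∫⁻ y', ENNReal.ofReal (D / 2) *
          ∫⁻ t in Ioc 0 (D / 2), F ((1 - t / D) • y' + (t / D) • y) ^ 2 :=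
          setLIntegral_le_lintegral _ _
      _ = ENNReal.ofReal (D / 2) * ∫⁻ t in Ioc 0 (D / 2), ∫⁻ y',
          F ((1 - t / D) • y' + (t / D) • y) ^ 2 := by
          rw [lintegral_const_mul' _ _ ENNReal.ofReal_ne_top, lintegral_lintegral_swap]
          exact (Measurable.pow_const (hFm.comp (by fun_prop)) 2).aemeasurable
      _ ≤ ENNReal.ofReal (D / 2) * ∫⁻ t in Ioc 0 (D / 2), 2 ^ d *
          ∫⁻ y in B, ‖fderiv ℝ f y‖ₑ ^ 2 := by
          refine mul_le_mul' le_rfl (setLIntegral_mono' measurableSet_Ioc fun t ht => ?_)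
          have hc : 1 / 2 ≤ 1 - t / D := by
            have : t / D ≤ 1 / 2 := by
              rw [div_le_iff₀ hD]
              linarith [ht.2]
            linarith
          rw [lintegral_comp_smul_add (by linarith) _ (hFm.pow_const 2), hF2]
          gcongr
          rw [show (2 : ℝ≥0∞) ^ d = ENNReal.ofReal (2 ^ d) by
            rw [ENNReal.ofReal_pow (by norm_num)]; norm_num]
          gcongr
          rw [inv_le_comm₀ (by linarith) (by norm_num)]
          linarith
      _ = _ := by
          rw [setLIntegral_const, Real.volume_Ioc, sub_zero]
          ring
  refine (setLIntegral_mono' hBm hin).trans (le_of_eq ?_)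
  rw [setLIntegral_const]
  ring

/-- Passing through the midpoint of `y` and `y'` gives two halves that are equal by symmetry. -/
theorem lintegral_lintegral_sub_le (hf : ContDiff ℝ 1 f) {B : Set (Space d)} (hB : Convex ℝ B)
    (hBm : MeasurableSet B) {D : ℝ} (hD : 0 < D) (hBD : ∀ y ∈ B, ∀ y' ∈ B, ‖y - y'‖ ≤ D) :
    ∫⁻ y in B, ∫⁻ y' in B, ‖f y - f y'‖ₑ ^ 2 ≤
      4 * (ENNReal.ofReal (D / 2) ^ 2 * 2 ^ d * volume B * ∫⁻ y in B, ‖fderiv ℝ f y‖ₑ ^ 2) := by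
  have hfm : Measurable f := hf.continuous.measurable
  have h1 := lintegral_midpoint_sub_le hf hB hBm hD hBD
  have h2 : ∫⁻ y in B, ∫⁻ y' in B, ‖f ((1 / 2 : ℝ) • (y + y')) - f y‖ₑ ^ 2 =
      ∫⁻ y in B, ∫⁻ y' in B, ‖f ((1 / 2 : ℝ) • (y + y')) - f y'‖ₑ ^ 2 := by
    rw [lintegral_lintegral_swap]
    · simp only [add_comm]
    · exact Measurable.aemeasurable (by fun_prop)
  calc _ ≤ ∫⁻ y in B, ∫⁻ y' in B, 2 * (‖f ((1 / 2 : ℝ) • (y + y')) - f y‖ₑ ^ 2 +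
          ‖f ((1 / 2 : ℝ) • (y + y')) - f y'‖ₑ ^ 2) := by
        refine lintegral_mono fun y => lintegral_mono fun y' => ?_
        refine (enorm_sub_sq_le (b := f ((1 / 2 : ℝ) • (y + y')))).trans (le_of_eq ?_)
        rw [enorm_sub_rev (f y)]
    _ = 2 * ((∫⁻ y in B, ∫⁻ y' in B, ‖f ((1 / 2 : ℝ) • (y + y')) - f y‖ₑ ^ 2) +
          ∫⁻ y in B, ∫⁻ y' in B, ‖f ((1 / 2 : ℝ) • (y + y')) - f y'‖ₑ ^ 2) := by
        simp_rw [lintegral_const_mul' 2 _ ENNReal.ofNat_ne_top]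
        rw [← lintegral_add_left (by fun_prop)]
        congr 1
        refine lintegral_congr fun y => ?_
        rw [lintegral_add_left (by fun_prop)]
    _ ≤ _ := by
        rw [h2]
        refine (mul_le_mul' le_rfl (add_le_add h1 h1)).trans (le_of_eq ?_)
        ring

variable {v : Space d} {h : Space d → ℝ}

/-- The vertical descent from `y + a • v` to the foot has length `a + h y ≤ 2 a`; after
Cauchy–Schwarz, Tonelli and translation invariance bound the gradient integral at each time by the
one over `Ω`. -/
theorem lintegral_foot_sub_le (hf : ContDiff ℝ 1 f) (hv : ‖v‖ = 1) {Ω T : Set (Space d)}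
    (hΩ : MeasurableSet Ω) (hT : MeasurableSet T) {a : ℝ} (hTa : ∀ y ∈ T, h y ∈ Ioo 0 a)
    (hTΩ : ∀ y ∈ T, ∀ t ∈ Ioc (-h y) a, y + t • v ∈ Ω) :
    ∫⁻ y in T, ‖f (foot h v y) - f (y + a • v)‖ₑ ^ 2 ≤
      ENNReal.ofReal (2 * a) ^ 2 * ∫⁻ y in Ω, ‖fderiv ℝ f y‖ₑ ^ 2 := by
  have hF := measurable_enorm_fderiv hf
  set F := Ω.indicator fun y => ‖fderiv ℝ f y‖ₑ with hFdef
  have hFm : Measurable F := hF.indicator hΩ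
  have hF2 : ∫⁻ y, F y ^ 2 = ∫⁻ y in Ω, ‖fderiv ℝ f y‖ₑ ^ 2 := by
    rw [← lintegral_indicator hΩ]
    refine lintegral_congr fun y => ?_
    by_cases hy : y ∈ Ω <;> simp [hFdef, hy]
  have hpt : ∀ y ∈ T, ‖f (foot h v y) - f (y + a • v)‖ₑ ^ 2 ≤ ENNReal.ofReal (2 * a) *
      ∫⁻ t in Ioc 0 (2 * a), F (y + (a - t) • v) ^ 2 := by
    intro y hy
    obtain ⟨hy0, hya⟩ := hTa y hy
    have h1 := enorm_sub_le_lintegral_fderiv (f := f) isOpen_univ hf.contDiffOn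
      (x := y + a • v) (v := -v) (a := a + h y) (by rw [norm_neg, hv]) (by linarith)
      fun _ _ => mem_univ _
    have e1 : y + a • v + (a + h y) • -v = foot h v y := by
      rw [foot]
      module
    have e2 : ∀ t : ℝ, y + a • v + t • -v = y + (a - t) • v := by
      intro t
      module
    simp only [e1, e2] at h1
    -- The end of the path is the foot, which need not belong to `Ω`; it is dropped as a null set.
    rw [← restrict_Ioo_eq_restrict_Ioc] at h1
    have h2 : ∫⁻ t in Ioo 0 (a + h y), ‖fderiv ℝ f (y + (a - t) • v)‖ₑ ≤
        ∫⁻ t in Ioc 0 (2 * a), F (y + (a - t) • v) := by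
      calc _ = ∫⁻ t in Ioo 0 (a + h y), F (y + (a - t) • v) := by
            refine setLIntegral_congr_fun measurableSet_Ioo fun t ht => ?_
            have hmem : y + (a - t) • v ∈ Ω :=
              hTΩ y hy (a - t) ⟨by linarith [ht.2], by linarith [ht.1]⟩
            simp only [hFdef, indicator_of_mem hmem]
        _ ≤ _ := lintegral_mono_set
          (Ioo_subset_Ioc_self.trans (Ioc_subset_Ioc_right (by linarith)))
    have h3 := lintegral_sq_le (μ := volume.restrict (Ioc 0 (2 * a)))
      (f := fun t => F (y + (a - t) • v)) (hFm.comp (by fun_prop)).aemeasurable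
    rw [Measure.restrict_apply_univ, Real.volume_Ioc, sub_zero] at h3
    exact (pow_le_pow_left' (h1.trans h2) 2).trans h3
  calc _ ≤ ∫⁻ y in T, ENNReal.ofReal (2 * a) *
        ∫⁻ t in Ioc 0 (2 * a), F (y + (a - t) • v) ^ 2 := setLIntegral_mono' hT hpt
    _ ≤ ∫⁻ y, ENNReal.ofReal (2 * a) *
        ∫⁻ t in Ioc 0 (2 * a), F (y + (a - t) • v) ^ 2 := setLIntegral_le_lintegral _ _
    _ = ENNReal.ofReal (2 * a) * ∫⁻ t in Ioc 0 (2 * a), ∫⁻ y, F (y + (a - t) • v) ^ 2 := by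
        rw [lintegral_const_mul' _ _ ENNReal.ofReal_ne_top, lintegral_lintegral_swap]
        exact (Measurable.pow_const (hFm.comp (by fun_prop)) 2).aemeasurable
    _ = _ := by
        have e : ∀ t : ℝ, ∫⁻ y, F (y + (a - t) • v) ^ 2 = ∫⁻ y in Ω, ‖fderiv ℝ f y‖ₑ ^ 2 :=
          fun t => by rw [lintegral_add_right_eq_self fun y => F y ^ 2, hF2]
        simp only [e]
        rw [setLIntegral_const, Real.volume_Ioc, sub_zero]
        ring

/-- Poincaré's inequality for the boundary values on the base of a tube. -/
theorem lintegral_lintegral_foot_sub_le (hf : ContDiff ℝ 1 f) (hv : ‖v‖ = 1) (hh : Measurable h)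
    {Ω T B : Set (Space d)}
    (hΩ : MeasurableSet Ω) (hT : MeasurableSet T) {a : ℝ} (hTa : ∀ y ∈ T, h y ∈ Ioo 0 a)
    (hTΩ : ∀ y ∈ T, ∀ t ∈ Ioc (-h y) a, y + t • v ∈ Ω) (hB : Convex ℝ B) (hBm : MeasurableSet B)
    (hBΩ : B ⊆ Ω) (hTB : ∀ y ∈ T, y + a • v ∈ B) {D : ℝ} (hD : 0 < D)
    (hBD : ∀ y ∈ B, ∀ y' ∈ B, ‖y - y'‖ ≤ D) :
    ∫⁻ y in T, ∫⁻ y' in T, ‖f (foot h v y) - f (foot h v y')‖ₑ ^ 2 ≤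
      (6 * volume T * ENNReal.ofReal (2 * a) ^ 2 +
        16 * (ENNReal.ofReal (D / 2) ^ 2 * 2 ^ d * volume B)) *
          ∫⁻ y in Ω, ‖fderiv ℝ f y‖ₑ ^ 2 := by
  have hfm : Measurable f := hf.continuous.measurable
  have hfoot : Measurable (foot h v) := measurable_foot hh
  have h1 := lintegral_foot_sub_le hf hv hΩ hT hTa hTΩ
  have h2 := lintegral_lintegral_sub_le hf hB hBm hD hBD
  have h3 : ∫⁻ y in T, ∫⁻ y' in T, ‖f (y + a • v) - f (y' + a • v)‖ₑ ^ 2 ≤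
      ∫⁻ y in B, ∫⁻ y' in B, ‖f y - f y'‖ₑ ^ 2 := by
    refine le_trans (lintegral_mono fun y => ?_) (setLIntegral_comp_add_le hT hBm hTB
      fun y => ∫⁻ y' in B, ‖f y - f y'‖ₑ ^ 2)
    exact setLIntegral_comp_add_le hT hBm hTB fun y' => ‖f (y + a • v) - f y'‖ₑ ^ 2
  have h4 : ∫⁻ y in B, ‖fderiv ℝ f y‖ₑ ^ 2 ≤ ∫⁻ y in Ω, ‖fderiv ℝ f y‖ₑ ^ 2 :=
    lintegral_mono_set hBΩ
  -- Two feet are compared through the lifted points, which lie in the convex set `B`. Splitting the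
  -- square twice gives the weights `2`, `4`, `4`, hence `6 = 2 + 4`, and `16 = 4 · 4` with the
  -- constant on `B`.
  calc _ ≤ ∫⁻ y in T, ∫⁻ y' in T, (2 * ‖f (foot h v y) - f (y + a • v)‖ₑ ^ 2 +
          (4 * ‖f (y + a • v) - f (y' + a • v)‖ₑ ^ 2 +
            4 * ‖f (foot h v y') - f (y' + a • v)‖ₑ ^ 2)) := by
        refine lintegral_mono fun y => lintegral_mono fun y' => ?_
        refine (enorm_sub_sq_le (b := f (y + a • v))).trans ?_
        rw [mul_add]
        gcongr
        refine (mul_le_mul' le_rfl (enorm_sub_sq_le (b := f (y' + a • v)))).trans (le_of_eq ?_)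
        rw [enorm_sub_rev (f (foot h v y'))]
        ring
    _ = 2 * (volume T * ∫⁻ y in T, ‖f (foot h v y) - f (y + a • v)‖ₑ ^ 2) +
          (4 * (∫⁻ y in T, ∫⁻ y' in T, ‖f (y + a • v) - f (y' + a • v)‖ₑ ^ 2) +
          4 * (volume T * ∫⁻ y in T, ‖f (foot h v y) - f (y + a • v)‖ₑ ^ 2)) := by
        have e : ∀ y, ∫⁻ y' in T, (2 * ‖f (foot h v y) - f (y + a • v)‖ₑ ^ 2 +
          (4 * ‖f (y + a • v) - f (y' + a • v)‖ₑ ^ 2 +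
            4 * ‖f (foot h v y') - f (y' + a • v)‖ₑ ^ 2)) =
            (2 * volume T) * ‖f (foot h v y) - f (y + a • v)‖ₑ ^ 2 +
            (4 * (∫⁻ y' in T, ‖f (y + a • v) - f (y' + a • v)‖ₑ ^ 2) +
            4 * ∫⁻ y' in T, ‖f (foot h v y') - f (y' + a • v)‖ₑ ^ 2) := by
          intro y
          rw [lintegral_add_left (by fun_prop), lintegral_add_left (by fun_prop),
            lintegral_const_mul' _ _ ENNReal.ofNat_ne_top,
            lintegral_const_mul' _ _ ENNReal.ofNat_ne_top, setLIntegral_const,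
            lintegral_const_mul' _ _ ENNReal.ofNat_ne_top]
          ring
        simp only [e]
        rw [lintegral_add_left (by fun_prop), lintegral_add_left (by fun_prop),
            lintegral_const_mul _ (by fun_prop),
            lintegral_const_mul' _ _ ENNReal.ofNat_ne_top, setLIntegral_const]
        ring
    _ ≤ 2 * (volume T * (ENNReal.ofReal (2 * a) ^ 2 * ∫⁻ y in Ω, ‖fderiv ℝ f y‖ₑ ^ 2)) +
          (4 * (4 * (ENNReal.ofReal (D / 2) ^ 2 * 2 ^ d * volume B *
            ∫⁻ y in Ω, ‖fderiv ℝ f y‖ₑ ^ 2)) +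
          4 * (volume T * (ENNReal.ofReal (2 * a) ^ 2 * ∫⁻ y in Ω, ‖fderiv ℝ f y‖ₑ ^ 2))) := by
        gcongr
        exact h3.trans (h2.trans (by gcongr))
    _ = _ := by ring

end Poincare

/-! ### Infinitesimal rotations on a boundary piece -/

section Rigid

variable {d : ℕ}

/-- The diagonal vanishes, so if `A i j ≠ 0` the rows `i` and `j` are independent, each having a
zero where the other has none. The kernel therefore lies in a space of codimension two. -/
theorem exists_submodule_of_antisymm {A : Fin d → Fin d → ℝ} (hA : ∀ i j, A i j = -A j i)
    (hA0 : A ≠ 0) : ∃ V : Submodule ℝ (Space d), Module.finrank ℝ V < d - 1 ∧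
      ∀ x : Space d, (∀ i, ∑ j, A i j * x j = 0) → x ∈ V := by
  obtain ⟨i, j, hij⟩ : ∃ i j, A i j ≠ 0 := by
    by_contra! h
    exact hA0 (funext fun i => funext fun j => h i j)
  have hii : ∀ i, A i i = 0 := fun i => by linarith [hA i i]
  have hne : i ≠ j := fun h => hij (by rw [h, hii])
  have hji : A j i ≠ 0 := by
    rw [hA j i]
    exact neg_ne_zero.2 hij
  let w : Fin 2 → Space d := ![WithLp.toLp 2 (A i), WithLp.toLp 2 (A j)]
  have hw : LinearIndependent ℝ w := by
    rw [LinearIndependent.pair_iff]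
    intro s t hst
    have h1 := congrArg (fun x : Space d => x i) hst
    have h2 := congrArg (fun x : Space d => x j) hst
    simp [hii, hij, hji] at h1 h2
    exact ⟨h2, h1⟩
  refine ⟨(Submodule.span ℝ (range w))ᗮ, ?_, fun x hx => ?_⟩
  · have h1 := (Submodule.span ℝ (range w)).finrank_add_finrank_orthogonal
    rw [finrank_span_eq_card hw, finrank_euclideanSpace_fin, Fintype.card_fin] at h1
    omega
  · rw [Submodule.mem_orthogonal]
    intro y hy
    induction hy using Submodule.span_induction with
    | mem y hy =>
      have e : ∀ k, inner ℝ (WithLp.toLp 2 (A k) : Space d) x = 0 := fun k => by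
        rw [← hx k, PiLp.inner_apply]
        refine Finset.sum_congr rfl fun l _ => ?_
        simp [mul_comm]
      obtain ⟨k, rfl⟩ := hy
      fin_cases k
      · exact e i
      · exact e j
    | zero => simp
    | add y z _ _ h1 h2 => rw [inner_add_left, h1, h2, add_zero]
    | smul c y _ h1 => rw [real_inner_smul_left, h1, mul_zero]

/-- The mean square oscillation on `T` of the rotation field `A (X y)`. -/
def rotationEnergy (μ : Measure (Space d)) (X : Space d → Space d) (A : Fin d → Fin d → ℝ) :
    ℝ≥0∞ :=
  ∫⁻ z, ∑ i, ‖∑ j, A i j * (X z.1 j - X z.2 j)‖ₑ ^ 2 ∂(μ.prod μ)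

variable {μ : Measure (Space d)} {X : Space d → Space d}

theorem measurable_rotation (hX : Measurable X) (A : Fin d → Fin d → ℝ) :
    Measurable fun z : Space d × Space d => ∑ i, ‖∑ j, A i j * (X z.1 j - X z.2 j)‖ₑ ^ 2 := by
  have h1 : ∀ j, Measurable fun y => X y j := fun j => by fun_prop
  have h2 : ∀ j, Measurable fun z : Space d × Space d => X z.1 j - X z.2 j := fun j =>
    ((h1 j).comp measurable_fst).sub ((h1 j).comp measurable_snd)
  fun_prop

theorem rotationEnergy_smul (c : ℝ) (A : Fin d → Fin d → ℝ) :
    rotationEnergy μ X (fun i j => c * A i j) = ‖c‖ₑ ^ 2 * rotationEnergy μ X A := by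
  unfold rotationEnergy
  rw [← lintegral_const_mul' _ _ (by finiteness)]
  refine lintegral_congr fun z => ?_
  rw [Finset.mul_sum]
  refine Finset.sum_congr rfl fun i _ => ?_
  rw [← mul_pow, ← enorm_mul, Finset.mul_sum]
  simp only [mul_assoc]

/-- Fatou; no integrability of `X` is needed, and the energy may be infinite. -/
theorem lowerSemicontinuous_rotationEnergy (hX : Measurable X) :
    LowerSemicontinuous (rotationEnergy μ X) := by
  intro A
  refine lowerSemicontinuousAt_iff_le_liminf.2 ?_
  refine le_trans (le_of_eq ?_) (lintegral_liminf_le (fun A => measurable_rotation hX A))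
  refine lintegral_congr fun z => ?_
  refine (Tendsto.liminf_eq ?_).symm
  have : Continuous fun A : Fin d → Fin d → ℝ =>
      ∑ i, ‖∑ j, A i j * (X z.1 j - X z.2 j)‖ₑ ^ 2 := by fun_prop
  exact this.tendsto A

/-- Zero energy would put almost every `X y'` in a translate, through some `X y`, of a space
containing the kernel of `A`, which the hypothesis on `μ` excludes. -/
theorem rotationEnergy_ne_zero [SFinite μ] (hX : Measurable X) (hμ : μ ≠ 0)
    (hμV : ∀ (V : Submodule ℝ (Space d)) (x : Space d), Module.finrank ℝ V < d - 1 →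
      ∀ᵐ y ∂μ, X y - x ∉ V) {A : Fin d → Fin d → ℝ} (hA : ∀ i j, A i j = -A j i)
    (hA0 : A ≠ 0) : rotationEnergy μ X A ≠ 0 := by
  intro h
  rw [rotationEnergy, lintegral_eq_zero_iff (measurable_rotation hX A)] at h
  have : NeBot (ae μ) := ae_neBot.2 hμ
  obtain ⟨V, hV, hVA⟩ := exists_submodule_of_antisymm hA hA0
  obtain ⟨y, hy⟩ := (Measure.ae_ae_of_ae_prod h).exists
  obtain ⟨y', h1, h2⟩ := (hy.and (hμV V (X y) hV)).exists
  refine h2 ?_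
  rw [← neg_sub]
  refine V.neg_mem (hVA _ fun i => ?_)
  have h3 := (Finset.sum_eq_zero_iff.1 h1) i (Finset.mem_univ i)
  simpa using h3

/-- On the compact unit sphere of skew matrices the lower semicontinuous energy attains a positive
minimum; quadratic homogeneity does the rest. -/
theorem exists_le_rotationEnergy [SFinite μ] (hX : Measurable X) (hμ : μ ≠ 0)
    (hμV : ∀ (V : Submodule ℝ (Space d)) (x : Space d), Module.finrank ℝ V < d - 1 →
      ∀ᵐ y ∂μ, X y - x ∉ V) :
    ∃ C : ℝ≥0∞, C ≠ ⊤ ∧ ∀ A : Fin d → Fin d → ℝ, (∀ i j, A i j = -A j i) →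
      ∀ i j, ‖A i j‖ₑ ^ 2 ≤ C * rotationEnergy μ X A := by
  let k : Set (Fin d → Fin d → ℝ) := Metric.sphere 0 1 ∩ {A | ∀ i j, A i j = -A j i}
  have hk : IsCompact k := by
    refine (isCompact_sphere _ _).inter_right ?_
    simp only [ofPred_forall]
    exact isClosed_iInter fun i => isClosed_iInter fun j =>
      isClosed_eq (by fun_prop) (by fun_prop)
  have hmin : ∃ q : ℝ≥0∞, q ≠ 0 ∧ q ≠ ⊤ ∧ ∀ A ∈ k, q ≤ rotationEnergy μ X A := by
    -- The sphere of skew matrices is empty when `d ≤ 1`.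
    rcases k.eq_empty_or_nonempty with h0 | hne
    · exact ⟨1, one_ne_zero, ENNReal.one_ne_top, by simp [h0]⟩
    · obtain ⟨A, hA, hmin⟩ := (lowerSemicontinuous_rotationEnergy (μ := μ) hX
        ).lowerSemicontinuousOn k |>.exists_isMinOn hne hk
      have hA0 : A ≠ 0 := fun h => by
        have := hA.1
        rw [h] at this
        simp at this
      have h1 := rotationEnergy_ne_zero hX hμ hμV hA.2 hA0
      -- Truncation at `1` keeps `q` finite even if the minimal energy is infinite.
      exact ⟨min 1 (rotationEnergy μ X A), (lt_min one_pos (pos_iff_ne_zero.2 h1)).ne',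
        (min_lt_of_left_lt ENNReal.one_lt_top).ne,
        fun B hB => (min_le_right _ _).trans (hmin hB)⟩
  obtain ⟨q, hq0, hqt, hq⟩ := hmin
  refine ⟨q⁻¹, ENNReal.inv_ne_top.2 hq0, fun A hA i j => ?_⟩
  by_cases hA0 : A = 0
  · simp [hA0]
  have hn : 0 < ‖A‖ := norm_pos_iff.2 hA0
  have h1 : (fun i j => ‖A‖⁻¹ * A i j) ∈ k := by
    refine ⟨?_, fun i j => by simp only [hA i j]; ring⟩
    rw [mem_sphere_zero_iff_norm]
    have : (fun i j => ‖A‖⁻¹ * A i j) = ‖A‖⁻¹ • A := rfl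
    rw [this, norm_smul, norm_inv, norm_norm, inv_mul_cancel₀ hn.ne']
  have h2 := hq _ h1
  have h3 : rotationEnergy μ X A =
      ‖‖A‖‖ₑ ^ 2 * rotationEnergy μ X (fun i j => ‖A‖⁻¹ * A i j) := by
    rw [← rotationEnergy_smul]
    congr 1
    funext i j
    rw [mul_inv_cancel_left₀ hn.ne']
  have h4 : ‖A i j‖ₑ ≤ ‖‖A‖‖ₑ := by
    rw [← ofReal_norm, ← ofReal_norm, norm_norm]
    exact ENNReal.ofReal_le_ofReal ((norm_le_pi_norm (A i) j).trans (norm_le_pi_norm A i))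
  rw [h3, mul_left_comm]
  calc ‖A i j‖ₑ ^ 2 ≤ ‖‖A‖‖ₑ ^ 2 * (q⁻¹ * q) := by
        rw [ENNReal.inv_mul_cancel hq0 hqt, mul_one]
        gcongr
    _ ≤ _ := by gcongr

end Rigid

/-! ### A measure on a boundary piece with a Poincaré inequality -/

section BoundaryTube

variable {d : ℕ} {Ω : Set (Space d)}

theorem chart_eq_zero_of_mem_frontier (hΩ : IsOpen Ω) {h : Space d → ℝ} (hh : Continuous h)
    {p : Space d} {r : ℝ} (hr : ∀ y ∈ Metric.ball p r, (y ∈ Ω ↔ 0 < h y)) {x : Space d}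
    (hx : x ∈ frontier Ω) (hxr : x ∈ Metric.ball p r) : h x = 0 := by
  rw [hΩ.frontier_eq] at hx
  refine le_antisymm (not_lt.1 fun h0 => hx.2 ((hr x hxr).2 h0)) (not_lt.1 fun h0 => ?_)
  have h1 : {y | h y < 0} ∩ Metric.ball p r ∈ 𝓝 x :=
    inter_mem ((isOpen_lt hh continuous_const).mem_nhds h0) (Metric.isOpen_ball.mem_nhds hxr)
  obtain ⟨y, hy, hyΩ⟩ := mem_closure_iff_nhds.1 hx.1 _ h1
  exact lt_asymm hy.1 ((hr y hy.2).1 hyΩ)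

/-- A non-negligible piece of the boundary of a Lipschitz domain carries a measure for which a
Poincaré inequality holds. -/
theorem exists_boundary_measure (hΩ : IsLipschitzDomain Ω) {S : Set (Space d)}
    (hS : MeasurableSet S) (hSΩ : S ⊆ frontier Ω)
    (hS0 : Measure.euclideanHausdorffMeasure (d - 1) S ≠ 0) :
    ∃ (μ : Measure (Space d)) (X : Space d → Space d) (C : ℝ≥0∞), IsFiniteMeasure μ ∧ μ ≠ 0 ∧
      Measurable X ∧ C ≠ ⊤ ∧
      μ.map X ≤ C • (Measure.euclideanHausdorffMeasure (d - 1)).restrict S ∧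
      ∀ f : Space d → ℝ, ContDiff ℝ 1 f →
        ∫⁻ y, ∫⁻ y', ‖f (X y) - f (X y')‖ₑ ^ 2 ∂μ ∂μ ≤ C * ∫⁻ y in Ω, ‖fderiv ℝ f y‖ₑ ^ 2 := by
  -- A point of `S` near which `S` is nowhere negligible; if none existed, `S` would be locally
  -- null, hence null.
  obtain ⟨p, hpS, hp⟩ : ∃ p ∈ S, ∀ u ∈ 𝓝[S] p,
      Measure.euclideanHausdorffMeasure (d - 1) u ≠ 0 := by
    by_contra! h
    exact hS0 (measure_null_of_locally_null S h)
  obtain ⟨v, h, K, r, hv, hK, hK1, hr0, hhv, hhp, hr⟩ := hΩ.exists_chart (hSΩ hpS)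
  have hK' : (1 : ℝ) ≤ K := by exact_mod_cast hK1
  have hh : Measurable h := hK.continuous.measurable
  obtain ⟨a, ha, har⟩ : ∃ a, 0 < a ∧ 2 * a < r := ⟨r / 4, by positivity, by linarith⟩
  -- With `4 K b = a`, the function `h` exceeds `a - 2 K b = a / 2` on the ball of radius `2 b`
  -- about `p + a • v`. That ball lies in `Ω` and contains the tube shifted by `a • v`.
  obtain ⟨b, hb, hba⟩ : ∃ b, 0 < b ∧ K * (4 * b) = a :=
    ⟨a / (4 * K), by positivity, by field_simp⟩
  have hb4 : 4 * b ≤ a := by nlinarith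
  have hSm : MeasurableSet (S ∩ Metric.ball p b) := hS.inter measurableSet_ball
  set T := tube h v (S ∩ Metric.ball p b) b with hT
  have hTm : MeasurableSet T := measurableSet_tube hh hSm b
  have hTp : ∀ y ∈ T, ∀ t, dist (y + t • v) p < b + |h y + t| := by
    intro y hy t
    have h1 := dist_foot_le (h := h) hv (y + t • v)
    rw [foot_add_smul hhv, hhv] at h1
    have h2 : dist (foot h v y) p < b := hy.1.2
    have h3 := dist_triangle_left (y + t • v) p (foot h v y)
    linarith
  have hTr : T ⊆ Metric.ball p r := by
    intro y hy
    have h1 := hTp y hy 0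
    rw [zero_smul, add_zero, add_zero, abs_of_pos hy.2.1] at h1
    rw [Metric.mem_ball]
    linarith [hy.2.2]
  have hT0 : volume T ≠ 0 := by
    intro h0
    refine hp (S ∩ Metric.ball p b) (inter_mem self_mem_nhdsWithin
      (nhdsWithin_le_nhds (Metric.ball_mem_nhds p hb))) ?_
    refine euclideanHausdorffMeasure_eq_zero_of_tube hv hK hhv hSm (fun x hx => ?_) hb h0
    exact chart_eq_zero_of_mem_frontier hΩ.isOpen hK.continuous hr (hSΩ hx.1)
      (Metric.ball_subset_ball (by linarith) hx.2)
  have hTfin : volume T ≠ ⊤ := ((measure_mono hTr).trans_lt measure_ball_lt_top).ne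
  have hBΩ : Metric.ball (p + a • v) (2 * b) ⊆ Ω := by
    intro z hz
    have h1 : |h z - a| ≤ K * dist z (p + a • v) := by
      have := hK.dist_le_mul z (p + a • v)
      rwa [hhv, hhp, zero_add, Real.dist_eq] at this
    rw [Metric.mem_ball] at hz
    refine (hr z ?_).2 ?_
    · rw [Metric.mem_ball]
      have h2 := dist_triangle z (p + a • v) p
      have h3 : dist (p + a • v) p = a := by
        rw [dist_self_add_left, norm_smul, hv, mul_one, Real.norm_of_nonneg ha.le]
      linarith
    · have h2 := (abs_le.1 h1).1
      nlinarith
  have key := fun (f : Space d → ℝ) (hf : ContDiff ℝ 1 f) =>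
    lintegral_lintegral_foot_sub_le hf hv hh hΩ.isOpen.measurableSet hTm (a := a)
    (fun y hy => ⟨hy.2.1, by linarith [hy.2.2]⟩) (fun y hy t ht => by
      have h1 := hTp y hy t
      have h2 : 0 < h y + t := by linarith [ht.1]
      rw [abs_of_pos h2] at h1
      refine (hr _ ?_).2 (by rwa [hhv])
      rw [Metric.mem_ball]
      linarith [hy.2.2, ht.2]) (convex_ball (p + a • v) (2 * b)) measurableSet_ball hBΩ
    (fun y hy => by
      have h1 := hTp y hy 0
      rw [zero_smul, add_zero, add_zero, abs_of_pos hy.2.1] at h1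
      rw [Metric.mem_ball, dist_add_right]
      linarith [hy.2.2]) (D := 4 * b) (by positivity) (fun y hy y' hy' => by
      rw [← dist_eq_norm]
      rw [Metric.mem_ball] at hy hy'
      have := dist_triangle_right y y' (p + a • v)
      linarith)
  set C := 6 * volume T * ENNReal.ofReal (2 * a) ^ 2 + 16 * (ENNReal.ofReal (4 * b / 2) ^ 2 *
    2 ^ d * volume (Metric.ball (p + a • v) (2 * b)))
  have hC : C ≠ ⊤ := by
    have : volume (Metric.ball (p + a • v) (2 * b)) ≠ ⊤ := measure_ball_lt_top.ne
    finiteness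
  -- The measure is the volume of a thin tube, read on the boundary through the foot map. Its image
  -- is at most `b` times surface measure, so no surface integration formula is needed.
  refine ⟨volume.restrict T, foot h v, C + ENNReal.ofReal b,
    ⟨by rw [Measure.restrict_apply_univ]; exact hTfin.lt_top⟩, ?_, measurable_foot hh,
    by finiteness, ?_, fun f hf => (key f hf).trans (by gcongr; exact le_self_add)⟩
  · rwa [Ne, Measure.restrict_eq_zero]
  · refine Measure.le_iff.2 fun A hA => ?_
    rw [Measure.map_apply (measurable_foot hh) hA,
      Measure.restrict_apply ((measurable_foot hh) hA), Measure.smul_apply,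
      Measure.restrict_apply hA, smul_eq_mul]
    have h1 : foot h v ⁻¹' A ∩ T = tube h v (A ∩ (S ∩ Metric.ball p b)) b := by
      ext y
      simp only [hT, tube, mem_inter_iff, mem_preimage, mem_ofPred_eq]
      tauto
    rw [h1]
    refine (volume_tube_le hv hh hhv (hA.inter hSm) b).trans ?_
    gcongr
    · exact le_add_self
    · exact inter_subset_left

end BoundaryTube

/-! ### Korn's inequality with a partial boundary condition -/

section KornBoundary

variable {d : ℕ} {Ω : Set (Space d)}

theorem ennreal_sum_sq_le (a : Fin d → ℝ≥0∞) : (∑ j, a j) ^ 2 ≤ d * ∑ j, a j ^ 2 := by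
  have h := lintegral_sq_le (μ := Measure.count) (f := a) (measurable_of_finite a).aemeasurable
  simpa [lintegral_count, tsum_fintype] using h

theorem contDiff_sub_linear {u : Space d → ℝ} (hu : ContDiff ℝ ∞ u) (a : Fin d → ℝ) :
    ContDiff ℝ ∞ fun x => u x - ∑ j, a j * x j := by
  fun_prop

theorem pderiv_sub_linear {u : Space d → ℝ} (hu : ContDiff ℝ ∞ u) (a : Fin d → ℝ) (k : Fin d)
    (x : Space d) : pderiv k (fun x => u x - ∑ j, a j * x j) x = pderiv k u x - a k := by
  let L : Space d →L[ℝ] ℝ := ∑ j, a j • EuclideanSpace.proj j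
  have hL : (fun x => u x - ∑ j, a j * x j) = fun x => u x - L x := by
    funext x
    simp [L]
  rw [hL, pderiv, fderiv_fun_sub (hu.differentiable (by simp) x) L.differentiableAt,
    ContinuousLinearMap.fderiv]
  simp [pderiv, L]

theorem lintegral_fderiv_sub_linear_le [IsFiniteMeasure (volume.restrict Ω)] {u : Space d → ℝ}
    (hu : ContDiff ℝ ∞ u) (hc : HasCompactSupport u) (a : Fin d → ℝ) :
    ∫⁻ y in Ω, ‖fderiv ℝ (fun x => u x - ∑ j, a j * x j) y‖ₑ ^ 2 ≤
      d * ∑ j, ‖gradL2 Ω hu hc j - Lp.const 2 (volume.restrict Ω) (a j)‖ₑ ^ 2 := by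
  have hm : ∀ j, Measurable fun y => ‖pderiv j u y - a j‖ₑ ^ 2 := fun j =>
    (((continuous_pderiv j hu).sub continuous_const).enorm.measurable).pow_const 2
  have h1 : ∀ j, ‖gradL2 Ω hu hc j - Lp.const 2 (volume.restrict Ω) (a j)‖ₑ ^ 2 =
      ∫⁻ y in Ω, ‖pderiv j u y - a j‖ₑ ^ 2 := by
    intro j
    rw [← lintegral_enorm_sq_Lp]
    refine lintegral_congr_ae ?_
    filter_upwards [Lp.coeFn_sub (gradL2 Ω hu hc j) (Lp.const 2 (volume.restrict Ω) (a j)),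
      Lp.coeFn_const (p := 2) (volume.restrict Ω) (a j),
      (memLp_pderiv_test Ω hu hc j).coeFn_toLp] with y h3 h4 h5
    rw [h3, Pi.sub_apply, h4, gradL2, h5, Function.const_apply]
  simp only [h1]
  rw [← lintegral_finsetSum _ fun j _ => hm j, ← lintegral_const_mul' _ _ (by finiteness)]
  refine lintegral_mono fun y => ?_
  refine (pow_le_pow_left' (enorm_fderiv_le_sum_pderiv _ _) 2).trans ?_
  refine (ennreal_sum_sq_le _).trans (le_of_eq ?_)
  simp only [pderiv_sub_linear hu]

theorem lintegral_lintegral_sub_sq_le {μ : Measure (Space d)} {g : Space d → ℝ}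
    (hg : Measurable g) :
    ∫⁻ y, ∫⁻ y', ‖g y - g y'‖ₑ ^ 2 ∂μ ∂μ ≤ 4 * μ univ * ∫⁻ y, ‖g y‖ₑ ^ 2 ∂μ := by
  calc _ ≤ ∫⁻ y, ∫⁻ y', (2 * ‖g y‖ₑ ^ 2 + 2 * ‖g y'‖ₑ ^ 2) ∂μ ∂μ := by
        refine lintegral_mono fun y => lintegral_mono fun y' => ?_
        have := enorm_sub_sq_le (a := g y) (b := 0) (c := g y')
        rwa [sub_zero, zero_sub, enorm_neg, mul_add] at this
    _ = _ := by
        have e : ∀ y, ∫⁻ y', (2 * ‖g y‖ₑ ^ 2 + 2 * ‖g y'‖ₑ ^ 2) ∂μ =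
            2 * μ univ * ‖g y‖ₑ ^ 2 + 2 * ∫⁻ y', ‖g y'‖ₑ ^ 2 ∂μ := by
          intro y
          rw [lintegral_add_left (by fun_prop), lintegral_const,
            lintegral_const_mul _ (by fun_prop)]
          ring
        simp only [e]
        rw [lintegral_add_left (by fun_prop), lintegral_const_mul _ (by fun_prop),
          lintegral_const]
        ring

/-- The rotation `A x` is `u` minus `u - A x`: the oscillation of the former is bounded by the
boundary values, that of the latter is left for the Poincaré inequality. -/
theorem rotationEnergy_le {μ : Measure (Space d)} [SFinite μ] {X : Space d → Space d}
    (hX : Measurable X) {u : Fin d → Space d → ℝ} (hu : ∀ i, Measurable (u i))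
    (A : Fin d → Fin d → ℝ) :
    rotationEnergy μ X A ≤ ∑ i, 2 * (4 * μ univ * ∫⁻ y, ‖u i (X y)‖ₑ ^ 2 ∂μ +
      ∫⁻ y, ∫⁻ y', ‖(u i (X y) - ∑ j, A i j * X y j) -
        (u i (X y') - ∑ j, A i j * X y' j)‖ₑ ^ 2 ∂μ ∂μ) := by
  have hm1 : ∀ i, Measurable fun z : Space d × Space d => ‖∑ j, A i j * (X z.1 j - X z.2 j)‖ₑ ^ 2 :=
    fun i => by fun_prop
  have hm2 : ∀ i, Measurable fun x : Space d => u i x - ∑ j, A i j * x j := fun i => by fun_prop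
  rw [rotationEnergy, lintegral_finsetSum _ fun i _ => hm1 i]
  refine Finset.sum_le_sum fun i _ => ?_
  rw [lintegral_prod _ (hm1 i).aemeasurable]
  have hui := hu i
  have h2i := (hm2 i).comp hX
  have h1 := lintegral_lintegral_sub_sq_le (μ := μ) ((hu i).comp hX)
  have h2m : Measurable fun z : Space d × Space d => (u i (X z.1) - ∑ j, A i j * X z.1 j) -
        (u i (X z.2) - ∑ j, A i j * X z.2 j) :=
    (h2i.comp measurable_fst).sub (h2i.comp measurable_snd)
  calc _ ≤ ∫⁻ y, ∫⁻ y', 2 * (‖u i (X y) - u i (X y')‖ₑ ^ 2 +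
        ‖(u i (X y) - ∑ j, A i j * X y j) - (u i (X y') - ∑ j, A i j * X y' j)‖ₑ ^ 2) ∂μ ∂μ := by
        refine lintegral_mono fun y => lintegral_mono fun y' => ?_
        have e : ∑ j, A i j * (X y j - X y' j) = (u i (X y) - u i (X y')) -
            ((u i (X y) - ∑ j, A i j * X y j) - (u i (X y') - ∑ j, A i j * X y' j)) := by
          simp only [mul_sub, Finset.sum_sub_distrib]
          ring
        rw [e]
        have := enorm_sub_sq_le (a := u i (X y) - u i (X y')) (b := 0)
          (c := (u i (X y) - ∑ j, A i j * X y j) - (u i (X y') - ∑ j, A i j * X y' j))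
        rwa [sub_zero, zero_sub, enorm_neg] at this
    _ = 2 * ((∫⁻ y, ∫⁻ y', ‖u i (X y) - u i (X y')‖ₑ ^ 2 ∂μ ∂μ) +
        ∫⁻ y, ∫⁻ y', ‖(u i (X y) - ∑ j, A i j * X y j) -
          (u i (X y') - ∑ j, A i j * X y' j)‖ₑ ^ 2 ∂μ ∂μ) := by
        simp_rw [lintegral_const_mul' 2 _ ENNReal.ofNat_ne_top]
        rw [← lintegral_add_left (by fun_prop)]
        congr 1
        refine lintegral_congr fun y => ?_
        rw [lintegral_add_left (by fun_prop)]
    _ ≤ _ := by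
        gcongr
        exact h1

/-- Korn's inequality for smooth vector fields, with the boundary values on a non-negligible piece
of the boundary. -/
theorem korn_boundary (hΩ : IsLipschitzDomain Ω) {S : Set (Space d)}
    (hS : MeasurableSet S) (hSΩ : S ⊆ frontier Ω)
    (hS0 : Measure.euclideanHausdorffMeasure (d - 1) S ≠ 0) :
    ∃ C : ℝ≥0∞, C ≠ ⊤ ∧ ∀ (u : Fin d → Space d → ℝ)
      (hu : ∀ i, ContDiff ℝ ∞ (u i)) (hc : ∀ i, HasCompactSupport (u i)),
      ∑ i, ∑ j, ‖gradL2 Ω (hu i) (hc i) j‖ₑ ^ 2 ≤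
        C * ((∑ i, ∑ j, ‖gradL2 Ω (hu i) (hc i) j + gradL2 Ω (hu j) (hc j) i‖ₑ ^ 2) +
          ∑ i, ∫⁻ x in S, ‖u i x‖ₑ ^ 2 ∂Measure.euclideanHausdorffMeasure (d - 1)) := by
  have hvol : volume Ω ≠ ⊤ := hΩ.isBounded.measure_lt_top.ne
  have : IsFiniteMeasure (volume.restrict Ω) :=
    ⟨by rw [Measure.restrict_apply_univ]; exact hvol.lt_top⟩
  obtain ⟨C₀, hC₀, hmod⟩ := korn_mod_rigid hΩ
  obtain ⟨μ, X, C₁, hμf, hμ0, hX, hC₁, hμS, hPoinc⟩ := exists_boundary_measure hΩ hS hSΩ hS0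
  -- Translates of spaces of codimension two carry no surface measure, hence are null for the image
  -- of `μ`.
  obtain ⟨C₂, hC₂, hrot⟩ := exists_le_rotationEnergy (μ := μ) hX hμ0 fun V x hV => by
    have h1 := euclideanHausdorffMeasure_submodule V hV x
    have hcl : IsClosed ((fun y => x + y) '' (V : Set (Space d))) :=
      (Homeomorph.addLeft x).isClosedMap _ V.closed_of_finiteDimensional
    have h2 := hμS ((fun y => x + y) '' (V : Set (Space d)))
    rw [Measure.map_apply hX hcl.measurableSet, Measure.smul_apply,
      Measure.restrict_apply hcl.measurableSet, measure_mono_null inter_subset_left h1,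
      smul_zero, nonpos_iff_eq_zero] at h2
    refine measure_mono_null (fun y hy => ?_) h2
    have hy' : X y - x ∈ V := by simpa using hy
    exact ⟨X y - x, hy', add_sub_cancel _ _⟩
  have hμu : μ univ ≠ ⊤ := measure_ne_top μ univ
  have hμint : ∀ g : Space d → ℝ, Measurable g → ∫⁻ y, ‖g (X y)‖ₑ ^ 2 ∂μ ≤
      C₁ * ∫⁻ x in S, ‖g x‖ₑ ^ 2 ∂Measure.euclideanHausdorffMeasure (d - 1) := by
    intro g hg
    rw [← lintegral_map (f := fun x => ‖g x‖ₑ ^ 2) (by fun_prop) hX]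
    refine (lintegral_mono' hμS le_rfl).trans ?_
    rw [lintegral_smul_measure, smul_eq_mul]
  refine ⟨d ^ 2 * (2 * (ENNReal.ofReal C₀ ^ 2 + volume Ω * (C₂ *
    (8 * μ univ * C₁ + 2 * C₁ * d ^ 3 * ENNReal.ofReal C₀ ^ 2)))), by finiteness,
    fun u hu hc => ?_⟩
  set G := fun i j => gradL2 Ω (hu i) (hc i) j with hG
  set E : ℝ≥0∞ := ∑ i, ∑ j, ‖G i j + G j i‖ₑ ^ 2 with hE
  set Bd : ℝ≥0∞ := ∑ i, ∫⁻ x in S, ‖u i x‖ₑ ^ 2 ∂Measure.euclideanHausdorffMeasure (d - 1) with hBd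
  have hEt : E ≠ ⊤ := by
    exact ENNReal.sum_ne_top.2 fun i _ => ENNReal.sum_ne_top.2 fun j _ =>
      ENNReal.pow_ne_top enorm_ne_top
  have hδE : ENNReal.ofReal (√E.toReal) ^ 2 = E := by
    rw [← ENNReal.ofReal_pow (Real.sqrt_nonneg _), Real.sq_sqrt ENNReal.toReal_nonneg,
      ENNReal.ofReal_toReal hEt]
  obtain ⟨A, hA, hGA⟩ := hmod u hu hc (√E.toReal) (Real.sqrt_nonneg _) fun i j => by
    have h1 : ‖G i j + G j i‖ₑ ^ 2 ≤ E :=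
      (Finset.single_le_sum (f := fun j => ‖G i j + G j i‖ₑ ^ 2) (fun _ _ => zero_le)
        (Finset.mem_univ j)).trans (Finset.single_le_sum
          (f := fun i => ∑ j, ‖G i j + G j i‖ₑ ^ 2) (fun _ _ => zero_le) (Finset.mem_univ i))
    refine Real.le_sqrt_of_sq_le ?_
    have h2 := ENNReal.toReal_mono hEt h1
    rwa [ENNReal.toReal_pow, toReal_enorm] at h2
  have hGA' : ∀ i j, ‖G i j - Lp.const 2 (volume.restrict Ω) (A i j)‖ₑ ^ 2 ≤
      ENNReal.ofReal C₀ ^ 2 * E := by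
    intro i j
    rw [← hδE, ← mul_pow, ← ENNReal.ofReal_mul hC₀, ← ofReal_norm]
    exact pow_le_pow_left' (ENNReal.ofReal_le_ofReal (hGA i j)) 2
  have hum : ∀ i, Measurable (u i) := fun i => (hu i).continuous.measurable
  -- The field `u i - ∑ j, A i j * x j` has the gradient that `korn_mod_rigid` bounds by `E`, so the
  -- boundary Poincaré inequality controls its oscillation; `d ^ 3` collects one sum over rows and
  -- two dimensional factors from the gradient.
  have hrotle : rotationEnergy μ X A ≤
      (8 * μ univ * C₁ + 2 * C₁ * d ^ 3 * ENNReal.ofReal C₀ ^ 2) * (E + Bd) := by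
    have h1 : ∀ i, ∫⁻ y, ∫⁻ y', ‖(u i (X y) - ∑ j, A i j * X y j) -
        (u i (X y') - ∑ j, A i j * X y' j)‖ₑ ^ 2 ∂μ ∂μ ≤
        C₁ * (d * (d * (ENNReal.ofReal C₀ ^ 2 * E))) := by
      intro i
      refine (hPoinc _ ((contDiff_sub_linear (hu i) (A i)).of_le (by simp))).trans ?_
      gcongr
      refine (lintegral_fderiv_sub_linear_le (hu i) (hc i) (A i)).trans ?_
      gcongr
      simpa using Finset.sum_le_sum fun j (_ : j ∈ Finset.univ) => hGA' i j
    calc _ ≤ _ := rotationEnergy_le hX hum A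
      _ ≤ ∑ i, 2 * (4 * μ univ * (C₁ * ∫⁻ x in S, ‖u i x‖ₑ ^ 2
            ∂Measure.euclideanHausdorffMeasure (d - 1)) +
            C₁ * (d * (d * (ENNReal.ofReal C₀ ^ 2 * E)))) := by
          gcongr with i _
          · exact hμint _ (hum i)
          · exact h1 i
      _ = 8 * μ univ * C₁ * Bd + 2 * C₁ * d ^ 3 * ENNReal.ofReal C₀ ^ 2 * E := by
          simp only [mul_add, Finset.sum_add_distrib, Finset.sum_const, Finset.card_univ,
            Fintype.card_fin, nsmul_eq_mul, hBd, Finset.mul_sum]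
          congr 1
          · refine Finset.sum_congr rfl fun i _ => ?_
            ring
          · ring
      _ ≤ (8 * μ univ * C₁) * (E + Bd) + 2 * C₁ * d ^ 3 * ENNReal.ofReal C₀ ^ 2 * (E + Bd) := by
          gcongr
          · exact le_add_self
          · exact le_self_add
      _ = _ := by ring
  have hij : ∀ i j, ‖G i j‖ₑ ^ 2 ≤ 2 * (ENNReal.ofReal C₀ ^ 2 + volume Ω * (C₂ *
      (8 * μ univ * C₁ + 2 * C₁ * d ^ 3 * ENNReal.ofReal C₀ ^ 2))) * (E + Bd) := by
    intro i j
    have hc1 : ‖Lp.const 2 (volume.restrict Ω) (A i j)‖ₑ ^ 2 = ‖A i j‖ₑ ^ 2 * volume Ω := by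
      rw [← lintegral_enorm_sq_Lp, ← setLIntegral_const]
      refine lintegral_congr_ae ?_
      filter_upwards [Lp.coeFn_const (p := 2) (volume.restrict Ω) (A i j)] with y hy
      rw [hy, Function.const_apply]
    have hc2 : ‖G i j‖ₑ ≤ ‖G i j - Lp.const 2 (volume.restrict Ω) (A i j)‖ₑ +
        ‖Lp.const 2 (volume.restrict Ω) (A i j)‖ₑ := by
      have := enorm_add_le (G i j - Lp.const 2 (volume.restrict Ω) (A i j))
        (Lp.const 2 (volume.restrict Ω) (A i j))
      rwa [sub_add_cancel] at this
    calc _ ≤ 2 * (‖G i j - Lp.const 2 (volume.restrict Ω) (A i j)‖ₑ ^ 2 +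
          ‖Lp.const 2 (volume.restrict Ω) (A i j)‖ₑ ^ 2) :=
          (pow_le_pow_left' hc2 2).trans (ennreal_add_sq_le _ _)
      _ ≤ 2 * (ENNReal.ofReal C₀ ^ 2 * (E + Bd) + (C₂ *
          ((8 * μ univ * C₁ + 2 * C₁ * d ^ 3 * ENNReal.ofReal C₀ ^ 2) * (E + Bd))) *
            volume Ω) := by
          rw [hc1]
          gcongr
          · exact (hGA' i j).trans (by gcongr; exact le_self_add)
          · exact (hrot A hA i j).trans (by gcongr)
      _ = _ := by ring
  calc _ ≤ ∑ _i : Fin d, ∑ _j : Fin d, 2 * (ENNReal.ofReal C₀ ^ 2 + volume Ω * (C₂ *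
      (8 * μ univ * C₁ + 2 * C₁ * d ^ 3 * ENNReal.ofReal C₀ ^ 2))) * (E + Bd) :=
        Finset.sum_le_sum fun i _ => Finset.sum_le_sum fun j _ => hij i j
    _ = _ := by
      simp only [Finset.sum_const, Finset.card_univ, Fintype.card_fin, nsmul_eq_mul]
      ring

end KornBoundary

/-! ### Passage to Sobolev fields and the Korn constant of the model -/

section KornModel

variable {d : ℕ} {Ω : Set (Space d)}

theorem tendsto_gradL2 {φ : ℕ → Space d → ℝ}
    (hφ : ∀ m, ContDiff ℝ ∞ (φ m) ∧ HasCompactSupport (φ m)) {i : Fin d} {g : L2 Ω}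
    (h : Tendsto (fun m => eLpNorm (fun x => pderiv i (φ m) x - g x) 2 (volume.restrict Ω))
      atTop (𝓝 0)) :
    Tendsto (fun m => gradL2 Ω (hφ m).1 (hφ m).2 i) atTop (𝓝 g) := by
  rw [Lp.tendsto_Lp_iff_tendsto_eLpNorm']
  refine h.congr fun m => eLpNorm_congr_ae ?_
  filter_upwards [(memLp_pderiv_test Ω (hφ m).1 (hφ m).2 i).coeFn_toLp] with x hx
  rw [Pi.sub_apply, gradL2, hx]

/-- Off `Γ` the trace `g` vanishes, so `φ` is there its own error of approximation; along an
approximating sequence the boundary term of `korn_boundary` tends to zero. -/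
theorem setLIntegral_le_eLpNorm_trace {Γ : Set (Space d)} (hΓ : MeasurableSet Γ) {φ : Space d → ℝ}
    {g : Lp ℝ 2 (surface Ω)} (hg : ∀ᵐ x ∂(surface Ω), x ∉ Γ → g x = 0) :
    ∫⁻ x in frontier Ω \ Γ, ‖φ x‖ₑ ^ 2 ∂Measure.euclideanHausdorffMeasure (d - 1) ≤
      eLpNorm (fun x => φ x - g x) 2 (surface Ω) ^ 2 := by
  have e : eLpNorm (fun x => φ x - g x) 2 (surface Ω) ^ 2 =
      ∫⁻ x, ‖φ x - g x‖ₑ ^ 2 ∂surface Ω := by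
    rw [eLpNorm_eq_lintegral_rpow_enorm_toReal (by norm_num) (by norm_num),
      ← ENNReal.rpow_natCast, ← ENNReal.rpow_mul]
    norm_num
  have hr : (Measure.euclideanHausdorffMeasure (d - 1)).restrict (frontier Ω \ Γ) =
      (surface Ω).restrict Γᶜ := by
    rw [surface, Measure.restrict_restrict hΓ.compl, inter_comm, sdiff_eq]
  rw [e, hr]
  refine le_trans (le_of_eq ?_) (setLIntegral_le_lintegral Γᶜ _)
  refine setLIntegral_congr_fun_ae hΓ.compl ?_
  filter_upwards [hg] with x hx hxΓ
  rw [hx hxΓ, sub_zero]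

/-- Korn's inequality for `H¹` vector fields vanishing on a non-negligible part of the boundary. -/
theorem korn_H1Zero (hΩ : IsLipschitzDomain Ω) {Γ : Set (Space d)} (hΓ : MeasurableSet Γ)
    (h0 : surface Ω (frontier Ω \ Γ) ≠ 0) :
    ∃ C : ℝ≥0∞, C ≠ ⊤ ∧ ∀ u : Fin d → H1Zero Ω Γ, ∑ i, ∑ j, ‖grad (u i).1 j‖ₑ ^ 2 ≤
      C * ∑ i, ∑ j, ‖grad (u i).1 j + grad (u j).1 i‖ₑ ^ 2 := by
  obtain ⟨C, hC, hK⟩ := korn_boundary hΩ (isClosed_frontier.measurableSet.diff hΓ) sdiff_subset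
    fun h => h0 (measure_mono_null le_rfl
      (nonpos_iff_eq_zero.1 ((Measure.restrict_apply_le _ _).trans_eq h)))
  refine ⟨C, hC, fun u => ?_⟩
  -- The smooth approximants need not vanish on the boundary. This is why the inequality for smooth
  -- fields carries a boundary term instead of a boundary condition.
  choose g hg hg0 using fun i => (u i).2
  choose φ hφ hφ0 hφ1 hφt using hg
  have hG := fun i j => tendsto_gradL2 (hφ i) (hφ1 i j)
  have hB : Tendsto (fun m => ∑ i, eLpNorm (fun x => φ i m x - g i x) 2 (surface Ω) ^ 2)
      atTop (𝓝 0) := by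
    have := tendsto_finsetSum Finset.univ fun i (_ : i ∈ Finset.univ) =>
      ((ENNReal.continuous_pow 2).tendsto _).comp (hφt i)
    simpa using this
  have hL : Tendsto (fun m => ∑ i, ∑ j, ‖gradL2 Ω (hφ i m).1 (hφ i m).2 j‖ₑ ^ 2) atTop
      (𝓝 (∑ i, ∑ j, ‖grad (u i).1 j‖ₑ ^ 2)) :=
    tendsto_finsetSum _ fun i _ => tendsto_finsetSum _ fun j _ =>
      ((ENNReal.continuous_pow 2).tendsto _).comp (hG i j).enorm
  have hR : Tendsto (fun m => ∑ i, ∑ j, ‖gradL2 Ω (hφ i m).1 (hφ i m).2 j +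
      gradL2 Ω (hφ j m).1 (hφ j m).2 i‖ₑ ^ 2) atTop
      (𝓝 (∑ i, ∑ j, ‖grad (u i).1 j + grad (u j).1 i‖ₑ ^ 2)) :=
    tendsto_finsetSum _ fun i _ => tendsto_finsetSum _ fun j _ =>
      ((ENNReal.continuous_pow 2).tendsto _).comp ((hG i j).add (hG j i)).enorm
  have hRB := ENNReal.Tendsto.const_mul (hR.add hB) (Or.inr hC)
  rw [add_zero] at hRB
  refine le_of_tendsto_of_tendsto' hL hRB fun m => ?_
  refine (hK (fun i => φ i m) (fun i => (hφ i m).1) fun i => (hφ i m).2).trans ?_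
  gcongr with i _
  exact setLIntegral_le_eLpNorm_trace hΓ (hg0 i)

/-- Korn's inequality for the fluid velocities. -/
theorem Model.exists_korn (S : Model d) : ∃ c : ℝ, 0 < c ∧ c ≤ 1 ∧ ∀ u : S.Hf,
    c * ∑ i, ∑ j, inner ℝ (grad (u i).1 j) (grad (u i).1 j) ≤
      ∑ i, ∑ j, inner ℝ (S.deform u i j) (S.deform u i j) := by
  have hΓ : MeasurableSet S.Γ := (isClosed_closure.inter isClosed_closure).measurableSet
  obtain ⟨C, hC, hK⟩ := korn_H1Zero S.lipschitz_f hΓ S.dirichlet_f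
  have hC0 : 0 ≤ C.toReal := ENNReal.toReal_nonneg
  -- The factor `4` comes from the `1/2` in `deform`; adding `1` keeps the constant finite and at
  -- most one, even for `C = 0`.
  refine ⟨(4 * C.toReal + 1)⁻¹, by positivity, inv_le_one_of_one_le₀ (by linarith), fun u => ?_⟩
  have ht : ∀ w : Fin d → Fin d → L2 S.Ωf,
      (∑ i, ∑ j, ‖w i j‖ₑ ^ 2) ≠ ⊤ ∧ (∑ i, ∑ j, ‖w i j‖ₑ ^ 2).toReal = ∑ i, ∑ j, ‖w i j‖ ^ 2 := by
    intro w
    have h1 : ∀ i j, ‖w i j‖ₑ ^ 2 ≠ ⊤ := fun i j => ENNReal.pow_ne_top enorm_ne_top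
    have h2 : ∀ i, ∑ j, ‖w i j‖ₑ ^ 2 ≠ ⊤ := fun i => ENNReal.sum_ne_top.2 fun j _ => h1 i j
    refine ⟨ENNReal.sum_ne_top.2 fun i _ => h2 i, ?_⟩
    rw [ENNReal.toReal_sum fun i _ => h2 i]
    refine Finset.sum_congr rfl fun i _ => ?_
    rw [ENNReal.toReal_sum fun j _ => h1 i j]
    refine Finset.sum_congr rfl fun j _ => ?_
    rw [ENNReal.toReal_pow, toReal_enorm]
  have h1 := ENNReal.toReal_mono
    (ENNReal.mul_ne_top hC (ht fun i j => grad (u i).1 j + grad (u j).1 i).1) (hK u)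
  rw [ENNReal.toReal_mul, (ht fun i j => grad (u i).1 j + grad (u j).1 i).2,
    (ht fun i j => grad (u i).1 j).2] at h1
  have h2 : ∀ i j, inner ℝ (S.deform u i j) (S.deform u i j) =
      (1 / 4 : ℝ) * ‖grad (u i).1 j + grad (u j).1 i‖ ^ 2 := by
    intro i j
    rw [real_inner_self_eq_norm_sq, Model.deform, norm_smul, mul_pow]
    norm_num
  simp only [h2, real_inner_self_eq_norm_sq, ← Finset.mul_sum]
  rw [inv_mul_le_iff₀ (by positivity)]
  have h3 : 0 ≤ ∑ i, ∑ j, ‖grad (u i).1 j + grad (u j).1 i‖ ^ 2 := by positivity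
  refine h1.trans ?_
  linarith

end KornModel

end StokesDarcy

end

theorem theorem4p1 {d : ℕ} (hd : 2 ≤ d) (S : StokesDarcy.Model d) :
    ∃ C Ct : ℝ → ℝ,
      (∀ θ ∈ Set.Icc (0 : ℝ) 1, 0 ≤ C θ ∧ 0 ≤ Ct θ) ∧
      (∀ θ ∈ Set.Ico (0 : ℝ) 1, 0 < C θ) ∧
      ∀ (Hfh : Submodule ℝ S.Hf) (Qfh : Submodule ℝ (StokesDarcy.L2 S.Ωf))
        (Hph : Submodule ℝ S.Hp),
      ∀ θ ∈ Set.Icc (0 : ℝ) 1, ∀ (T : ℝ) (N : ℕ) (t : ℕ → ℝ),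
        StokesDarcy.DLN.IsPartition t N T →
      ∀ (F : ℝ → S.Force) (u : ℕ → S.U),
        StokesDarcy.DLN.IsSolution S Hfh Qfh Hph θ t N F u →
      ∀ M : ℕ, 2 ≤ M → M ≤ N →
        ENNReal.ofReal
          (StokesDarcy.DLN.energy S θ (u M) (u (M - 1)) +
            ∑ n ∈ Finset.Icc 1 (M - 1),
              S.norm0 (StokesDarcy.DLN.comb
                (StokesDarcy.DLN.lam θ (StokesDarcy.DLN.eps t n)) u n) ^ 2 +
            C θ * ∑ n ∈ Finset.Icc 1 (M - 1),
              (StokesDarcy.DLN.step t n + StokesDarcy.DLN.step t (n - 1)) *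
                S.normU (StokesDarcy.DLN.comb
                  (StokesDarcy.DLN.β θ (StokesDarcy.DLN.eps t n)) u n) ^ 2) ≤
        ENNReal.ofReal (StokesDarcy.DLN.energy S θ (u 1) (u 0)) +
          ENNReal.ofReal (Ct θ) * ∑ n ∈ Finset.Icc 1 (N - 1),
            ENNReal.ofReal (StokesDarcy.DLN.step t n + StokesDarcy.DLN.step t (n - 1)) *
              S.dualNorm (StokesDarcy.DLN.comb
                (StokesDarcy.DLN.β θ (StokesDarcy.DLN.eps t n)) (fun m => F (t m)) n) ^ 2 := by
  obtain ⟨c, hc0, hc1, hK⟩ := S.exists_korn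
  -- Both constants are those of `absorb`; the first vanishes at `θ = 1`, the second does not depend
  -- on `θ`.
  refine ⟨fun θ => c * (1 - θ) / 4, fun _ => 1 / (2 * c), fun θ hθ => ⟨?_, by positivity⟩,
    fun θ hθ => ?_, fun Hfh Qfh Hph θ hθ T N t ht F u hu M hM2 hMN => ?_⟩
  · have := hθ.2
    have : 0 ≤ 1 - θ := by linarith
    positivity
  · have := hθ.2
    have : 0 < 1 - θ := by linarith
    positivity
  · exact StokesDarcy.DLN.stability_of_korn S hc0 hc1 hK hθ ht hu hM2 hMN
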